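/- Let $n\ge 1$, $p\ge 2$ and $\alpha\in\mathbb R$ with $2n<\alpha p<n+p$, put $s=\alpha-n/p\in(0,1)$, and let $\Omega\subset\mathbb R^n$ be a bounded domain (nonempty, open, connected). Let $W^{s,p}_0(\Omega)$ be the closure of $C_0^\infty(\Omega)$ in the norm $$\|u\|_{W^{s,p}(\Omega)}^p=\int_\Omega\int_\Omega\frac{|u(y)-u(x)|^p}{|y-x|^{sp+n}}\,dx\,dy+\int_\Omega|u|^p\,dx ,$$ its elements being extended by zero to $\mathbb R^n$. A real number $\lambda$ is called an eigenvalue of $\Omega$ if there is $u\in W^{s,p}_0(\Omega)$, $u\not\equiv 0$, such that for all $\phi\in C_0^\infty(\Omega)$ $$\int_{\mathbb R^n}\int_{\mathbb R^n}\frac{|u(y)-u(x)|^{p-2}(u(y)-u(x))(\phi(y)-\phi(x))}{|y-x|^{\alpha p}}\,dx\,dy=\lambda\int_{\mathbb R^n}|u|^{p-2}u\,\phi\,dx .$$ The first eigenvalue is $$\lambda_1=\inf_{\phi\in C_0^\infty(\Omega),\ \phi\not\equiv0}\ \frac{\displaystyle\int_{\mathbb R^n}\int_{\mathbb R^n}\frac{|\phi(y)-\phi(x)|^p}{|y-x|^{\alpha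 p}}\,dx\,dy}{\displaystyle\int_{\mathbb R^n}|\phi|^p\,dx}.$$ **Theorem.** The first eigenvalue is isolated: $\lambda_1$ is an eigenvalue, and no sequence of eigenvalues different from $\lambda_1$ converges to $\lambda_1$. Hence the second eigenvalue $$\lambda_2=\inf\{\lambda:\ \lambda \text{ is an eigenvalue of } \Omega,\ \lambda>\lambda_1\}$$ is well defined (the set is nonempty), it satisfies $\lambda_2>\lambda_1$, and the infimum is attained, i.e. $\lambda_2$ is itself an eigenvalue. -/

import Mathlib

open MeasureTheory Filter Topology
open scoped ENNReal

namespace FracEigen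

noncomputable section

/-- Euclidean space `ℝⁿ` with the Euclidean norm. -/
abbrev Space (n : ℕ) : Type := EuclideanSpace ℝ (Fin n)

/-- A bounded domain of `ℝⁿ`: a bounded, nonempty, open and connected set. -/
structure IsBoundedDomain {n : ℕ} (Ω : Set (Space n)) : Prop where
  isOpen : IsOpen Ω
  isConnected : IsConnected Ω
  isBounded : Bornology.IsBounded Ω

/-- The class `C₀^∞(Ω)`: smooth functions with compact support contained in `Ω`
(defined on all of `ℝⁿ`, hence zero outside `Ω`). -/
structure IsTest {n : ℕ} (Ω : Set (Space n)) (φ : Space n → ℝ) : Prop where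
  smooth : ContDiff ℝ (⊤ : ℕ∞) φ
  compact_support : HasCompactSupport φ
  support_subset : tsupport φ ⊆ Ω

/-- The (possibly infinite) double integral
`∫_D ∫_D |u(y) - u(x)|^p / |y - x|^θ dx dy`. -/
def seminormPow {n : ℕ} (p θ : ℝ) (D : Set (Space n)) (u : Space n → ℝ) : ℝ≥0∞ :=
  ∫⁻ x in D, ∫⁻ y in D, ENNReal.ofReal (|u y - u x| ^ p / ‖y - x‖ ^ θ)

/-- The (possibly infinite) integral `∫_D |u|^p dx`. -/
def lpPow {n : ℕ} (p : ℝ) (D : Set (Space n)) (u : Space n → ℝ) : ℝ≥0∞ :=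
  ∫⁻ x in D, ENNReal.ofReal (|u x| ^ p)

/-- The fractional Sobolev norm of `W^{s,p}(D)`:
`‖u‖^p = ∫_D ∫_D |u(y) - u(x)|^p / |y - x|^{sp+n} dx dy + ∫_D |u|^p dx`. -/
def sobolevNorm {n : ℕ} (s p : ℝ) (D : Set (Space n)) (u : Space n → ℝ) : ℝ≥0∞ :=
  (seminormPow p (s * p + n) D u + lpPow p D u) ^ (1 / p)

/-- Membership in `W₀^{s,p}(Ω)`: the closure of `C₀^∞(Ω)` in the norm of `W^{s,p}(Ω)`,
whose elements are extended by zero to all of `ℝⁿ`. -/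
structure MemSobolevZero {n : ℕ} (s p : ℝ) (Ω : Set (Space n)) (u : Space n → ℝ) : Prop where
  aestronglyMeasurable : AEStronglyMeasurable u volume
  zero_outside : ∀ x ∉ Ω, u x = 0
  finite_norm : sobolevNorm s p Ω u < (⊤ : ℝ≥0∞)
  mem_closure : ∀ ε : ℝ≥0∞, 0 < ε →
    ∃ φ : Space n → ℝ, IsTest Ω φ ∧ sobolevNorm s p Ω (fun x => u x - φ x) < ε

/-- The fractional Rayleigh quotient
`∫∫_{ℝⁿ × ℝⁿ} |φ(y) - φ(x)|^p / |y - x|^{αp} dx dy / ∫_{ℝⁿ} |φ|^p dx`. -/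
def rayleigh {n : ℕ} (α p : ℝ) (φ : Space n → ℝ) : ℝ≥0∞ :=
  seminormPow p (α * p) Set.univ φ / lpPow p Set.univ φ

/-- The first eigenvalue `λ₁(Ω)`: the infimum of the Rayleigh quotient over all
`φ ∈ C₀^∞(Ω)`, `φ ≢ 0`. -/
def firstEigenvalue {n : ℕ} (α p : ℝ) (Ω : Set (Space n)) : ℝ :=
  (sInf {r : ℝ≥0∞ | ∃ φ : Space n → ℝ, IsTest Ω φ ∧ φ ≠ 0 ∧ r = rayleigh α p φ}).toReal

/-- The weak Euler-Lagrange equation with parameter `lam`. -/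
def WeakEquation {n : ℕ} (α p lam : ℝ) (Ω : Set (Space n)) (u : Space n → ℝ) : Prop :=
  ∀ φ : Space n → ℝ, IsTest Ω φ →
    ∫ z : Space n × Space n,
        |u z.2 - u z.1| ^ (p - 2) * (u z.2 - u z.1) * (φ z.2 - φ z.1)
          / ‖z.2 - z.1‖ ^ (α * p)
      = lam * ∫ x : Space n, |u x| ^ (p - 2) * u x * φ x

/-- `u` is an eigenfunction of `Ω` with eigenvalue `lam`: `u ≢ 0`, `u ∈ W₀^{s,p}(Ω)` with
`s = α - n/p`, and the Euler-Lagrange equation holds for all test functions. -/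
structure IsEigenfunction {n : ℕ} (α p lam : ℝ) (Ω : Set (Space n)) (u : Space n → ℝ) :
    Prop where
  mem : MemSobolevZero (α - n / p) p Ω u
  ne_zero : ¬ u =ᵐ[volume] 0
  weak_equation : WeakEquation α p lam Ω u

/-- `lam` is an eigenvalue of `Ω`. -/
def IsEigenvalue {n : ℕ} (α p : ℝ) (Ω : Set (Space n)) (lam : ℝ) : Prop :=
  ∃ u : Space n → ℝ, IsEigenfunction α p lam Ω u

/-- The set of all eigenvalues that are larger than `λ₁(Ω)`. -/
def higherEigenvalues {n : ℕ} (α p : ℝ) (Ω : Set (Space n)) : Set ℝ :=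
  {lam : ℝ | IsEigenvalue α p Ω lam ∧ firstEigenvalue α p Ω < lam}

/-- The second eigenvalue `λ₂(Ω) = inf {λ > λ₁(Ω)}`, the infimum being over eigenvalues. -/
def secondEigenvalue {n : ℕ} (α p : ℝ) (Ω : Set (Space n)) : ℝ :=
  sInf (higherEigenvalues α p Ω)

end

end FracEigen

/-! Put θ = αp, so that sp + n = θ. The condition θ > 2n, i.e. sp > n, is the Morrey regime: finite
energy forces Hölder continuity. Everything therefore takes place in `energySpace`, the continuous
functions vanishing off Ω with finite energy on ℝⁿ. By `Admissible.exists_subseq` (Arzelà–Ascoli),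
bounded energy gives uniformly convergent subsequences, under which the mass is continuous and the
energy lower semicontinuous (`energy_fatou`). The energy is the L^p power integral of the increments
u(y) - u(x) for the measure |y - x|^(-θ) dx dy, so the same convexity inequalities serve energy and
mass. By convexity, solving A u = λ B w (A, B the derivatives of energy and mass up to the factor p)
is the same as minimising ψ ↦ E(ψ) - pλ⟨Bw, ψ⟩. This form survives uniform limits
(`Solves.of_tendsto`), hence the set of eigenvalues is closed.

The energy space is W₀^{s,p}(Ω). The Hardy inequality `hardy` makes the energy on Ω × Ω control that
on ℝⁿ × ℝⁿ, so closures of test functions have continuous representatives. Conversely, truncation,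
mollification and Clarkson's inequality make test functions dense
(`Admissible.exists_test_energy_sub_le`).

The direct method makes λ₁ an eigenvalue. The positive part of a first eigenfunction is again a
minimiser, and Picone's inequality gives a minimum principle (`ae_pos_of_supersolution`), so first
eigenfunctions have one sign. Picone also shows that a nonnegative eigenfunction can only belong to
λ₁ (`Solves.eq_of_nonneg`). All other eigenfunctions change sign, and both {u > 0} and {u < 0} have
measure at least a constant over λ (`Admissible.exists_nodal_bound`).

Isolation: if eigenvalues λₖ ≠ λ₁ tended to λ₁, normalised eigenfunctions would converge uniformly
to a first eigenfunction v, say v ≥ 0. Then {uₖ < 0} lies, up to a null set, where v is positive but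
tiny, a set of measure tending to 0. This contradicts the nodal bound.

Existence of a higher eigenvalue: let c be the infimum of the levels at which a connected set of
nonzero functions joins a nonnegative function to a nonpositive one. Such a set contains a function
of mean zero, and a first eigenfunction never has mean zero, so compactness gives c > λ₁. In place
of a deformation flow, the continuous, sign-preserving solution operator T of A(Tv) = c B v is
applied to nearly optimal connected sets. Since c cannot be lowered, some v has quotient about at
most c while Tv has quotient about at least c, and in the limit equality in Young's inequality makes
v an eigenfunction (`Solves.isEigen_of_energy_le`). Closedness of the spectrum and isolation then
give λ₂. -/

namespace FracEigen

open scoped BoundedContinuousFunction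

/-! ### The duality map `t ↦ |t|^(p-2) t` and pointwise inequalities -/

/-- The scalar duality map `t ↦ |t|^(p-2) t`. -/
noncomputable def dualPow (p t : ℝ) : ℝ := |t| ^ (p - 2) * t

@[simp] lemma dualPow_zero (p : ℝ) : dualPow p 0 = 0 := by simp [dualPow]

lemma dualPow_neg (p t : ℝ) : dualPow p (-t) = -dualPow p t := by simp [dualPow]

lemma dualPow_of_nonneg {p t : ℝ} (hp : 2 ≤ p) (ht : 0 ≤ t) : dualPow p t = t ^ (p - 1) := by
  rcases ht.eq_or_lt with rfl | h
  · rw [dualPow_zero, Real.zero_rpow (by linarith)]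
  · rw [dualPow, abs_of_pos h, show p - 1 = (p - 2) + 1 by ring, Real.rpow_add_one h.ne']

lemma abs_dualPow {p : ℝ} (hp : 2 ≤ p) (t : ℝ) : |dualPow p t| = |t| ^ (p - 1) := by
  rw [← dualPow_of_nonneg hp (abs_nonneg t), dualPow, dualPow, abs_mul, abs_abs,
    abs_of_nonneg (by positivity)]

lemma dualPow_mul_self {p : ℝ} (hp : 2 ≤ p) (t : ℝ) : dualPow p t * t = |t| ^ p := by
  rcases eq_or_ne t 0 with rfl | h
  · simp [Real.zero_rpow (show p ≠ 0 by linarith)]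
  · have h' : |t| ≠ 0 := abs_ne_zero.2 h
    rw [dualPow, mul_assoc, ← abs_mul_abs_self t, ← mul_assoc, ← Real.rpow_add_one h',
      ← Real.rpow_add_one h']
    ring_nf

lemma continuous_dualPow {p : ℝ} (hp : 2 ≤ p) : Continuous (dualPow p) :=
  (continuous_abs.rpow_const fun _ => Or.inr (by linarith)).mul continuous_id

lemma dualPow_smul {p c : ℝ} (hp : 2 ≤ p) (hc : 0 ≤ c) (t : ℝ) :
    dualPow p (c * t) = c ^ (p - 1) * dualPow p t := by
  rw [← dualPow_of_nonneg hp hc, dualPow, dualPow, dualPow, abs_mul,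
    Real.mul_rpow (abs_nonneg _) (abs_nonneg _), abs_of_nonneg hc]
  ring

/-- Young's inequality for a^(p-1) and b with exponents p/(p-1) and p, multiplied by p. -/
lemma abs_rpow_sub_mul_le {p : ℝ} (hp : 2 ≤ p) {a b : ℝ} (ha : 0 ≤ a) (hb : 0 ≤ b) :
    p * a ^ (p - 1) * b ≤ (p - 1) * a ^ p + b ^ p := by
  have hp0 : (0 : ℝ) < p := by linarith
  have h := Real.young_inequality_of_nonneg (a := a ^ (p - 1)) (b := b) (p := p / (p - 1)) (q := p)
    (by positivity) hb (Real.HolderConjugate.symm (Real.HolderConjugate.conjExponent (by linarith)))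
  rw [← Real.rpow_mul ha, show (p - 1) * (p / (p - 1)) = p by
    field_simp [show p - 1 ≠ 0 by linarith]] at h
  have := mul_le_mul_of_nonneg_left h hp0.le
  have hp1 : p - 1 ≠ 0 := by linarith
  calc p * a ^ (p - 1) * b = p * (a ^ (p - 1) * b) := by ring
    _ ≤ _ := this
    _ = _ := by field_simp

/-- The tangent inequality for the convex function `|t|^p`. -/
lemma abs_rpow_add_dualPow_le {p : ℝ} (hp : 2 ≤ p) (a b : ℝ) :
    |a| ^ p + p * (dualPow p a * (b - a)) ≤ |b| ^ p := by
  have h1 := abs_rpow_sub_mul_le hp (abs_nonneg a) (abs_nonneg b)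
  have h2 : dualPow p a * b ≤ |a| ^ (p - 1) * |b| := by
    rw [← abs_dualPow hp, ← abs_mul]; exact le_abs_self _
  have h3 := dualPow_mul_self hp a
  have := mul_le_mul_of_nonneg_left h2 (show 0 ≤ p by linarith)
  rw [mul_sub, h3]
  linarith

/-- Write |x|^p = (x²)^(p/2). Since p/2 ≥ 1, this power is superadditive and convex on [0, ∞), and
the parallelogram identity links the two estimates. -/
lemma clarkson {p : ℝ} (hp : 2 ≤ p) (a b : ℝ) :
    |(a + b) / 2| ^ p + |(a - b) / 2| ^ p ≤ (|a| ^ p + |b| ^ p) / 2 := by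
  have key : ∀ x : ℝ, |x| ^ p = (x ^ 2) ^ (p / 2) := by
    intro x
    rw [← sq_abs, ← Real.rpow_natCast, ← Real.rpow_mul (abs_nonneg x)]
    congr 1; push_cast; ring
  rw [key, key, key, key]
  have h1 := Real.add_rpow_le_rpow_add (p := p / 2) (sq_nonneg ((a + b) / 2))
    (sq_nonneg ((a - b) / 2)) (by linarith)
  have h2 := (convexOn_rpow (p := p / 2) (by linarith)).2 (x := a ^ 2) (y := b ^ 2)
    (Set.mem_Ici.2 (sq_nonneg a)) (Set.mem_Ici.2 (sq_nonneg b))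
    (by norm_num : (0 : ℝ) ≤ 1 / 2) (by norm_num : (0 : ℝ) ≤ 1 / 2) (by norm_num)
  simp only [smul_eq_mul] at h2
  have h3 : ((a + b) / 2) ^ 2 + ((a - b) / 2) ^ 2 = 1 / 2 * a ^ 2 + 1 / 2 * b ^ 2 := by ring
  rw [h3] at h1
  linarith

/-- Strong monotonicity of the duality map, the source of uniqueness for A w = c B v. Add the
tangent inequalities at a and at b, both evaluated at the midpoint, and compare with Clarkson. -/
lemma abs_sub_rpow_le {p : ℝ} (hp : 2 ≤ p) (a b : ℝ) :
    |a - b| ^ p ≤ p * 2 ^ (p - 1) / 2 * ((dualPow p a - dualPow p b) * (a - b)) := by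
  have h1 := clarkson hp a b
  have h2 := abs_rpow_add_dualPow_le hp a ((a + b) / 2)
  have h3 := abs_rpow_add_dualPow_le hp b ((a + b) / 2)
  have e : ∀ x : ℝ, |x / 2| ^ p = |x| ^ p / 2 ^ p := fun x => by
    rw [abs_div, abs_two, Real.div_rpow (abs_nonneg _) (by norm_num)]
  rw [e, e] at h1
  rw [e] at h2 h3
  have h4 : (0 : ℝ) < 2 ^ p := by positivity
  have h5 : (2 : ℝ) ^ (p - 1) = 2 ^ p / 2 := by
    rw [Real.rpow_sub_one (by norm_num)]
  rw [h5]
  have h6 : |a - b| ^ p / 2 ^ p ≤ p / 4 * ((dualPow p a - dualPow p b) * (a - b)) := by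
    nlinarith
  rw [div_le_iff₀ h4] at h6
  calc _ ≤ _ := h6
    _ = _ := by ring

/-- A crude Young inequality with a small weight on b. If |a| ≤ δ|b| the first term suffices,
because δ^(p-1) ≤ δ; otherwise |b| < |a|/δ and the second one does. -/
lemma abs_dualPow_mul_le {p δ : ℝ} (hp : 2 ≤ p) (hδ : 0 < δ) (hδ1 : δ ≤ 1) (a b : ℝ) :
    |dualPow p a * b| ≤ δ * |b| ^ p + δ⁻¹ * |a| ^ p := by
  rw [abs_mul, abs_dualPow hp]
  have ha := abs_nonneg a
  have hb := abs_nonneg b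
  generalize |a| = a at *
  generalize |b| = b at *
  have hsplit : ∀ x : ℝ, 0 ≤ x → x ^ (p - 1) * x = x ^ p := by
    intro x hx
    rw [← Real.rpow_add_one' hx (by linarith)]; ring_nf
  rcases le_or_gt a (δ * b) with h | h
  · have : a ^ (p - 1) ≤ δ * b ^ (p - 1) := by
      calc a ^ (p - 1) ≤ (δ * b) ^ (p - 1) := by gcongr; linarith
        _ = δ ^ (p - 1) * b ^ (p - 1) := Real.mul_rpow hδ.le hb
        _ ≤ δ * b ^ (p - 1) := by
          gcongr
          calc δ ^ (p - 1) ≤ δ ^ (1 : ℝ) := Real.rpow_le_rpow_of_exponent_ge hδ hδ1 (by linarith)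
            _ = δ := Real.rpow_one δ
    calc a ^ (p - 1) * b ≤ δ * b ^ (p - 1) * b := by gcongr
      _ = δ * b ^ p := by rw [mul_assoc, hsplit b hb]
      _ ≤ _ := by have : 0 ≤ δ⁻¹ * a ^ p := by positivity
                  linarith
  · have : b ≤ δ⁻¹ * a := by rw [inv_mul_eq_div, le_div_iff₀ hδ]; linarith
    calc a ^ (p - 1) * b ≤ a ^ (p - 1) * (δ⁻¹ * a) := by gcongr
      _ = δ⁻¹ * a ^ p := by rw [← hsplit a ha]; ring
      _ ≤ _ := by have : 0 ≤ δ * b ^ p := by positivity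
                  linarith

lemma abs_dualPow_mul_le_add {p : ℝ} (hp : 2 ≤ p) (a b : ℝ) :
    |dualPow p a * b| ≤ |b| ^ p + |a| ^ p := by
  simpa using abs_dualPow_mul_le hp one_pos le_rfl a b

/-- The positive part is monotone and 1-Lipschitz, so its increment has the sign of a - b and is no
larger. This is what makes u⁺ a useful test function in a nonlocal equation. -/
lemma dualPow_sub_mul_posPart {p : ℝ} (hp : 2 ≤ p) (a b : ℝ) :
    |max a 0 - max b 0| ^ p ≤ dualPow p (a - b) * (max a 0 - max b 0) := by
  have key : ∀ a b : ℝ, b ≤ a →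
      |max a 0 - max b 0| ^ p ≤ dualPow p (a - b) * (max a 0 - max b 0) := by
    intro a b hab
    have h0 : 0 ≤ max a 0 - max b 0 := by simpa using max_le_max_right 0 hab
    have h1 : max a 0 - max b 0 ≤ a - b := by
      rw [sub_le_iff_le_add]
      exact max_le (by linarith [le_max_left b 0]) (by linarith [le_max_right b 0])
    rw [← dualPow_mul_self hp, dualPow_of_nonneg hp h0, dualPow_of_nonneg hp (by linarith)]
    gcongr
    linarith
  rcases le_total b a with h | h
  · exact key a b h
  · have := key b a h
    rw [abs_sub_comm, ← neg_sub b a, dualPow_neg, ← neg_sub (max b 0), neg_mul_neg]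
    exact this

/-- The discrete Picone inequality. -/
lemma picone {p : ℝ} (hp : 2 ≤ p) {a b c d : ℝ} (ha : 0 ≤ a) (hb : 0 ≤ b) (hc : 0 < c)
    (hd : 0 < d) :
    dualPow p (c - d) * (a ^ p / c ^ (p - 1) - b ^ p / d ^ (p - 1)) ≤ |a - b| ^ p := by
  have key : ∀ {a b c d : ℝ}, 0 ≤ a → 0 ≤ b → 0 < c → 0 < d → d < c →
      dualPow p (c - d) * (a ^ p / c ^ (p - 1) - b ^ p / d ^ (p - 1)) ≤ |a - b| ^ p := by
    intro a b c d ha hb hc hd hdc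
    rw [dualPow_of_nonneg hp (by linarith)]
    rcases le_or_gt a b with hab | hab
    · refine le_trans ?_ (by positivity : (0 : ℝ) ≤ |a - b| ^ p)
      refine mul_nonpos_of_nonneg_of_nonpos (Real.rpow_nonneg (by linarith) _) ?_
      rw [sub_nonpos]
      have : d ^ (p - 1) ≤ c ^ (p - 1) := by gcongr; linarith
      gcongr
    · rw [abs_of_pos (by linarith)]
      -- Now b < a and d < c. Jensen's inequality for t ↦ t^p, applied to a = s·((a-b)/s) + t·(b/t)
      -- with s + t = 1, gives a^p ≤ (a-b)^p/s^(p-1) + b^p/t^(p-1), which is the claim after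
      -- multiplication by s^(p-1).
      set s := (c - d) / c with hs
      set t := d / c with ht
      have hs0 : 0 < s := div_pos (by linarith) hc
      have ht0 : 0 < t := div_pos hd hc
      have hst : s + t = 1 := by rw [hs, ht]; field_simp; ring
      have h := (convexOn_rpow (p := p) (by linarith)).2 (x := (a - b) / s) (y := b / t)
        (Set.mem_Ici.2 (div_nonneg (by linarith) hs0.le)) (Set.mem_Ici.2 (by positivity))
        hs0.le ht0.le hst
      simp only [smul_eq_mul] at h
      rw [mul_div_cancel₀ _ hs0.ne', mul_div_cancel₀ _ ht0.ne', sub_add_cancel,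
        Real.div_rpow (by linarith) hs0.le, Real.div_rpow hb ht0.le] at h
      have e : ∀ x : ℝ, 0 < x → x ^ p = x ^ (p - 1) * x := by
        intro x hx; rw [← Real.rpow_add_one hx.ne']; ring_nf
      rw [e s hs0, e t ht0] at h
      have hs1 : 0 < s ^ (p - 1) := by positivity
      have ht1 : 0 < t ^ (p - 1) := by positivity
      have h' : a ^ p ≤ (a - b) ^ p / s ^ (p - 1) + b ^ p / t ^ (p - 1) := by
        refine h.trans_eq ?_
        field_simp
      have e1 : (c - d) ^ (p - 1) = s ^ (p - 1) * c ^ (p - 1) := by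
        rw [← Real.mul_rpow hs0.le hc.le, hs, div_mul_cancel₀ _ hc.ne']
      have e2 : d ^ (p - 1) = t ^ (p - 1) * c ^ (p - 1) := by
        rw [← Real.mul_rpow ht0.le hc.le, ht, div_mul_cancel₀ _ hc.ne']
      rw [e1, e2]
      have hc1 : 0 < c ^ (p - 1) := by positivity
      have : s ^ (p - 1) * c ^ (p - 1) * (a ^ p / c ^ (p - 1) - b ^ p / (t ^ (p - 1) * c ^ (p - 1)))
          = s ^ (p - 1) * (a ^ p - b ^ p / t ^ (p - 1)) := by field_simp
      rw [this]
      calc _ ≤ s ^ (p - 1) * ((a - b) ^ p / s ^ (p - 1)) := by gcongr; linarith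
        _ = _ := by field_simp
  rcases lt_trichotomy d c with h | h | h
  · exact key ha hb hc hd h
  · subst h; simp; positivity
  · have := key hb ha hd hc h
    rw [abs_sub_comm, ← neg_sub d c, dualPow_neg, ← neg_sub (b ^ p / _), neg_mul_neg]
    exact this

/-! ### Elementary integrals -/

/-- Jensen's inequality, obtained from the monotonicity of L^p norms on a probability space.
Non-integrable f needs no separate treatment. -/
lemma ofReal_abs_integral_rpow_le {X : Type*} [MeasurableSpace X] {μ : Measure X}
    [IsProbabilityMeasure μ] {p : ℝ} (hp : 1 ≤ p) {f : X → ℝ} (hf : AEStronglyMeasurable f μ) :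
    ENNReal.ofReal (|∫ x, f x ∂μ| ^ p) ≤ ∫⁻ x, ENNReal.ofReal (|f x| ^ p) ∂μ := by
  have hp0 : 0 < p := by linarith
  have e : ∀ t : ℝ, ENNReal.ofReal (|t| ^ p) = ‖t‖ₑ ^ p := fun t => by
    rw [← ENNReal.ofReal_rpow_of_nonneg (abs_nonneg _) hp0.le, Real.enorm_eq_ofReal_abs]
  simp_rw [e]
  have h1 : ‖∫ x, f x ∂μ‖ₑ ≤ eLpNorm f 1 μ := by
    rw [eLpNorm_one_eq_lintegral_enorm]; exact enorm_integral_le_lintegral_enorm f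
  have h2 : eLpNorm f 1 μ ≤ eLpNorm f (ENNReal.ofReal p) μ :=
    eLpNorm_le_eLpNorm_of_exponent_le (by simpa using hp) hf
  have h3 := eLpNorm_eq_lintegral_rpow_enorm_toReal (μ := μ) (f := f)
    (p := ENNReal.ofReal p) (by simpa using hp0) ENNReal.ofReal_ne_top
  rw [ENNReal.toReal_ofReal hp0.le] at h3
  calc ‖∫ x, f x ∂μ‖ₑ ^ p ≤ (eLpNorm f (ENNReal.ofReal p) μ) ^ p := by
        gcongr; exact h1.trans h2
    _ = _ := by
        rw [h3, ← ENNReal.rpow_mul, one_div, inv_mul_cancel₀ hp0.ne', ENNReal.rpow_one]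

lemma lintegral_add_smul {n : ℕ} {r : ℝ} (hr : 0 < r) (c : Space n) (f : Space n → ℝ≥0∞) :
    ∫⁻ x, f (c + r • x) = ENNReal.ofReal (r⁻¹ ^ n) * ∫⁻ x, f x := by
  have h1 : ∫⁻ x, f (c + r • x) = ∫⁻ y, f (c + y) ∂(Measure.map (r • ·) (volume : Measure (Space n))) := by
    rw [show (fun x : Space n => r • x) = ⇑(Homeomorph.smulOfNeZero r hr.ne').toMeasurableEquiv from rfl,
      lintegral_map_equiv]
    rfl
  rw [h1, Measure.map_addHaar_smul _ hr.ne', lintegral_smul_measure, lintegral_add_left_eq_self]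
  simp [abs_of_pos hr]

lemma setLIntegral_ball_add_smul {n : ℕ} {r : ℝ} (hr : 0 < r) (c : Space n) (f : Space n → ℝ≥0∞) :
    ∫⁻ x in Metric.ball 0 1, f (c + r • x) = ENNReal.ofReal (r⁻¹ ^ n) * ∫⁻ x in Metric.ball c r, f x := by
  rw [← lintegral_indicator Metric.isOpen_ball.measurableSet,
    ← lintegral_indicator Metric.isOpen_ball.measurableSet, ← lintegral_add_smul hr c]
  congr 1
  ext x
  have : c + r • x ∈ Metric.ball c r ↔ x ∈ Metric.ball (0 : Space n) 1 := by
    simp only [Metric.mem_ball, dist_eq_norm, add_sub_cancel_left, sub_zero, norm_smul,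
      Real.norm_of_nonneg hr.le]
    constructor <;> intro h <;> nlinarith
  by_cases hx : x ∈ Metric.ball (0 : Space n) 1
  · rw [Set.indicator_of_mem hx, Set.indicator_of_mem (this.2 hx)]
  · rw [Set.indicator_of_notMem hx, Set.indicator_of_notMem (mt this.1 hx)]

/-- The integral `∫ (1 + |h|)^(-a) dh`. -/
noncomputable def tailConst (n : ℕ) (a : ℝ) : ℝ≥0∞ := ∫⁻ h : Space n, ENNReal.ofReal ((1 + ‖h‖) ^ (-a))

lemma tailConst_lt_top {n : ℕ} {a : ℝ} (ha : (n : ℝ) < a) : tailConst n a < ⊤ :=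
  finite_integral_one_add_norm (by simpa using ha)

lemma lintegral_add_norm_rpow {n : ℕ} {a r : ℝ} (hr : 0 < r) :
    ∫⁻ h : Space n, ENNReal.ofReal ((r + ‖h‖) ^ (-a)) = ENNReal.ofReal (r ^ (n - a)) * tailConst n a := by
  have h := lintegral_add_smul hr (0 : Space n) (fun h => ENNReal.ofReal ((r + ‖h‖) ^ (-a)))
  have e : ∀ x : Space n, ENNReal.ofReal ((r + ‖(0 : Space n) + r • x‖) ^ (-a))
      = ENNReal.ofReal (r ^ (-a)) * ENNReal.ofReal ((1 + ‖x‖) ^ (-a)) := by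
    intro x
    rw [← ENNReal.ofReal_mul (by positivity), ← Real.mul_rpow hr.le (by positivity), zero_add,
      norm_smul, Real.norm_of_nonneg hr.le]
    ring_nf
  simp_rw [e] at h
  rw [lintegral_const_mul' _ _ ENNReal.ofReal_ne_top] at h
  change _ * tailConst n a = _ at h
  have hrn : (r ^ n : ℝ) * r⁻¹ ^ n = 1 := by rw [← mul_pow, mul_inv_cancel₀ hr.ne', one_pow]
  calc _ = ENNReal.ofReal (r ^ n) * (ENNReal.ofReal (r⁻¹ ^ n) * ∫⁻ h : Space n, ENNReal.ofReal ((r + ‖h‖) ^ (-a))) := by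
        rw [← mul_assoc, ← ENNReal.ofReal_mul (by positivity), hrn, ENNReal.ofReal_one, one_mul]
    _ = _ := by
        rw [← h, ← mul_assoc, ← ENNReal.ofReal_mul (by positivity), sub_eq_add_neg,
          Real.rpow_add hr, Real.rpow_natCast]

/-- In polar coordinates the integrand is r^(n-1+p-θ) near the origin, integrable because θ < n + p,
and r^(n-1-θ) at infinity, integrable because θ > n. -/
lemma lintegral_min_norm_rpow_lt_top {n : ℕ} (hn : 1 ≤ n) {p θ : ℝ} (h1 : (n : ℝ) < θ)
    (h2 : θ < n + p) :
    ∫⁻ h : Space n, ENNReal.ofReal ((min 1 ‖h‖) ^ p / ‖h‖ ^ θ) < ⊤ := by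
  have : Nonempty (Fin n) := ⟨⟨0, hn⟩⟩
  have key : Integrable (fun h : Space n => (min 1 ‖h‖) ^ p / ‖h‖ ^ θ) := by
    rw [integrable_fun_norm_addHaar (f := fun t : ℝ => (min 1 t) ^ p / t ^ θ) volume]
    have hn' : ((n - 1 : ℕ) : ℝ) = n - 1 := by push_cast [Nat.cast_sub hn]; ring
    rw [← Set.Ioc_union_Ioi_eq_Ioi (zero_le_one' ℝ)]
    simp only [finrank_euclideanSpace, Fintype.card_fin, smul_eq_mul]
    refine IntegrableOn.union ?_ ?_
    · have : IntegrableOn (fun y : ℝ => y ^ ((n : ℝ) - 1 + p - θ)) (Set.Ioc 0 1) := by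
        rw [← intervalIntegrable_iff_integrableOn_Ioc_of_le zero_le_one]
        exact intervalIntegral.intervalIntegrable_rpow' (by linarith)
      refine this.congr_fun (fun y hy => ?_) measurableSet_Ioc
      change y ^ ((n : ℝ) - 1 + p - θ) = y ^ (n - 1) * (min 1 y ^ p / y ^ θ)
      rw [min_eq_right hy.2, ← Real.rpow_natCast y (n - 1), hn',
        Real.rpow_sub hy.1 ((n : ℝ) - 1 + p) θ, Real.rpow_add hy.1 ((n : ℝ) - 1) p]
      ring
    · have : IntegrableOn (fun y : ℝ => y ^ ((n : ℝ) - 1 - θ)) (Set.Ioi 1) :=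
        integrableOn_Ioi_rpow_of_lt (by linarith) one_pos
      refine this.congr_fun (fun y (hy : 1 < y) => ?_) measurableSet_Ioi
      change y ^ ((n : ℝ) - 1 - θ) = y ^ (n - 1) * (min 1 y ^ p / y ^ θ)
      have hy0 : 0 < y := by linarith
      rw [min_eq_left hy.le, Real.one_rpow, ← Real.rpow_natCast y (n - 1), hn',
        Real.rpow_sub hy0 ((n : ℝ) - 1) θ]
      ring
  exact key.lintegral_lt_top

/-! ### A Morrey inequality on balls -/

/-- The normalised Lebesgue measure on the unit ball. -/
noncomputable def unitBallMeasure (n : ℕ) : Measure (Space n) :=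
  (volume (Metric.ball (0 : Space n) 1))⁻¹ • volume.restrict (Metric.ball 0 1)

lemma volume_unitBall_ne_zero (n : ℕ) : volume (Metric.ball (0 : Space n) 1) ≠ 0 :=
  (Metric.measure_ball_pos volume 0 one_pos).ne'

lemma volume_unitBall_ne_top (n : ℕ) : volume (Metric.ball (0 : Space n) 1) ≠ ⊤ :=
  measure_ball_lt_top.ne

instance (n : ℕ) : IsProbabilityMeasure (unitBallMeasure n) where
  measure_univ := by
    simp [unitBallMeasure, ENNReal.inv_mul_cancel (volume_unitBall_ne_zero n) (volume_unitBall_ne_top n)]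

lemma ae_unitBallMeasure (n : ℕ) : ∀ᵐ x ∂(unitBallMeasure n), x ∈ Metric.ball (0 : Space n) 1 :=
  Measure.ae_smul_measure (ae_restrict_mem Metric.isOpen_ball.measurableSet) _

lemma lintegral_unitBallMeasure {n : ℕ} {r : ℝ} (hr : 0 < r) (c : Space n) (f : Space n → ℝ≥0∞) :
    ∫⁻ x, f (c + r • x) ∂(unitBallMeasure n) =
      (volume (Metric.ball (0 : Space n) 1))⁻¹ * ENNReal.ofReal (r⁻¹ ^ n) * ∫⁻ x in Metric.ball c r, f x := by
  rw [unitBallMeasure, lintegral_smul_measure, setLIntegral_ball_add_smul hr, smul_eq_mul, mul_assoc]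

lemma integrable_comp_unitBallMeasure {n : ℕ} {u : Space n → ℝ} (hu : Continuous u) (r : ℝ)
    (c : Space n) : Integrable (fun x => u (c + r • x)) (unitBallMeasure n) := by
  refine Integrable.smul_measure ?_ (ENNReal.inv_ne_top.2 (volume_unitBall_ne_zero n))
  exact ((hu.comp (by fun_prop : Continuous fun x : Space n => c + r • x)).continuousOn.integrableOn_compact
    (isCompact_closedBall 0 1)).mono_set Metric.ball_subset_closedBall

/-- The difference of the averages is one integral over the product of two probability measures, to
which Jensen applies. -/
lemma average_sub_average_le {n : ℕ} {p : ℝ} (hp : 1 ≤ p) {u : Space n → ℝ} (hu : Continuous u)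
    {r s : ℝ} (hr : 0 < r) (hs : 0 < s) (c d : Space n) :
    ENNReal.ofReal (|∫ x, u (c + r • x) ∂(unitBallMeasure n) - ∫ x, u (d + s • x) ∂(unitBallMeasure n)| ^ p)
      ≤ (volume (Metric.ball (0 : Space n) 1))⁻¹ * ENNReal.ofReal (r⁻¹ ^ n) *
        ((volume (Metric.ball (0 : Space n) 1))⁻¹ * ENNReal.ofReal (s⁻¹ ^ n) *
        ∫⁻ y in Metric.ball c r, ∫⁻ z in Metric.ball d s, ENNReal.ofReal (|u z - u y| ^ p)) := by
  have hi1 := integrable_comp_unitBallMeasure hu r c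
  have hi2 := integrable_comp_unitBallMeasure hu s d
  have h := ofReal_abs_integral_rpow_le (μ := (unitBallMeasure n).prod (unitBallMeasure n)) hp
    (f := fun z => u (c + r • z.1) - u (d + s • z.2)) (by
      refine Continuous.aestronglyMeasurable ?_
      fun_prop)
  rw [integral_sub (hi1.comp_fst _) (hi2.comp_snd _)] at h
  rw [integral_fun_fst (fun x => u (c + r • x)), integral_fun_snd (fun x => u (d + s • x))] at h
  simp only [probReal_univ, one_smul] at h
  refine h.trans (le_of_eq ?_)
  rw [lintegral_prod _ (by
      refine Continuous.aemeasurable ?_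
      refine ENNReal.continuous_ofReal.comp (Continuous.rpow_const ?_ fun _ => Or.inr (by linarith))
      fun_prop)]
  have e : ∀ x, ∫⁻ y, ENNReal.ofReal (|u (c + r • x) - u (d + s • y)| ^ p) ∂(unitBallMeasure n)
      = (volume (Metric.ball (0 : Space n) 1))⁻¹ * ENNReal.ofReal (s⁻¹ ^ n) *
        ∫⁻ z in Metric.ball d s, ENNReal.ofReal (|u z - u (c + r • x)| ^ p) := by
    intro x
    rw [← lintegral_unitBallMeasure hs d (fun z => ENNReal.ofReal (|u z - u (c + r • x)| ^ p))]
    simp_rw [abs_sub_comm]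
  simp_rw [e]
  rw [lintegral_unitBallMeasure hr c (fun y => (volume (Metric.ball (0 : Space n) 1))⁻¹ *
    ENNReal.ofReal (s⁻¹ ^ n) * ∫⁻ z in Metric.ball d s, ENNReal.ofReal (|u z - u y| ^ p))]
  rw [lintegral_const_mul']
  exact ENNReal.mul_ne_top (ENNReal.inv_ne_top.2 (volume_unitBall_ne_zero n)) ENNReal.ofReal_ne_top

lemma lintegral_ball_le_seminormPow {n : ℕ} {p θ : ℝ} (hp : 0 < p) (hθ : 0 ≤ θ) {u : Space n → ℝ}
    {r R : ℝ} (hr : 0 < r) {c d x : Space n} {s : ℝ} (h1 : Metric.ball c r ⊆ Metric.ball x R)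
    (h2 : Metric.ball d s ⊆ Metric.ball c r) :
    ∫⁻ y in Metric.ball c r, ∫⁻ z in Metric.ball d s, ENNReal.ofReal (|u z - u y| ^ p) ≤
      ENNReal.ofReal ((2 * r) ^ θ) * seminormPow p θ (Metric.ball x R) u := by
  rw [seminormPow, ← lintegral_const_mul' _ _ ENNReal.ofReal_ne_top]
  refine (setLIntegral_mono' Metric.isOpen_ball.measurableSet fun y hy => ?_).trans
    (lintegral_mono_set h1)
  rw [← lintegral_const_mul' _ _ ENNReal.ofReal_ne_top]
  refine (setLIntegral_mono' Metric.isOpen_ball.measurableSet fun z hz => ?_).trans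
    (lintegral_mono_set (h2.trans h1))
  rw [← ENNReal.ofReal_mul (by positivity)]
  refine ENNReal.ofReal_le_ofReal ?_
  rcases eq_or_ne z y with rfl | hne
  · simp [Real.zero_rpow hp.ne']
  · have hpos : 0 < ‖z - y‖ := norm_pos_iff.2 (sub_ne_zero.2 hne)
    have hlt : ‖z - y‖ ≤ 2 * r := by
      have a := h2 hz
      have b := hy
      rw [Metric.mem_ball] at a b
      rw [← dist_eq_norm]
      have := dist_triangle_right z y c
      linarith
    rw [mul_div_assoc', le_div_iff₀ (by positivity), mul_comm]
    gcongr

/-- The Morrey inequality in a ball: a continuous function is controlled up to the boundary of the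
ball by its Gagliardo seminorm in the ball. -/
lemma morrey {n : ℕ} {p θ : ℝ} (hp : 1 ≤ p) (hθ : 2 * (n : ℝ) < θ) :
    ∃ C : ℝ, 0 < C ∧ ∀ u : Space n → ℝ, Continuous u → ∀ (x : Space n) (d : ℝ), 0 < d →
      ∀ v ∈ Metric.closedBall x d, ∀ w ∈ Metric.closedBall x d,
      ENNReal.ofReal (|u v - u w| ^ p) ≤
        ENNReal.ofReal (C * d ^ (θ - 2 * n)) * seminormPow p θ (Metric.ball x d) u := by
  have hp0 : 0 < p := by linarith
  have hθ0 : 0 ≤ θ := by have : (0 : ℝ) ≤ n := by positivity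
                         linarith
  set V : ℝ := (volume (Metric.ball (0 : Space n) 1)).toReal with hV
  have hVpos : 0 < V := ENNReal.toReal_pos (volume_unitBall_ne_zero n) (volume_unitBall_ne_top n)
  have hVe : (volume (Metric.ball (0 : Space n) 1))⁻¹ = ENNReal.ofReal V⁻¹ := by
    rw [ENNReal.ofReal_inv_of_pos hVpos, hV, ENNReal.ofReal_toReal (volume_unitBall_ne_top n)]
  set σ : ℝ := θ - 2 * n with hσ
  have hσ0 : 0 < σ := by rw [hσ]; linarith
  -- The factors V⁻¹ normalise the two averages, 2^n comes from the second ball having half the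
  -- radius, and 2^θ from |z - y| ≤ 2r in a ball of radius r.
  set C₁ : ℝ := V⁻¹ * V⁻¹ * 2 ^ n * 2 ^ θ with hC₁
  have hC₁pos : 0 < C₁ := by positivity
  -- Halving the radius r multiplies r^(-2n) r^θ = r^σ by 2^(-σ), so consecutive averages differ by
  -- a geometric sequence of ratio q < 1; this is where θ > 2n enters.
  set q : ℝ := ((1 / 2 : ℝ) ^ σ) ^ (1 / p) with hq
  have hq0 : 0 < q := by positivity
  have hq1 : q < 1 := by
    refine Real.rpow_lt_one (by positivity) (Real.rpow_lt_one (by norm_num) (by norm_num) hσ0) (by positivity)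
  have h1q : 0 < 1 - q := by linarith
  refine ⟨(2 / (1 - q)) ^ p * C₁, by positivity, ?_⟩
  intro u hu x d hd
  set G := seminormPow p θ (Metric.ball x d) u with hG
  rcases eq_or_ne G ⊤ with hGt | hGt
  · intro v _ w _
    rw [hGt, ENNReal.mul_top]
    · exact le_top
    · rw [ne_eq, ENNReal.ofReal_eq_zero, not_le]; positivity
  set g := G.toReal with hg
  have hGg : G = ENNReal.ofReal g := (ENNReal.ofReal_toReal hGt).symm
  have hg0 : 0 ≤ g := ENNReal.toReal_nonneg
  set Q : ℝ := C₁ * d ^ σ * g with hQ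
  have hQ0 : 0 ≤ Q := by positivity
  set m : ℝ := ∫ ξ, u (x + d • ξ) ∂(unitBallMeasure n) with hm
  have key : ∀ w ∈ Metric.closedBall x d, |u w - m| ≤ Q ^ (1 / p) / (1 - q) := by
    intro w hw
    have hxw : ‖x - w‖ ≤ d := by rw [← dist_eq_norm, dist_comm]; exact hw
    set t : ℕ → ℝ := fun k => (1 / 2 : ℝ) ^ k with ht
    have ht0 : ∀ k, 0 < t k := fun k => by positivity
    have ht1 : ∀ k, t k ≤ 1 := fun k => pow_le_one₀ (by norm_num) (by norm_num)
    have hts : ∀ k, t (k + 1) = t k / 2 := fun k => by rw [ht]; simp only [pow_succ]; ring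
    -- The balls B(c k, t k · d) are nested, start with B(x, d) and shrink to w while staying inside
    -- B(x, d), even when w lies on its boundary. Telescoping their averages compares u w with the
    -- average over B(x, d).
    set c : ℕ → Space n := fun k => w + t k • (x - w) with hc
    set a : ℕ → ℝ := fun k => ∫ ξ, u (c k + (t k * d) • ξ) ∂(unitBallMeasure n) with ha
    have ha0 : a 0 = m := by simp [ha, hc, ht, hm]
    have hlim : Tendsto a atTop (𝓝 (u w)) := by
      have htl : Tendsto t atTop (𝓝 0) := tendsto_pow_atTop_nhds_zero_of_lt_one (by norm_num) (by norm_num)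
      have hcl : Tendsto c atTop (𝓝 w) := by
        simpa using (htl.smul_const (x - w)).const_add w
      obtain ⟨M, hM⟩ := (isCompact_closedBall w (2 * d)).exists_bound_of_continuousOn hu.continuousOn
      have : u w = ∫ _ξ, u w ∂(unitBallMeasure n) := by simp
      rw [this]
      refine tendsto_integral_of_dominated_convergence (fun _ => M)
        (fun k => (integrable_comp_unitBallMeasure hu _ _).aestronglyMeasurable)
        (integrable_const _) ?_ ?_
      · intro k
        filter_upwards [ae_unitBallMeasure n] with ξ hξ
        refine hM _ ?_
        rw [mem_ball_zero_iff] at hξ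
        rw [Metric.mem_closedBall, dist_eq_norm]
        have : c k + (t k * d) • ξ - w = t k • (x - w) + (t k * d) • ξ := by
          simp only [hc]; abel
        rw [this]
        refine (norm_add_le _ _).trans ?_
        rw [norm_smul, norm_smul, Real.norm_of_nonneg (ht0 k).le, Real.norm_of_nonneg (by have := ht0 k; positivity)]
        have h3 : t k * ‖x - w‖ ≤ 1 * d := mul_le_mul (ht1 k) hxw (norm_nonneg _) zero_le_one
        have h4 : t k * d * ‖ξ‖ ≤ 1 * d * 1 := by
          have := ht1 k
          have := ht0 k
          gcongr
        linarith
      · refine Eventually.of_forall fun ξ => ?_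
        refine (hu.tendsto w).comp ?_
        have : Tendsto (fun k => c k + (t k * d) • ξ) atTop (𝓝 (w + ((0 : ℝ) * d) • ξ)) :=
          hcl.add ((htl.mul_const d).smul_const ξ)
        simpa using this
    have hstep : ∀ k, dist (a k) (a (k + 1)) ≤ Q ^ (1 / p) * q ^ k := by
      intro k
      have hr := mul_pos (ht0 k) hd
      have hs := mul_pos (ht0 (k + 1)) hd
      have hsub1 : Metric.ball (c k) (t k * d) ⊆ Metric.ball x d := by
        refine Metric.ball_subset_ball' ?_
        have : c k - x = -((1 - t k) • (x - w)) := by simp only [hc]; module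
        rw [dist_eq_norm, this, norm_neg, norm_smul, Real.norm_of_nonneg (by linarith [ht1 k])]
        nlinarith [ht1 k]
      have hsub2 : Metric.ball (c (k + 1)) (t (k + 1) * d) ⊆ Metric.ball (c k) (t k * d) := by
        refine Metric.ball_subset_ball' ?_
        have : c (k + 1) - c k = -((t k / 2) • (x - w)) := by simp only [hc, hts]; module
        rw [dist_eq_norm, this, norm_neg, norm_smul, Real.norm_of_nonneg (by linarith [ht0 k]), hts]
        nlinarith [ht0 k]
      have h1 := average_sub_average_le hp hu hr hs (c k) (c (k + 1))
      have h2 := lintegral_ball_le_seminormPow hp0 hθ0 (u := u) hr hsub1 hsub2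
      rw [← hG, hGg, ← ENNReal.ofReal_mul (by positivity)] at h2
      have h3 : ENNReal.ofReal (|a k - a (k + 1)| ^ p) ≤ ENNReal.ofReal (V⁻¹ * (t k * d)⁻¹ ^ n *
          (V⁻¹ * (t (k + 1) * d)⁻¹ ^ n * ((2 * (t k * d)) ^ θ * g))) := by
        rw [ENNReal.ofReal_mul (by positivity), ENNReal.ofReal_mul (by positivity),
          ENNReal.ofReal_mul (p := V⁻¹ * (t (k + 1) * d)⁻¹ ^ n) (by positivity),
          ENNReal.ofReal_mul (p := V⁻¹) (by positivity)]
        rw [hVe] at h1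
        refine h1.trans ?_
        gcongr
      have h4 : V⁻¹ * (t k * d)⁻¹ ^ n * (V⁻¹ * (t (k + 1) * d)⁻¹ ^ n * ((2 * (t k * d)) ^ θ * g))
          = Q * ((1 / 2 : ℝ) ^ σ) ^ k := by
        have e1 : (2 * (t k * d)) ^ θ = 2 ^ θ * ((t k * d) ^ σ * (t k * d) ^ n * (t k * d) ^ n) := by
          rw [Real.mul_rpow (by norm_num) hr.le, show θ = σ + n + n by rw [hσ]; ring,
            Real.rpow_add hr, Real.rpow_add hr, Real.rpow_natCast]
        have e2 : (t k * d) ^ σ = ((1 / 2 : ℝ) ^ σ) ^ k * d ^ σ := by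
          rw [Real.mul_rpow (ht0 k).le hd.le]
          congr 1
          rw [ht]
          simp only
          rw [← Real.rpow_natCast, ← Real.rpow_mul (by norm_num), mul_comm, Real.rpow_mul (by norm_num),
            Real.rpow_natCast]
        have e3 : (t (k + 1) * d)⁻¹ ^ n = 2 ^ n * (t k * d)⁻¹ ^ n := by
          rw [← mul_pow, hts]; congr 1; field_simp
        have e4 : (t k * d)⁻¹ ^ n * (t k * d) ^ n = 1 := by
          rw [← mul_pow, inv_mul_cancel₀ hr.ne', one_pow]
        rw [e1, e3, e2, hQ, hC₁]
        calc _ = V⁻¹ * V⁻¹ * 2 ^ n * 2 ^ θ * d ^ σ * g * ((1 / 2 : ℝ) ^ σ) ^ k *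
              ((t k * d)⁻¹ ^ n * (t k * d) ^ n) * ((t k * d)⁻¹ ^ n * (t k * d) ^ n) := by ring
          _ = _ := by rw [e4]; ring
      rw [h4, ENNReal.ofReal_le_ofReal_iff (by positivity)] at h3
      have h5 := Real.rpow_le_rpow (by positivity) h3 (by positivity : 0 ≤ 1 / p)
      rw [← Real.rpow_mul (abs_nonneg _), mul_one_div_cancel hp0.ne', Real.rpow_one,
        Real.mul_rpow hQ0 (by positivity)] at h5
      rw [Real.dist_eq]
      refine h5.trans (le_of_eq ?_)
      congr 1
      have hb : 0 ≤ (1 / 2 : ℝ) ^ σ := by positivity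
      rw [hq]
      generalize (1 / 2 : ℝ) ^ σ = b at hb
      rw [← Real.rpow_natCast b, ← Real.rpow_mul hb, mul_comm, Real.rpow_mul hb, Real.rpow_natCast]
    have := dist_le_of_le_geometric_of_tendsto₀ q (Q ^ (1 / p)) hq1 hstep hlim
    rw [ha0, Real.dist_eq, abs_sub_comm] at this
    exact this
  intro v hv w hw
  rw [hGg, ← ENNReal.ofReal_mul (by positivity)]
  refine ENNReal.ofReal_le_ofReal ?_
  have h1 : |u v - u w| ≤ 2 / (1 - q) * Q ^ (1 / p) := by
    have e : u v - u w = (u v - m) - (u w - m) := by ring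
    rw [e]
    refine (abs_sub _ _).trans ?_
    calc _ ≤ _ := add_le_add (key v hv) (key w hw)
      _ = _ := by ring
  calc |u v - u w| ^ p ≤ (2 / (1 - q) * Q ^ (1 / p)) ^ p := by gcongr
    _ = (2 / (1 - q)) ^ p * Q := by
      rw [Real.mul_rpow (by positivity) (by positivity), ← Real.rpow_mul hQ0,
        one_div_mul_cancel hp0.ne', Real.rpow_one]
    _ = _ := by rw [hQ]; ring

/-! ### Finiteness of the energy of test functions and a fractional Hardy inequality -/

lemma measurable_diff_quotient {n : ℕ} (p θ : ℝ) {u : Space n → ℝ} (hu : Measurable u) :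
    Measurable fun z : Space n × Space n => ENNReal.ofReal (|u z.2 - u z.1| ^ p / ‖z.2 - z.1‖ ^ θ) := by
  fun_prop

/-- The integrand vanishes unless x or y lies in the ball B. On either half it is at most a multiple
of k(y - x), and integrating the other variable first leaves |B| ∫ k. -/
lemma seminormPow_lt_top_of_lipschitz {n : ℕ} (hn : 1 ≤ n) {p θ : ℝ} (h1 : (n : ℝ) < θ)
    (h2 : θ < n + p) {φ : Space n → ℝ} {L R : ℝ} (hp : 0 < p)
    (hL : ∀ x y, |φ x - φ y| ≤ L * min 1 ‖x - y‖) (hR : ∀ x ∉ Metric.closedBall (0 : Space n) R, φ x = 0) :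
    seminormPow p θ Set.univ φ < ⊤ := by
  classical
  set B := Metric.closedBall (0 : Space n) R
  have hB : MeasurableSet B := Metric.isClosed_closedBall.measurableSet
  set k : Space n → ℝ≥0∞ := fun h => ENNReal.ofReal ((min 1 ‖h‖) ^ p / ‖h‖ ^ θ) with hk
  have hkm : Measurable k := by rw [hk]; fun_prop
  have hK := lintegral_min_norm_rpow_lt_top hn h1 h2
  change ∫⁻ h, k h < ⊤ at hK
  set ind : Space n → ℝ≥0∞ := B.indicator 1 with hind
  have hindm : Measurable ind := measurable_one.indicator hB
  have hint : ∫⁻ x, ind x = volume B := by rw [hind, lintegral_indicator_one hB]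
  have hVB : volume B < ⊤ := measure_closedBall_lt_top
  have hL0 : 0 ≤ |L| := abs_nonneg L
  have bound : ∀ x y, ENNReal.ofReal (|φ y - φ x| ^ p / ‖y - x‖ ^ θ) ≤
      ENNReal.ofReal (|L| ^ p) * (ind x * k (y - x) + ind y * k (y - x)) := by
    intro x y
    have hmain : ENNReal.ofReal (|φ y - φ x| ^ p / ‖y - x‖ ^ θ) ≤ ENNReal.ofReal (|L| ^ p) * k (y - x) := by
      rw [hk, ← ENNReal.ofReal_mul (by positivity)]
      refine ENNReal.ofReal_le_ofReal ?_
      rw [← mul_div_assoc, ← Real.mul_rpow hL0 (by positivity)]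
      gcongr
      refine (hL y x).trans ?_
      gcongr
      exact le_abs_self L
    by_cases hx : x ∈ B
    · refine hmain.trans ?_
      gcongr
      simp [hind, hx]
    · by_cases hy : y ∈ B
      · refine hmain.trans ?_
        gcongr
        simp [hind, hy]
      · simp [hR x hx, hR y hy, Real.zero_rpow hp.ne']
  have hlt : ∫⁻ x, ∫⁻ y, ENNReal.ofReal (|L| ^ p) * (ind x * k (y - x) + ind y * k (y - x))
      = ENNReal.ofReal (|L| ^ p) * (volume B * (∫⁻ h, k h) + volume B * ∫⁻ h, k h) := by
    have hkn : ∀ h, k (-h) = k h := fun h => by simp [hk]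
    have m1 : Measurable fun z : Space n × Space n => ind z.1 * k (z.2 - z.1) := by fun_prop
    have m2 : Measurable fun z : Space n × Space n => ind z.2 * k (z.2 - z.1) := by fun_prop
    simp_rw [lintegral_const_mul' (ENNReal.ofReal (|L| ^ p)) _ ENNReal.ofReal_ne_top]
    congr 1
    have e : ∀ x, ∫⁻ y, (ind x * k (y - x) + ind y * k (y - x)) =
        ind x * (∫⁻ h, k h) + ∫⁻ y, ind y * k (y - x) := by
      intro x
      rw [lintegral_add_left (by fun_prop), lintegral_const_mul _ (by fun_prop), lintegral_sub_right_eq_self]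
    simp_rw [e]
    rw [lintegral_add_left (by fun_prop), lintegral_mul_const _ hindm, hint]
    congr 1
    rw [lintegral_lintegral_swap m2.aemeasurable]
    have e2 : ∀ y, ∫⁻ x, ind y * k (y - x) = ind y * ∫⁻ h, k h := by
      intro y
      rw [lintegral_const_mul _ (by fun_prop), lintegral_sub_left_eq_self]
    simp_rw [e2]
    rw [lintegral_mul_const _ hindm, hint]
  rw [seminormPow]
  simp only [Measure.restrict_univ]
  refine lt_of_le_of_lt (lintegral_mono fun x => lintegral_mono fun y => bound x y) ?_
  rw [hlt]
  exact ENNReal.mul_lt_top ENNReal.ofReal_lt_top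
    (ENNReal.add_lt_top.2 ⟨ENNReal.mul_lt_top hVB hK, ENNReal.mul_lt_top hVB hK⟩)

lemma IsTest.seminormPow_lt_top {n : ℕ} (hn : 1 ≤ n) {p θ : ℝ} (h1 : (n : ℝ) < θ)
    (h2 : θ < n + p) (hp : 0 < p) {Ω : Set (Space n)} {φ : Space n → ℝ} (hφ : IsTest Ω φ) :
    seminormPow p θ Set.univ φ < ⊤ := by
  obtain ⟨K, hK⟩ := hφ.smooth.lipschitzWith_of_hasCompactSupport hφ.compact_support (by simp)
  obtain ⟨M, hM⟩ := hφ.compact_support.exists_bound_of_continuous hφ.smooth.continuous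
  obtain ⟨R, hR⟩ := hφ.compact_support.isCompact.isBounded.subset_closedBall (0 : Space n)
  have hM0 : 0 ≤ M := (norm_nonneg _).trans (hM 0)
  refine seminormPow_lt_top_of_lipschitz hn h1 h2 (L := K + 2 * M) (R := R) hp ?_ ?_
  · intro x y
    have a : |φ x - φ y| ≤ K * ‖x - y‖ := by
      have := hK.dist_le_mul x y
      rwa [Real.dist_eq, dist_eq_norm] at this
    have b : |φ x - φ y| ≤ 2 * M := by
      refine (abs_sub _ _).trans ?_
      have := hM x; have := hM y
      simp only [Real.norm_eq_abs] at *
      linarith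
    have hK0 : (0 : ℝ) ≤ K := K.2
    rcases le_total 1 ‖x - y‖ with h | h
    · rw [min_eq_left h]; linarith
    · rw [min_eq_right h]
      have := mul_nonneg hM0 (norm_nonneg (x - y))
      nlinarith
  · intro x hx
    exact image_eq_zero_of_notMem_tsupport fun h => hx (hR h)

lemma compl_nonempty_of_isBounded {n : ℕ} (hn : 1 ≤ n) {Ω : Set (Space n)}
    (hΩ : Bornology.IsBounded Ω) : Ωᶜ.Nonempty := by
  have : Nonempty (Fin n) := ⟨⟨0, hn⟩⟩
  rw [Set.nonempty_compl]
  rintro rfl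
  exact NormedSpace.unbounded_univ ℝ (Space n) hΩ

lemma seminormPow_symm_cross {n : ℕ} (p θ : ℝ) {φ : Space n → ℝ} (hφ : Measurable φ)
    (s t : Set (Space n)) :
    ∫⁻ x in s, ∫⁻ y in t, ENNReal.ofReal (|φ y - φ x| ^ p / ‖y - x‖ ^ θ) =
    ∫⁻ x in t, ∫⁻ y in s, ENNReal.ofReal (|φ y - φ x| ^ p / ‖y - x‖ ^ θ) := by
  rw [lintegral_lintegral_swap (measurable_diff_quotient p θ hφ).aemeasurable]
  simp_rw [abs_sub_comm, norm_sub_rev]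

/-- The fractional Hardy inequality: the integral over `Ω × Ωᶜ` is controlled by the one over
`Ω × Ω`. -/
lemma hardy {n : ℕ} {p θ : ℝ} (hp : 1 ≤ p) (hθ : 2 * (n : ℝ) < θ) (hn : 1 ≤ n) :
    ∃ C : ℝ≥0∞, C < ⊤ ∧ ∀ (Ω : Set (Space n)), IsOpen Ω → Ωᶜ.Nonempty → ∀ φ : Space n → ℝ,
      Continuous φ → (∀ x ∉ Ω, φ x = 0) →
      ∫⁻ x in Ω, ∫⁻ y in Ωᶜ, ENNReal.ofReal (|φ y - φ x| ^ p / ‖y - x‖ ^ θ) ≤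
        C * seminormPow p θ Ω φ := by
  have hp0 : 0 < p := by linarith
  have hn1 : (1 : ℝ) ≤ n := by exact_mod_cast hn
  have hθ0 : 0 < θ := by linarith
  -- Morrey is used with an exponent θ' strictly between 2n and θ. The surplus τ gives b = n + τ >
  -- n, which makes the final integral over x converge.
  set θ' : ℝ := (2 * n + θ) / 2 with hθ'
  set τ : ℝ := θ - θ' with hτ
  have hτ0 : 0 < τ := by rw [hτ, hθ']; linarith
  obtain ⟨C, hC, hmor⟩ := morrey (n := n) (θ := θ') hp (by rw [hθ']; linarith)
  set b : ℝ := n + τ with hb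
  have hb0 : 0 < b := by rw [hb]; linarith
  refine ⟨ENNReal.ofReal (2 ^ θ * C * 2 ^ b * 2 ^ τ) * (tailConst n θ * tailConst n b),
    ENNReal.mul_lt_top ENNReal.ofReal_lt_top (ENNReal.mul_lt_top (tailConst_lt_top (by linarith))
      (tailConst_lt_top (by linarith))), ?_⟩
  intro Ω hΩ hne φ hφ hφ0
  have hΩm := hΩ.measurableSet
  set g : Space n × Space n → ℝ≥0∞ := fun z => ENNReal.ofReal (|φ z.2 - φ z.1| ^ p / ‖z.2 - z.1‖ ^ θ')
    with hg
  have hgm : Measurable g := measurable_diff_quotient p θ' hφ.measurable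
  set m : Space n → Space n × Space n → ℝ≥0∞ :=
    fun x z => ENNReal.ofReal ((‖z.2 - z.1‖ / 2 + ‖x - z.1‖) ^ (-b)) with hm
  have hmm : Measurable fun q : Space n × (Space n × Space n) => m q.1 q.2 := by
    rw [hm]; fun_prop
  set ν : Measure (Space n × Space n) := (volume.restrict Ω).prod (volume.restrict Ω) with hν
  have step : ∀ x ∈ Ω, ∫⁻ y in Ωᶜ, ENNReal.ofReal (|φ y - φ x| ^ p / ‖y - x‖ ^ θ) ≤
      ENNReal.ofReal (2 ^ θ * C * 2 ^ b) * tailConst n θ * ∫⁻ z, g z * m x z ∂ν := by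
    intro x hx
    set d := Metric.infDist x Ωᶜ with hd
    have hd0 : 0 < d := (hΩ.isClosed_compl.notMem_iff_infDist_pos hne).1 (by simpa using hx)
    have hball : Metric.ball x d ⊆ Ω := by
      intro y hy
      by_contra hyn
      have := Metric.infDist_le_dist_of_mem (x := x) (show y ∈ Ωᶜ from hyn)
      rw [Metric.mem_ball, dist_comm] at hy
      linarith
    obtain ⟨w, hw, hwd⟩ := hΩ.isClosed_compl.exists_infDist_eq_dist hne x
    have h1 : ENNReal.ofReal (|φ x| ^ p) ≤
        ENNReal.ofReal (C * d ^ (θ' - 2 * n)) * seminormPow p θ' (Metric.ball x d) φ := by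
      have := hmor φ hφ x d hd0 x (Metric.mem_closedBall_self hd0.le) w
        (by rw [Metric.mem_closedBall, dist_comm, ← hwd])
      rwa [hφ0 w hw, sub_zero] at this
    -- Off Ω the function vanishes and |y - x| ≥ d, hence d + |y - x| ≤ 2|y - x|. The singular
    -- kernel is thus replaced by one integrable on the whole space.
    have h2 : ∫⁻ y in Ωᶜ, ENNReal.ofReal (|φ y - φ x| ^ p / ‖y - x‖ ^ θ) ≤
        ENNReal.ofReal (|φ x| ^ p) * (ENNReal.ofReal (2 ^ θ * d ^ (n - θ)) * tailConst n θ) := by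
      calc _ ≤ ∫⁻ y in Ωᶜ, ENNReal.ofReal (|φ x| ^ p) * (ENNReal.ofReal (2 ^ θ) *
            ENNReal.ofReal ((d + ‖y - x‖) ^ (-θ))) := by
            refine setLIntegral_mono' hΩm.compl fun y hy => ?_
            rw [hφ0 y hy, zero_sub, abs_neg, ← ENNReal.ofReal_mul (by positivity),
              ← ENNReal.ofReal_mul (by positivity)]
            refine ENNReal.ofReal_le_ofReal ?_
            have hdy : d ≤ ‖y - x‖ := by
              have := Metric.infDist_le_dist_of_mem (x := x) hy
              rwa [dist_comm, dist_eq_norm] at this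
            have hpos : 0 < ‖y - x‖ := by linarith
            rw [div_eq_mul_inv]
            gcongr
            rw [Real.rpow_neg (by positivity), ← div_eq_mul_inv, inv_eq_one_div,
              div_le_div_iff₀ (by positivity) (by positivity), one_mul,
              ← Real.mul_rpow (by norm_num) (by positivity)]
            gcongr
            linarith
        _ ≤ ∫⁻ y, ENNReal.ofReal (|φ x| ^ p) * (ENNReal.ofReal (2 ^ θ) *
            ENNReal.ofReal ((d + ‖y - x‖) ^ (-θ))) := setLIntegral_le_lintegral _ _
        _ = _ := by
            rw [lintegral_const_mul' _ _ ENNReal.ofReal_ne_top,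
              lintegral_const_mul' _ _ ENNReal.ofReal_ne_top,
              lintegral_sub_right_eq_self (fun h => ENNReal.ofReal ((d + ‖h‖) ^ (-θ))) x,
              lintegral_add_norm_rpow hd0, ENNReal.ofReal_mul (by positivity), mul_assoc]
    -- For y, z in B(x, d) one has |z - y|/2 + |x - y| ≤ 2d. This trades the weight d^(-b), which
    -- depends on Ω, for a kernel that can be integrated in x.
    have h3 : ENNReal.ofReal (d ^ (-b)) * seminormPow p θ' (Metric.ball x d) φ ≤
        ENNReal.ofReal (2 ^ b) * ∫⁻ z, g z * m x z ∂ν := by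
      rw [hν, lintegral_prod _ (by fun_prop), seminormPow,
        ← lintegral_const_mul' _ _ ENNReal.ofReal_ne_top,
        ← lintegral_const_mul' _ _ ENNReal.ofReal_ne_top]
      refine (setLIntegral_mono' Metric.isOpen_ball.measurableSet fun y hy => ?_).trans
        (lintegral_mono_set hball)
      rw [← lintegral_const_mul' _ _ ENNReal.ofReal_ne_top,
        ← lintegral_const_mul' _ _ ENNReal.ofReal_ne_top]
      refine (setLIntegral_mono' Metric.isOpen_ball.measurableSet fun z hz => ?_).trans
        (lintegral_mono_set hball)
      rcases eq_or_ne z y with rfl | hzy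
      · simp [Real.zero_rpow hp0.ne']
      · have hpos : 0 < ‖z - y‖ := norm_pos_iff.2 (sub_ne_zero.2 hzy)
        have hle : (‖z - y‖ / 2 + ‖x - y‖) / 2 ≤ d := by
          rw [Metric.mem_ball] at hy hz
          rw [← dist_eq_norm, ← dist_eq_norm, dist_comm x y]
          have := dist_triangle_right z y x
          linarith
        have hmain : ENNReal.ofReal (d ^ (-b)) ≤ ENNReal.ofReal (2 ^ b) * m x (y, z) := by
          rw [hm, ← ENNReal.ofReal_mul (by positivity)]
          refine ENNReal.ofReal_le_ofReal ?_
          have := Real.rpow_le_rpow_of_nonpos (z := -b) (by positivity) hle (by linarith)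
          rw [Real.div_rpow (by positivity) (by norm_num), Real.rpow_neg (by norm_num : (0 : ℝ) ≤ 2),
            div_inv_eq_mul, mul_comm] at this
          exact this
        calc _ ≤ ENNReal.ofReal (2 ^ b) * m x (y, z) * g (y, z) := by gcongr
          _ = _ := by ring
    have e1 : d ^ (θ' - 2 * n) * d ^ (n - θ) = d ^ (-b) := by
      rw [← Real.rpow_add hd0]; congr 1; rw [hb, hτ]; ring
    calc _ ≤ _ := h2
      _ ≤ ENNReal.ofReal (C * d ^ (θ' - 2 * n)) * seminormPow p θ' (Metric.ball x d) φ *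
          (ENNReal.ofReal (2 ^ θ * d ^ (n - θ)) * tailConst n θ) := by gcongr
      _ = ENNReal.ofReal (2 ^ θ * C) * tailConst n θ *
          (ENNReal.ofReal (d ^ (-b)) * seminormPow p θ' (Metric.ball x d) φ) := by
          have : ENNReal.ofReal (C * d ^ (θ' - 2 * n)) * ENNReal.ofReal (2 ^ θ * d ^ (n - θ)) =
              ENNReal.ofReal (2 ^ θ * C) * ENNReal.ofReal (d ^ (-b)) := by
            rw [← ENNReal.ofReal_mul (by positivity), ← ENNReal.ofReal_mul (by positivity), ← e1]
            ring_nf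
          calc _ = ENNReal.ofReal (C * d ^ (θ' - 2 * n)) * ENNReal.ofReal (2 ^ θ * d ^ (n - θ)) *
                (tailConst n θ * seminormPow p θ' (Metric.ball x d) φ) := by ring
            _ = _ := by rw [this]; ring
      _ ≤ ENNReal.ofReal (2 ^ θ * C) * tailConst n θ *
          (ENNReal.ofReal (2 ^ b) * ∫⁻ z, g z * m x z ∂ν) := by gcongr
      _ = _ := by
          rw [ENNReal.ofReal_mul (p := 2 ^ θ * C) (by positivity)]; ring
  have hfin : ENNReal.ofReal (2 ^ θ * C * 2 ^ b) * tailConst n θ ≠ ⊤ :=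
    ENNReal.mul_ne_top ENNReal.ofReal_ne_top (tailConst_lt_top (by linarith)).ne
  -- The integral over x is a multiple of |z₂ - z₁|^(n-b) = |z₂ - z₁|^(-τ), which restores the
  -- exponent θ' + τ = θ.
  have inner : ∀ z : Space n × Space n, ∫⁻ x, g z * m x z =
      ENNReal.ofReal (2 ^ τ) * tailConst n b *
        ENNReal.ofReal (|φ z.2 - φ z.1| ^ p / ‖z.2 - z.1‖ ^ θ) := by
    intro z
    rcases eq_or_ne z.2 z.1 with h | h
    · simp [hg, h, Real.zero_rpow hp0.ne']
    have hpos : 0 < ‖z.2 - z.1‖ := norm_pos_iff.2 (sub_ne_zero.2 h)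
    rw [lintegral_const_mul' _ _ ENNReal.ofReal_ne_top, hm]
    simp only
    rw [lintegral_sub_right_eq_self (fun h => ENNReal.ofReal ((‖z.2 - z.1‖ / 2 + ‖h‖) ^ (-b))) z.1,
      lintegral_add_norm_rpow (by positivity), ← mul_assoc, ← ENNReal.ofReal_mul (by positivity),
      mul_right_comm, ← ENNReal.ofReal_mul (by positivity)]
    congr 2
    rw [show (n : ℝ) - b = -τ by rw [hb]; ring, Real.div_rpow hpos.le (by norm_num),
      Real.rpow_neg hpos.le, Real.rpow_neg (by norm_num : (0 : ℝ) ≤ 2), div_inv_eq_mul,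
      show θ = θ' + τ by rw [hτ]; ring, Real.rpow_add hpos]
    field_simp
  calc _ ≤ ∫⁻ x in Ω, ENNReal.ofReal (2 ^ θ * C * 2 ^ b) * tailConst n θ * ∫⁻ z, g z * m x z ∂ν :=
        setLIntegral_mono' hΩm step
    _ ≤ ∫⁻ x, ENNReal.ofReal (2 ^ θ * C * 2 ^ b) * tailConst n θ * ∫⁻ z, g z * m x z ∂ν :=
        setLIntegral_le_lintegral _ _
    _ = ENNReal.ofReal (2 ^ θ * C * 2 ^ b) * tailConst n θ * ∫⁻ x, ∫⁻ z, g z * m x z ∂ν :=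
        lintegral_const_mul' _ _ hfin
    _ = ENNReal.ofReal (2 ^ θ * C * 2 ^ b) * tailConst n θ * ∫⁻ z, (∫⁻ x, g z * m x z) ∂ν := by
        rw [lintegral_lintegral_swap]
        exact ((hgm.comp measurable_snd).mul hmm).aemeasurable
    _ = ENNReal.ofReal (2 ^ θ * C * 2 ^ b) * tailConst n θ *
        (ENNReal.ofReal (2 ^ τ) * tailConst n b * seminormPow p θ Ω φ) := by
        simp_rw [inner]
        rw [lintegral_const_mul' _ _ (ENNReal.mul_ne_top ENNReal.ofReal_ne_top
          (tailConst_lt_top (by linarith)).ne), hν,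
          lintegral_prod _ (measurable_diff_quotient p θ hφ.measurable).aemeasurable, seminormPow]
    _ = _ := by
        rw [ENNReal.ofReal_mul (p := 2 ^ θ * C * 2 ^ b) (by positivity)]; ring

/-- The Gagliardo seminorm on the whole space of a continuous function vanishing outside `Ω` is
controlled by the one on `Ω`. -/
lemma seminormPow_univ_le {n : ℕ} {p θ : ℝ} (hp : 1 ≤ p) (hθ : 2 * (n : ℝ) < θ) (hn : 1 ≤ n) :
    ∃ C : ℝ≥0∞, C < ⊤ ∧ ∀ (Ω : Set (Space n)), IsOpen Ω → Ωᶜ.Nonempty → ∀ φ : Space n → ℝ,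
      Continuous φ → (∀ x ∉ Ω, φ x = 0) →
      seminormPow p θ Set.univ φ ≤ C * seminormPow p θ Ω φ := by
  obtain ⟨C, hC, h⟩ := hardy hp hθ hn
  -- The four blocks of Ω and Ωᶜ: the integrand is 0 on Ωᶜ × Ωᶜ, and the two mixed blocks are equal
  -- by symmetry.
  refine ⟨1 + C + C, by simp [hC], ?_⟩
  intro Ω hΩ hne φ hφ hφ0
  have hH := h Ω hΩ hne φ hφ hφ0
  have hΩm := hΩ.measurableSet
  set f : Space n → Space n → ℝ≥0∞ := fun x y => ENNReal.ofReal (|φ y - φ x| ^ p / ‖y - x‖ ^ θ) with hf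
  have hfm : Measurable (Function.uncurry f) := measurable_diff_quotient p θ hφ.measurable
  have e : ∀ x, ∫⁻ y, f x y = (∫⁻ y in Ω, f x y) + ∫⁻ y in Ωᶜ, f x y := fun x => by
    rw [lintegral_add_compl _ hΩm]
  have m1 : Measurable fun x => ∫⁻ y in Ω, f x y := hfm.lintegral_prod_right
  have z : ∫⁻ x in Ωᶜ, ∫⁻ y in Ωᶜ, f x y = 0 := by
    rw [setLIntegral_congr_fun (g := 0) hΩm.compl]
    · simp
    · intro x hx
      simp only [Pi.zero_apply]
      rw [setLIntegral_congr_fun (g := 0) hΩm.compl]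
      · simp
      · intro y hy
        simp [hf, hφ0 x hx, hφ0 y hy, Real.zero_rpow (show p ≠ 0 by linarith)]
  have m2 := seminormPow_symm_cross p θ hφ.measurable Ωᶜ Ω
  calc seminormPow p θ Set.univ φ = ∫⁻ x, ∫⁻ y, f x y := by simp [seminormPow, hf]
    _ = (∫⁻ x in Ω, ((∫⁻ y in Ω, f x y) + ∫⁻ y in Ωᶜ, f x y)) +
        ∫⁻ x in Ωᶜ, ((∫⁻ y in Ω, f x y) + ∫⁻ y in Ωᶜ, f x y) := by
        rw [← lintegral_add_compl _ hΩm]; simp_rw [e]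
    _ = (seminormPow p θ Ω φ + ∫⁻ x in Ω, ∫⁻ y in Ωᶜ, f x y) + ((∫⁻ x in Ω, ∫⁻ y in Ωᶜ, f x y) + 0) := by
        rw [lintegral_add_left m1, lintegral_add_left m1, z, m2]; rfl
    _ ≤ (seminormPow p θ Ω φ + C * seminormPow p θ Ω φ) + C * seminormPow p θ Ω φ := by
        rw [add_zero]; gcongr
    _ = _ := by ring

/-! ### Power integrals and the associated duality pairing -/

section Power

variable {Z : Type*} [MeasurableSpace Z] {μ : Measure Z} {p : ℝ} {f g h : Z → ℝ}

/-- The power integral `∫ |f|^p`. -/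
noncomputable def powInt (p : ℝ) (μ : Measure Z) (f : Z → ℝ) : ℝ := ∫ z, |f z| ^ p ∂μ

/-- The duality pairing `∫ |f|^(p-2) f g`. -/
noncomputable def pair (p : ℝ) (μ : Measure Z) (f g : Z → ℝ) : ℝ := ∫ z, dualPow p (f z) * g z ∂μ

lemma powInt_nonneg : 0 ≤ powInt p μ f := integral_nonneg fun _ => by positivity

lemma integrable_abs_rpow (hp : 2 ≤ p) (hf : MemLp f (ENNReal.ofReal p) μ) :
    Integrable (fun z => |f z| ^ p) μ := by
  have := hf.integrable_norm_rpow (by simp; linarith) ENNReal.ofReal_ne_top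
  rwa [ENNReal.toReal_ofReal (by linarith)] at this

lemma ofReal_powInt (hp : 2 ≤ p) (hf : MemLp f (ENNReal.ofReal p) μ) :
    ENNReal.ofReal (powInt p μ f) = ∫⁻ z, ENNReal.ofReal (|f z| ^ p) ∂μ :=
  ofReal_integral_eq_lintegral_ofReal (integrable_abs_rpow hp hf) (ae_of_all _ fun _ => by positivity)

lemma memLp_of_lintegral_lt_top (hp : 2 ≤ p) (hf : AEStronglyMeasurable f μ)
    (h : ∫⁻ z, ENNReal.ofReal (|f z| ^ p) ∂μ < ⊤) : MemLp f (ENNReal.ofReal p) μ := by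
  rw [← integrable_norm_rpow_iff hf (by simp; linarith) ENNReal.ofReal_ne_top,
    ENNReal.toReal_ofReal (by linarith)]
  refine ⟨?_, ?_⟩
  · exact (hf.norm.aemeasurable.pow_const p).aestronglyMeasurable
  · rwa [hasFiniteIntegral_iff_ofReal (ae_of_all _ fun _ => by positivity)]

lemma aestronglyMeasurable_dualPow (hp : 2 ≤ p) (hf : AEStronglyMeasurable f μ) :
    AEStronglyMeasurable (fun z => dualPow p (f z)) μ :=
  (continuous_dualPow hp).comp_aestronglyMeasurable hf

lemma integrable_dualPow_mul (hp : 2 ≤ p) (hf : MemLp f (ENNReal.ofReal p) μ)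
    (hg : MemLp g (ENNReal.ofReal p) μ) : Integrable (fun z => dualPow p (f z) * g z) μ :=
  Integrable.mono' ((integrable_abs_rpow hp hg).add (integrable_abs_rpow hp hf))
    ((aestronglyMeasurable_dualPow hp hf.1).mul hg.1)
    (ae_of_all _ fun z => abs_dualPow_mul_le_add hp (f z) (g z))

lemma pair_self (hp : 2 ≤ p) (f : Z → ℝ) : pair p μ f f = powInt p μ f := by
  simp only [pair, powInt, dualPow_mul_self hp]

lemma pair_add_right (hp : 2 ≤ p) (hf : MemLp f (ENNReal.ofReal p) μ)
    (hg : MemLp g (ENNReal.ofReal p) μ) (hh : MemLp h (ENNReal.ofReal p) μ) :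
    pair p μ f (g + h) = pair p μ f g + pair p μ f h := by
  simp only [pair]
  rw [← integral_add (integrable_dualPow_mul hp hf hg) (integrable_dualPow_mul hp hf hh)]
  simp only [Pi.add_apply, mul_add]

lemma pair_smul_right (c : ℝ) : pair p μ f (c • g) = c * pair p μ f g := by
  simp only [pair]
  rw [← integral_const_mul]
  congr 1; ext z; simp only [Pi.smul_apply, smul_eq_mul]; ring

lemma pair_neg_right : pair p μ f (-g) = -pair p μ f g := by
  simpa using pair_smul_right (f := f) (g := g) (μ := μ) (p := p) (-1)

lemma pair_neg_left : pair p μ (-f) g = -pair p μ f g := by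
  simp only [pair, Pi.neg_apply, dualPow_neg, neg_mul]
  rw [integral_neg]

lemma pair_sub_right (hp : 2 ≤ p) (hf : MemLp f (ENNReal.ofReal p) μ)
    (hg : MemLp g (ENNReal.ofReal p) μ) (hh : MemLp h (ENNReal.ofReal p) μ) :
    pair p μ f (g - h) = pair p μ f g - pair p μ f h := by
  rw [sub_eq_add_neg, pair_add_right hp hf hg hh.neg, pair_neg_right, sub_eq_add_neg]

lemma pair_smul_left (hp : 2 ≤ p) {c : ℝ} (hc : 0 ≤ c) :
    pair p μ (c • f) g = c ^ (p - 1) * pair p μ f g := by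
  simp only [pair]
  rw [← integral_const_mul]
  congr 1; ext z; simp only [Pi.smul_apply, smul_eq_mul, dualPow_smul hp hc]; ring

lemma powInt_smul {c : ℝ} (hc : 0 ≤ c) : powInt p μ (c • f) = c ^ p * powInt p μ f := by
  simp only [powInt]
  rw [← integral_const_mul]
  congr 1; ext z
  simp only [Pi.smul_apply, smul_eq_mul, abs_mul, abs_of_nonneg hc, Real.mul_rpow hc (abs_nonneg _)]

lemma powInt_neg : powInt p μ (-f) = powInt p μ f := by simp [powInt]

lemma powInt_mono (hp : 2 ≤ p) (hg : MemLp g (ENNReal.ofReal p) μ)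
    (h : ∀ z, |f z| ≤ |g z|) : powInt p μ f ≤ powInt p μ g := by
  refine integral_mono_of_nonneg (ae_of_all _ fun _ => by positivity) (integrable_abs_rpow hp hg)
    (ae_of_all _ fun z => ?_)
  have := h z
  exact Real.rpow_le_rpow (abs_nonneg _) this (by linarith)

lemma powInt_tangent (hp : 2 ≤ p) (hf : MemLp f (ENNReal.ofReal p) μ)
    (hg : MemLp g (ENNReal.ofReal p) μ) :
    powInt p μ f + p * pair p μ f (g - f) ≤ powInt p μ g := by
  simp only [pair, powInt]
  rw [← integral_const_mul, ← integral_add (integrable_abs_rpow hp hf)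
    ((integrable_dualPow_mul hp hf (hg.sub hf)).const_mul p)]
  exact integral_mono ((integrable_abs_rpow hp hf).add
    ((integrable_dualPow_mul hp hf (hg.sub hf)).const_mul p)) (integrable_abs_rpow hp hg)
    fun z => abs_rpow_add_dualPow_le hp (f z) (g z)

lemma mul_pair_le (hp : 2 ≤ p) (hf : MemLp f (ENNReal.ofReal p) μ)
    (hg : MemLp g (ENNReal.ofReal p) μ) :
    p * pair p μ f g ≤ (p - 1) * powInt p μ f + powInt p μ g := by
  have := powInt_tangent hp hf hg
  rw [pair_sub_right hp hf hg hf, pair_self hp] at this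
  linarith

lemma abs_pair_le (hp : 2 ≤ p) (hf : MemLp f (ENNReal.ofReal p) μ)
    (hg : MemLp g (ENNReal.ofReal p) μ) {δ : ℝ} (hδ : 0 < δ) (hδ1 : δ ≤ 1) :
    |pair p μ f g| ≤ δ * powInt p μ g + δ⁻¹ * powInt p μ f := by
  simp only [pair, powInt]
  rw [← integral_const_mul, ← integral_const_mul,
    ← integral_add ((integrable_abs_rpow hp hg).const_mul _) ((integrable_abs_rpow hp hf).const_mul _)]
  refine abs_integral_le_integral_abs.trans ?_
  exact integral_mono (integrable_dualPow_mul hp hf hg).abs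
    (((integrable_abs_rpow hp hg).const_mul _).add ((integrable_abs_rpow hp hf).const_mul _))
    fun z => abs_dualPow_mul_le hp hδ hδ1 (f z) (g z)

lemma powInt_clarkson (hp : 2 ≤ p) (hf : MemLp f (ENNReal.ofReal p) μ)
    (hg : MemLp g (ENNReal.ofReal p) μ) :
    powInt p μ ((1 / 2 : ℝ) • (f + g)) + powInt p μ ((1 / 2 : ℝ) • (f - g)) ≤
      (powInt p μ f + powInt p μ g) / 2 := by
  have h1 := integrable_abs_rpow hp ((hf.add hg).const_smul (1 / 2 : ℝ))
  have h2 := integrable_abs_rpow hp ((hf.sub hg).const_smul (1 / 2 : ℝ))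
  have h3 := integrable_abs_rpow hp hf
  have h4 := integrable_abs_rpow hp hg
  simp only [powInt]
  rw [← integral_add h1 h2, ← integral_add h3 h4, ← integral_div]
  refine integral_mono (h1.add h2) ((h3.add h4).div_const 2) fun z => ?_
  have := clarkson hp (f z) (g z)
  simp only [Pi.smul_apply, Pi.add_apply, Pi.sub_apply, smul_eq_mul, one_div_mul_eq_div]
  exact this

lemma powInt_sub_le (hp : 2 ≤ p) (hf : MemLp f (ENNReal.ofReal p) μ)
    (hg : MemLp g (ENNReal.ofReal p) μ) :
    powInt p μ (f - g) ≤ p * 2 ^ (p - 1) / 2 * (pair p μ f (f - g) - pair p μ g (f - g)) := by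
  have h1 := integrable_dualPow_mul hp hf (hf.sub hg)
  have h2 := integrable_dualPow_mul hp hg (hf.sub hg)
  simp only [pair, powInt]
  rw [← integral_sub h1 h2, ← integral_const_mul]
  refine integral_mono (integrable_abs_rpow hp (hf.sub hg)) ((h1.sub h2).const_mul _) fun z => ?_
  have := abs_sub_rpow_le hp (f z) (g z)
  simp only [Pi.sub_apply, ← sub_mul]
  exact this

lemma tendsto_pair_add_smul (hp : 2 ≤ p) (hf : MemLp f (ENNReal.ofReal p) μ)
    (hg : MemLp g (ENNReal.ofReal p) μ) :
    Tendsto (fun k : ℕ => pair p μ (f + (1 / ((k : ℝ) + 1)) • g) g) atTop (𝓝 (pair p μ f g)) := by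
  simp only [pair]
  refine tendsto_integral_of_dominated_convergence (fun z => |g z| ^ p + |(|f z| + |g z|)| ^ p) ?_ ?_ ?_ ?_
  · intro k
    exact (aestronglyMeasurable_dualPow hp (hf.1.add (hg.1.const_smul _))).mul hg.1
  · exact (integrable_abs_rpow hp hg).add (integrable_abs_rpow hp (hf.abs.add hg.abs))
  · intro k
    refine ae_of_all _ fun z => (abs_dualPow_mul_le_add hp _ _).trans ?_
    have hk : (1 : ℝ) / ((k : ℝ) + 1) ≤ 1 := by
      rw [div_le_one (by positivity)]; linarith [(Nat.cast_nonneg k : (0 : ℝ) ≤ k)]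
    have hk0 : (0 : ℝ) ≤ 1 / ((k : ℝ) + 1) := by positivity
    refine add_le_add le_rfl (Real.rpow_le_rpow (abs_nonneg _) ?_ (by linarith))
    simp only [Pi.add_apply, Pi.smul_apply, smul_eq_mul]
    rw [abs_of_nonneg (add_nonneg (abs_nonneg (f z)) (abs_nonneg (g z)))]
    refine (abs_add_le _ _).trans ?_
    rw [abs_mul, abs_of_nonneg hk0]
    exact add_le_add le_rfl (mul_le_of_le_one_left (abs_nonneg _) hk)
  · refine ae_of_all _ fun z => ?_
    have h1 : Tendsto (fun k : ℕ => f z + (1 / ((k : ℝ) + 1)) * g z) atTop (𝓝 (f z + 0 * g z)) :=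
      (tendsto_one_div_add_atTop_nhds_zero_nat.mul_const (g z)).const_add (f z)
    rw [zero_mul, add_zero] at h1
    exact (((continuous_dualPow hp).tendsto (f z)).comp h1).mul_const (g z)

/-- A first variation principle: a lower bound on difference quotients of the power integral passes
to the pairing. -/
lemma le_pair_of_forall (hp : 2 ≤ p) (hf : MemLp f (ENNReal.ofReal p) μ)
    (hg : MemLp g (ENNReal.ofReal p) μ) {l : ℝ}
    (h : ∀ t : ℝ, 0 < t → powInt p μ f + p * (t * l) ≤ powInt p μ (f + t • g)) :
    l ≤ pair p μ f g := by
  refine ge_of_tendsto' (tendsto_pair_add_smul hp hf hg) fun k => ?_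
  have hk0 : (0 : ℝ) < 1 / ((k : ℝ) + 1) := by positivity
  have h1 := h _ hk0
  -- The tangent at the displaced point f + tg bounds the difference quotient from above by the
  -- pairing at that point, and the pairing is continuous as t → 0.
  have h2 := powInt_tangent hp (hf.add (hg.const_smul (1 / ((k : ℝ) + 1)))) hf
  rw [sub_add_cancel_left, pair_neg_right, pair_smul_right] at h2
  have h3 : p * (1 / ((k : ℝ) + 1)) * l ≤
      p * (1 / ((k : ℝ) + 1)) * pair p μ (f + (1 / ((k : ℝ) + 1)) • g) g := by linarith
  exact le_of_mul_le_mul_left h3 (by positivity)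

end Power

/-! ### The energy space -/

/-- The measure `|y - x|^(-θ) dx dy` on pairs of points. -/
noncomputable def kernelMeasure (n : ℕ) (θ : ℝ) : Measure (Space n × Space n) :=
  volume.withDensity fun z => ENNReal.ofReal ((‖z.2 - z.1‖ ^ θ)⁻¹)

lemma measurable_kernel (n : ℕ) (θ : ℝ) :
    Measurable fun z : Space n × Space n => ENNReal.ofReal ((‖z.2 - z.1‖ ^ θ)⁻¹) := by fun_prop

lemma integral_kernelMeasure {n : ℕ} (θ : ℝ) (F : Space n × Space n → ℝ) :
    ∫ z, F z ∂(kernelMeasure n θ) = ∫ z, F z / ‖z.2 - z.1‖ ^ θ := by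
  rw [kernelMeasure, integral_withDensity_eq_integral_toReal_smul (measurable_kernel n θ)
    (ae_of_all _ fun _ => ENNReal.ofReal_lt_top)]
  congr 1; ext z
  rw [ENNReal.toReal_ofReal (by positivity), smul_eq_mul]; ring

/-- The increments `u y - u x` of a function. -/
def incr {n : ℕ} (u : Space n → ℝ) (z : Space n × Space n) : ℝ := u z.2 - u z.1

lemma incr_add {n : ℕ} (u v : Space n → ℝ) : incr (u + v) = incr u + incr v := by
  ext z; simp [incr]; ring

lemma incr_sub {n : ℕ} (u v : Space n → ℝ) : incr (u - v) = incr u - incr v := by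
  ext z; simp [incr]; ring

lemma incr_smul {n : ℕ} (c : ℝ) (u : Space n → ℝ) : incr (c • u) = c • incr u := by
  ext z; simp [incr]; ring

lemma incr_neg {n : ℕ} (u : Space n → ℝ) : incr (-u) = - incr u := by
  ext z; simp [incr]; ring

lemma measurable_incr {n : ℕ} {u : Space n → ℝ} (hu : Measurable u) : Measurable (incr u) := by
  unfold incr; fun_prop

lemma lintegral_kernelMeasure {n : ℕ} (p θ : ℝ) {u : Space n → ℝ} (hu : Measurable u) :
    ∫⁻ z, ENNReal.ofReal (|incr u z| ^ p) ∂(kernelMeasure n θ) = seminormPow p θ Set.univ u := by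
  have hm : Measurable fun z : Space n × Space n => ENNReal.ofReal (|incr u z| ^ p) := by
    have := measurable_incr hu; fun_prop
  rw [kernelMeasure, lintegral_withDensity_eq_lintegral_mul _ (measurable_kernel n θ) hm, seminormPow]
  simp only [Measure.restrict_univ]
  rw [Measure.volume_eq_prod, lintegral_prod _ ((measurable_kernel n θ).mul hm).aemeasurable]
  congr 1; ext x; congr 1; ext y
  simp only [Pi.mul_apply, incr]
  rw [← ENNReal.ofReal_mul (by positivity)]
  congr 1; ring

lemma powInt_fatou {Z : Type*} [MeasurableSpace Z] {μ : Measure Z} {p : ℝ} (hp : 2 ≤ p)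
    {f : ℕ → Z → ℝ} {g : Z → ℝ} (hf : ∀ k, MemLp (f k) (ENNReal.ofReal p) μ)
    (hg : AEStronglyMeasurable g μ) (hlim : ∀ z, Tendsto (fun k => f k z) atTop (𝓝 (g z)))
    {m : ℕ → ℝ} {l : ℝ} (hm : ∀ k, powInt p μ (f k) ≤ m k) (hml : Tendsto m atTop (𝓝 l)) :
    MemLp g (ENNReal.ofReal p) μ ∧ powInt p μ g ≤ l := by
  have h1 : ∫⁻ z, ENNReal.ofReal (|g z| ^ p) ∂μ ≤ ENNReal.ofReal l := by
    have e : ∀ z, ENNReal.ofReal (|g z| ^ p) = liminf (fun k => ENNReal.ofReal (|f k z| ^ p)) atTop := by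
      intro z
      refine (Tendsto.liminf_eq ?_).symm
      refine (ENNReal.continuous_ofReal.tendsto _).comp ?_
      exact ((hlim z).abs).rpow_const (Or.inr (by linarith))
    simp_rw [e]
    refine (lintegral_liminf_le' fun k => ?_).trans ?_
    · exact ((hf k).1.norm.aemeasurable.pow_const p).ennreal_ofReal
    · simp_rw [← ofReal_powInt hp (hf _)]
      refine (liminf_le_liminf (Eventually.of_forall fun k => ENNReal.ofReal_le_ofReal (hm k))).trans ?_
      exact ((ENNReal.continuous_ofReal.tendsto l).comp hml).liminf_eq.le
  have hmem := memLp_of_lintegral_lt_top hp hg (h1.trans_lt ENNReal.ofReal_lt_top)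
  refine ⟨hmem, ?_⟩
  rw [← ofReal_powInt hp hmem] at h1
  have hl : 0 ≤ l := ge_of_tendsto' hml fun k => powInt_nonneg.trans (hm k)
  exact (ENNReal.ofReal_le_ofReal_iff hl).1 h1

lemma tendsto_apply {X : Type*} [TopologicalSpace X] {u : ℕ → X →ᵇ ℝ} {v : X →ᵇ ℝ}
    (h : Tendsto u atTop (𝓝 v)) (x : X) : Tendsto (fun k => u k x) atTop (𝓝 (v x)) :=
  (BoundedContinuousFunction.tendsto_iff_tendstoUniformly.1 h).tendsto_at x

/-- The standing assumptions on the parameters (with `θ = α p`) and on the domain. -/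
structure Admissible (n : ℕ) (p θ : ℝ) (Ω : Set (Space n)) : Prop where
  one_le : 1 ≤ n
  two_le : 2 ≤ p
  lt : 2 * (n : ℝ) < θ
  lt' : θ < n + p
  isOpen : IsOpen Ω
  nonempty : Ω.Nonempty
  isBounded : Bornology.IsBounded Ω

/-- The continuous functions vanishing outside `Ω` with finite energy. -/
noncomputable def energySpace {n : ℕ} (p θ : ℝ) (Ω : Set (Space n)) : Submodule ℝ (Space n →ᵇ ℝ) where
  carrier := {u | (∀ x ∉ Ω, u x = 0) ∧ MemLp (incr u) (ENNReal.ofReal p) (kernelMeasure n θ)}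
  add_mem' := by
    rintro u v ⟨hu, hu'⟩ ⟨hv, hv'⟩
    refine ⟨fun x hx => by simp [hu x hx, hv x hx], ?_⟩
    rw [BoundedContinuousFunction.coe_add, incr_add]
    exact hu'.add hv'
  zero_mem' := ⟨fun _ _ => rfl, by
    have : incr (⇑(0 : Space n →ᵇ ℝ)) = 0 := by ext z; simp [incr]
    rw [this]
    exact MemLp.zero⟩
  smul_mem' := by
    rintro c u ⟨hu, hu'⟩
    refine ⟨fun x hx => by simp [hu x hx], ?_⟩
    rw [BoundedContinuousFunction.coe_smul]
    exact (incr_smul c u) ▸ hu'.const_smul c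

/-- The energy `∫∫ |u y - u x|^p / |y - x|^θ`. -/
noncomputable def energy {n : ℕ} (p θ : ℝ) (u : Space n →ᵇ ℝ) : ℝ := powInt p (kernelMeasure n θ) (incr u)

/-- The pairing associated with the energy. -/
noncomputable def energyPair {n : ℕ} (p θ : ℝ) (u v : Space n →ᵇ ℝ) : ℝ :=
  pair p (kernelMeasure n θ) (incr u) (incr v)

/-- The mass `∫ |u|^p`. -/
noncomputable def mass {n : ℕ} (p : ℝ) (u : Space n →ᵇ ℝ) : ℝ := powInt p volume u

/-- The pairing associated with the mass. -/
noncomputable def massPair {n : ℕ} (p : ℝ) (u v : Space n →ᵇ ℝ) : ℝ := pair p volume u v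

section Basic

variable {n : ℕ} {p θ : ℝ} {Ω : Set (Space n)} {u v w : Space n →ᵇ ℝ}

lemma zero_of_mem (hu : u ∈ energySpace p θ Ω) {x : Space n} (hx : x ∉ Ω) : u x = 0 := hu.1 x hx

lemma memLp_of_mem (hΩ : Bornology.IsBounded Ω) (hu : u ∈ energySpace p θ Ω) :
    MemLp u (ENNReal.ofReal p) volume := by
  refine u.continuous.memLp_of_hasCompactSupport ?_
  refine HasCompactSupport.intro' (K := closure Ω) hΩ.isCompact_closure isClosed_closure ?_
  intro x hx
  exact zero_of_mem hu fun h => hx (subset_closure h)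

lemma incr_coe_add (u v : Space n →ᵇ ℝ) : incr ⇑(u + v) = incr u + incr v := by
  rw [BoundedContinuousFunction.coe_add, incr_add]

lemma incr_coe_sub (u v : Space n →ᵇ ℝ) : incr ⇑(u - v) = incr u - incr v := by
  rw [BoundedContinuousFunction.coe_sub, incr_sub]

lemma incr_coe_smul (c : ℝ) (u : Space n →ᵇ ℝ) : incr ⇑(c • u) = c • incr u := by
  rw [BoundedContinuousFunction.coe_smul]; exact incr_smul c u

lemma incr_coe_neg (u : Space n →ᵇ ℝ) : incr ⇑(-u) = -incr u := by
  rw [BoundedContinuousFunction.coe_neg, incr_neg]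

lemma energy_nonneg : 0 ≤ energy p θ u := powInt_nonneg

lemma energyPair_self (hp : 2 ≤ p) : energyPair p θ u u = energy p θ u := pair_self hp _

lemma massPair_self (hp : 2 ≤ p) : massPair p u u = mass p u := pair_self hp _

lemma energy_neg : energy p θ (-u) = energy p θ u := by
  rw [energy, incr_coe_neg, powInt_neg, energy]

lemma energy_smul {c : ℝ} (hc : 0 ≤ c) : energy p θ (c • u) = c ^ p * energy p θ u := by
  rw [energy, incr_coe_smul, powInt_smul hc, energy]

lemma mass_smul {c : ℝ} (hc : 0 ≤ c) : mass p (c • u) = c ^ p * mass p u := powInt_smul hc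

lemma energyPair_smul_left (hp : 2 ≤ p) {c : ℝ} (hc : 0 ≤ c) :
    energyPair p θ (c • u) v = c ^ (p - 1) * energyPair p θ u v := by
  rw [energyPair, incr_coe_smul, pair_smul_left hp hc, energyPair]

lemma massPair_smul_left (hp : 2 ≤ p) {c : ℝ} (hc : 0 ≤ c) :
    massPair p (c • u) v = c ^ (p - 1) * massPair p u v := pair_smul_left hp hc

lemma energyPair_neg_left : energyPair p θ (-u) v = -energyPair p θ u v := by
  rw [energyPair, incr_coe_neg, pair_neg_left, energyPair]

lemma massPair_neg_left : massPair p (-u) v = -massPair p u v := pair_neg_left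

lemma energyPair_neg_right : energyPair p θ u (-v) = -energyPair p θ u v := by
  rw [energyPair, incr_coe_neg, pair_neg_right, energyPair]

lemma massPair_neg_right : massPair p u (-v) = -massPair p u v := pair_neg_right

lemma massPair_smul_right (c : ℝ) : massPair p u (c • v) = c * massPair p u v := pair_smul_right c

lemma energyPair_sub_right (hp : 2 ≤ p) (hu : u ∈ energySpace p θ Ω) (hv : v ∈ energySpace p θ Ω)
    (hw : w ∈ energySpace p θ Ω) : energyPair p θ u (v - w) = energyPair p θ u v - energyPair p θ u w := by
  rw [energyPair, incr_coe_sub, pair_sub_right hp hu.2 hv.2 hw.2]; rfl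

lemma massPair_sub_right (hΩ : Bornology.IsBounded Ω) (hp : 2 ≤ p) (hu : u ∈ energySpace p θ Ω)
    (hv : v ∈ energySpace p θ Ω) (hw : w ∈ energySpace p θ Ω) :
    massPair p u (v - w) = massPair p u v - massPair p u w :=
  pair_sub_right hp (memLp_of_mem hΩ hu) (memLp_of_mem hΩ hv) (memLp_of_mem hΩ hw)

lemma energy_tangent (hp : 2 ≤ p) (hu : u ∈ energySpace p θ Ω) (hv : v ∈ energySpace p θ Ω) :
    energy p θ u + p * energyPair p θ u (v - u) ≤ energy p θ v := by
  rw [energyPair, incr_coe_sub]; exact powInt_tangent hp hu.2 hv.2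

lemma mass_tangent (hΩ : Bornology.IsBounded Ω) (hp : 2 ≤ p) (hu : u ∈ energySpace p θ Ω)
    (hv : v ∈ energySpace p θ Ω) : mass p u + p * massPair p u (v - u) ≤ mass p v :=
  powInt_tangent hp (memLp_of_mem hΩ hu) (memLp_of_mem hΩ hv)

lemma seminormPow_univ_eq (hp : 2 ≤ p) (hu : u ∈ energySpace p θ Ω) :
    seminormPow p θ Set.univ u = ENNReal.ofReal (energy p θ u) := by
  rw [← lintegral_kernelMeasure p θ u.continuous.measurable, energy, ofReal_powInt hp hu.2]

lemma mem_energySpace_of_lt_top (hp : 2 ≤ p) (h0 : ∀ x ∉ Ω, u x = 0)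
    (h : seminormPow p θ Set.univ u < ⊤) : u ∈ energySpace p θ Ω := by
  refine ⟨h0, memLp_of_lintegral_lt_top hp
    (measurable_incr u.continuous.measurable).aestronglyMeasurable ?_⟩
  rwa [lintegral_kernelMeasure p θ u.continuous.measurable]

lemma lpPow_univ_eq (hΩ : Bornology.IsBounded Ω) (hp : 2 ≤ p) (hu : u ∈ energySpace p θ Ω) :
    lpPow p Set.univ u = ENNReal.ofReal (mass p u) := by
  rw [mass, ofReal_powInt hp (memLp_of_mem hΩ hu), lpPow]; simp

/-- Lower semicontinuity of the energy under uniform convergence, which replaces weak convergence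
throughout. The bound is a convergent sequence because in the applications it varies with k. -/
lemma energy_fatou (hp : 2 ≤ p) {u : ℕ → Space n →ᵇ ℝ} (hu : ∀ k, u k ∈ energySpace p θ Ω)
    (hlim : Tendsto u atTop (𝓝 v)) {m : ℕ → ℝ} {l : ℝ} (hm : ∀ k, energy p θ (u k) ≤ m k)
    (hml : Tendsto m atTop (𝓝 l)) : v ∈ energySpace p θ Ω ∧ energy p θ v ≤ l := by
  have hpt : ∀ x, Tendsto (fun k => u k x) atTop (𝓝 (v x)) := fun x =>
    tendsto_apply hlim x
  have h := powInt_fatou hp (fun k => (hu k).2)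
    (measurable_incr v.continuous.measurable).aestronglyMeasurable
    (fun z => (hpt z.2).sub (hpt z.1)) hm hml
  refine ⟨⟨fun x hx => ?_, h.1⟩, h.2⟩
  refine tendsto_nhds_unique (hpt x) ?_
  simp [fun k => zero_of_mem (hu k) hx]

lemma tendsto_massPair (hΩ : Bornology.IsBounded Ω) (hp : 2 ≤ p) {u v : ℕ → Space n →ᵇ ℝ}
    {u' v' : Space n →ᵇ ℝ} (hu : ∀ k, u k ∈ energySpace p θ Ω) (hul : Tendsto u atTop (𝓝 u'))
    (hvl : Tendsto v atTop (𝓝 v')) :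
    Tendsto (fun k => massPair p (u k) (v k)) atTop (𝓝 (massPair p u' v')) := by
  obtain ⟨R, hR⟩ := hΩ.subset_closedBall (0 : Space n)
  set B := Metric.closedBall (0 : Space n) R
  obtain ⟨M, hM⟩ := (Metric.isBounded_range_of_tendsto u hul).exists_norm_le
  obtain ⟨M', hM'⟩ := (Metric.isBounded_range_of_tendsto v hvl).exists_norm_le
  have hpt : ∀ x, Tendsto (fun k => u k x) atTop (𝓝 (u' x)) := fun x =>
    tendsto_apply hul x
  have hpt' : ∀ x, Tendsto (fun k => v k x) atTop (𝓝 (v' x)) := fun x =>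
    tendsto_apply hvl x
  refine tendsto_integral_of_dominated_convergence (B.indicator fun _ => M' ^ p + M ^ p) ?_ ?_ ?_ ?_
  · intro k
    exact (((continuous_dualPow hp).comp (u k).continuous).mul (v k).continuous).aestronglyMeasurable
  · rw [integrable_indicator_iff Metric.isClosed_closedBall.measurableSet]
    exact integrableOn_const (measure_closedBall_lt_top.ne)
  · intro k
    refine ae_of_all _ fun x => ?_
    by_cases hx : x ∈ B
    · rw [Set.indicator_of_mem hx]
      refine (abs_dualPow_mul_le_add hp _ _).trans ?_
      have h1 : |u k x| ≤ M := ((u k).norm_coe_le_norm x).trans (hM _ ⟨k, rfl⟩)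
      have h2 : |v k x| ≤ M' := ((v k).norm_coe_le_norm x).trans (hM' _ ⟨k, rfl⟩)
      exact add_le_add (Real.rpow_le_rpow (abs_nonneg _) h2 (by linarith))
        (Real.rpow_le_rpow (abs_nonneg _) h1 (by linarith))
    · rw [Set.indicator_of_notMem hx, zero_of_mem (hu k) fun h => hx (hR h)]
      simp
  · refine ae_of_all _ fun x => ?_
    exact (((continuous_dualPow hp).tendsto _).comp (hpt x)).mul (hpt' x)

lemma tendsto_mass (hΩ : Bornology.IsBounded Ω) (hp : 2 ≤ p) {u : ℕ → Space n →ᵇ ℝ}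
    {u' : Space n →ᵇ ℝ} (hu : ∀ k, u k ∈ energySpace p θ Ω) (hul : Tendsto u atTop (𝓝 u')) :
    Tendsto (fun k => mass p (u k)) atTop (𝓝 (mass p u')) := by
  simp_rw [← massPair_self hp]
  exact tendsto_massPair hΩ hp hu hul hul

lemma mass_pos (hΩ : Bornology.IsBounded Ω) (hp : 2 ≤ p) (hu : u ∈ energySpace p θ Ω) (h : u ≠ 0) :
    0 < mass p u := by
  obtain ⟨x, hx⟩ : ∃ x, u x ≠ 0 := by
    by_contra hcon
    push Not at hcon
    exact h (by ext x; simp [hcon x])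
  have hc : Continuous fun x => |u x| ^ p := u.continuous.abs.rpow_const fun _ => Or.inr (by linarith)
  refine hc.integral_pos_of_hasCompactSupport_nonneg_nonzero ?_ (fun _ => by positivity) (x := x) ?_
  · refine HasCompactSupport.intro' (K := closure Ω) hΩ.isCompact_closure isClosed_closure ?_
    intro x hx
    rw [zero_of_mem hu fun h => hx (subset_closure h), abs_zero, Real.zero_rpow (by linarith)]
  · have : 0 < |u x| := abs_pos.2 hx
    positivity

end Basic

section Compactness

variable {n : ℕ} {p θ : ℝ} {Ω : Set (Space n)}

lemma seminormPow_mono {p θ : ℝ} {s t : Set (Space n)} (h : s ⊆ t) (u : Space n → ℝ) :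
    seminormPow p θ s u ≤ seminormPow p θ t u :=
  (lintegral_mono_set h).trans (lintegral_mono fun _ => lintegral_mono_set h)

/-- Morrey in the ball centred at x of radius |x - y|, whose closure contains y. -/
lemma Admissible.holder (H : Admissible n p θ Ω) : ∃ C : ℝ, 0 < C ∧ ∀ u ∈ energySpace p θ Ω, ∀ x y,
    |u x - u y| ^ p ≤ C * ‖x - y‖ ^ (θ - 2 * n) * energy p θ u := by
  have hp := H.two_le
  obtain ⟨C, hC, h⟩ := morrey (n := n) (p := p) (θ := θ) (by linarith) H.lt
  refine ⟨C, hC, fun u hu x y => ?_⟩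
  rcases eq_or_ne x y with rfl | hxy
  · rw [sub_self, abs_zero, Real.zero_rpow (by linarith)]
    have := energy_nonneg (p := p) (θ := θ) (u := u)
    positivity
  have hd : 0 < ‖x - y‖ := norm_pos_iff.2 (sub_ne_zero.2 hxy)
  have h1 := h u u.continuous x ‖x - y‖ hd x (Metric.mem_closedBall_self hd.le) y
    (by rw [Metric.mem_closedBall, dist_comm, dist_eq_norm])
  have h2 := seminormPow_mono (p := p) (θ := θ) (Set.subset_univ (Metric.ball x ‖x - y‖)) u
  rw [seminormPow_univ_eq hp hu] at h2
  have h3 := h1.trans (mul_le_mul_right h2 _)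
  rw [← ENNReal.ofReal_mul (by positivity)] at h3
  exact (ENNReal.ofReal_le_ofReal_iff (mul_nonneg (by positivity) energy_nonneg)).1 h3

/-- Hölder continuity is applied between x and a fixed point z outside Ω, where u vanishes. -/
lemma Admissible.sup_bound (H : Admissible n p θ Ω) : ∃ C : ℝ, 0 < C ∧ ∀ u ∈ energySpace p θ Ω,
    ‖u‖ ^ p ≤ C * energy p θ u := by
  have hp := H.two_le
  obtain ⟨C, hC, h⟩ := H.holder
  obtain ⟨z, hz⟩ := compl_nonempty_of_isBounded H.one_le H.isBounded
  obtain ⟨R, hR0, hR⟩ := H.isBounded.subset_closedBall_lt 0 z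
  refine ⟨C * R ^ (θ - 2 * n), by positivity, fun u hu => ?_⟩
  have hE := energy_nonneg (p := p) (θ := θ) (u := u)
  have h0 : 0 ≤ C * R ^ (θ - 2 * n) * energy p θ u := by positivity
  have key : ‖u‖ ≤ (C * R ^ (θ - 2 * n) * energy p θ u) ^ (1 / p) := by
    rw [BoundedContinuousFunction.norm_le (by positivity)]
    intro x
    by_cases hx : x ∈ Ω
    · have h1 := h u hu x z
      rw [zero_of_mem hu hz, sub_zero] at h1
      have h2 : ‖x - z‖ ≤ R := by rw [← dist_eq_norm]; exact hR hx
      have h3 : |u x| ^ p ≤ C * R ^ (θ - 2 * n) * energy p θ u := by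
        refine h1.trans ?_
        have : 0 ≤ θ - 2 * n := by linarith [H.lt]
        gcongr
      have := Real.rpow_le_rpow (by positivity) h3 (by positivity : 0 ≤ 1 / p)
      rwa [← Real.rpow_mul (abs_nonneg _), mul_one_div_cancel (by linarith), Real.rpow_one] at this
    · rw [zero_of_mem hu hx, norm_zero]; positivity
  calc ‖u‖ ^ p ≤ ((C * R ^ (θ - 2 * n) * energy p θ u) ^ (1 / p)) ^ p :=
        Real.rpow_le_rpow (norm_nonneg _) key (by linarith)
    _ = _ := by rw [← Real.rpow_mul h0, one_div_mul_cancel (by linarith), Real.rpow_one]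

/-- Compactness of the embedding of the energy space into the bounded continuous functions. -/
lemma Admissible.exists_subseq (H : Admissible n p θ Ω) {u : ℕ → Space n →ᵇ ℝ}
    (hu : ∀ k, u k ∈ energySpace p θ Ω) {M : ℝ} (hM : ∀ k, energy p θ (u k) ≤ M) :
    ∃ v ∈ energySpace p θ Ω, ∃ ψ : ℕ → ℕ, StrictMono ψ ∧ Tendsto (u ∘ ψ) atTop (𝓝 v) := by
  have hp := H.two_le
  have hp0 : 0 < p := by linarith
  have hσ : 0 < θ - 2 * n := by linarith [H.lt]
  have hM0 : 0 ≤ M := energy_nonneg.trans (hM 0)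
  obtain ⟨C, hC, h⟩ := H.holder
  obtain ⟨C', hC', h'⟩ := H.sup_bound
  obtain ⟨R, hR⟩ := H.isBounded.subset_closedBall (0 : Space n)
  set K := Metric.closedBall (0 : Space n) R
  have : CompactSpace K := isCompact_iff_compactSpace.1 (isCompact_closedBall 0 R)
  -- Arzelà–Ascoli needs a compact domain. Since the functions vanish off K, restriction loses no
  -- distance, and Cauchy sequences of restrictions come from Cauchy sequences on ℝⁿ.
  set r : (Space n →ᵇ ℝ) → (K →ᵇ ℝ) := fun f => f.domRestrict K with hr
  have hdist : ∀ i j, dist (u i) (u j) ≤ dist (r (u i)) (r (u j)) := by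
    intro i j
    rw [BoundedContinuousFunction.dist_le dist_nonneg]
    intro x
    by_cases hx : x ∈ K
    · exact BoundedContinuousFunction.dist_coe_le_dist (f := r (u i)) (g := r (u j)) ⟨x, hx⟩
    · rw [zero_of_mem (hu i) fun h => hx (hR h), zero_of_mem (hu j) fun h => hx (hR h), dist_self]
      exact dist_nonneg
  set S := (C' * M) ^ (1 / p)
  have hS : ∀ k, ‖u k‖ ≤ S := by
    intro k
    have h1 : ‖u k‖ ^ p ≤ C' * M := (h' _ (hu k)).trans (by gcongr; exact hM k)
    have := Real.rpow_le_rpow (by positivity) h1 (by positivity : 0 ≤ 1 / p)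
    rwa [← Real.rpow_mul (norm_nonneg _), mul_one_div_cancel hp0.ne', Real.rpow_one] at this
  have hcpt : IsCompact (closure (Set.range fun k => r (u k))) := by
    refine BoundedContinuousFunction.arzela_ascoli (Metric.closedBall 0 S) (isCompact_closedBall 0 S) _ ?_ ?_
    · rintro _ x ⟨k, rfl⟩
      rw [mem_closedBall_zero_iff]
      exact ((u k).norm_coe_le_norm x).trans (hS k)
    · refine Metric.equicontinuous_of_continuity_modulus
        (fun t => (C * t ^ (θ - 2 * n) * M) ^ (1 / p)) ?_ _ ?_
      · have : Tendsto (fun t : ℝ => (C * t ^ (θ - 2 * n) * M) ^ (1 / p)) (𝓝 0)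
            (𝓝 ((C * (0 : ℝ) ^ (θ - 2 * n) * M) ^ (1 / p))) := by
          refine Tendsto.rpow_const ?_ (Or.inr (by positivity))
          exact ((tendsto_id.rpow_const (Or.inr hσ.le)).const_mul C).mul_const M
        simpa [Real.zero_rpow hσ.ne', Real.zero_rpow (inv_ne_zero hp0.ne')] using this
      · rintro x y ⟨_, k, rfl⟩
        have h1 : |u k x - u k y| ^ p ≤ C * (dist x y) ^ (θ - 2 * n) * M := by
          refine (h _ (hu k) x y).trans ?_
          rw [Subtype.dist_eq, dist_eq_norm]
          gcongr
          exact hM k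
        have := Real.rpow_le_rpow (by positivity) h1 (by positivity : 0 ≤ 1 / p)
        rwa [← Real.rpow_mul (abs_nonneg _), mul_one_div_cancel hp0.ne', Real.rpow_one] at this
  obtain ⟨f, -, ψ, hψ, hlim⟩ := hcpt.tendsto_subseq (x := fun k => r (u k))
    fun k => subset_closure ⟨k, rfl⟩
  have hcau : CauchySeq (u ∘ ψ) := by
    have := hlim.cauchySeq
    rw [Metric.cauchySeq_iff] at this ⊢
    intro ε hε
    obtain ⟨N, hN⟩ := this ε hε
    exact ⟨N, fun i hi j hj => (hdist _ _).trans_lt (hN i hi j hj)⟩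
  obtain ⟨v, hv⟩ := cauchySeq_tendsto_of_complete hcau
  exact ⟨v, (energy_fatou hp (fun k => hu (ψ k)) hv (fun k => hM (ψ k)) tendsto_const_nhds).1, ψ, hψ, hv⟩

end Compactness

/-! ### Weak solutions and eigenfunctions in the energy space -/

/-- `u` solves `A u = lam B w` weakly in the energy space. -/
structure Solves {n : ℕ} (p θ : ℝ) (Ω : Set (Space n)) (lam : ℝ) (w u : Space n →ᵇ ℝ) : Prop where
  mem : u ∈ energySpace p θ Ω
  eq : ∀ φ ∈ energySpace p θ Ω, energyPair p θ u φ = lam * massPair p w φ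

section Solutions

variable {n : ℕ} {p θ lam : ℝ} {Ω : Set (Space n)} {u v w : Space n →ᵇ ℝ}

/-- The variational inequality characterising weak solutions. -/
lemma solves_of_le (hp : 2 ≤ p) (hu : u ∈ energySpace p θ Ω)
    (h : ∀ ψ ∈ energySpace p θ Ω, energy p θ u + p * (lam * massPair p w (ψ - u)) ≤ energy p θ ψ) :
    Solves p θ Ω lam w u := by
  have key : ∀ φ ∈ energySpace p θ Ω, lam * massPair p w φ ≤ energyPair p θ u φ := by
    intro φ hφ
    refine le_pair_of_forall hp hu.2 hφ.2 fun t _ => ?_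
    have := h (u + t • φ) (add_mem hu (Submodule.smul_mem _ t hφ))
    rw [add_sub_cancel_left, massPair_smul_right] at this
    rw [energy, energy, incr_coe_add, incr_coe_smul] at this
    linarith
  refine ⟨hu, fun φ hφ => le_antisymm ?_ (key φ hφ)⟩
  have := key (-φ) (neg_mem hφ)
  rw [massPair_neg_right, energyPair_neg_right] at this
  linarith

lemma Solves.le (hp : 2 ≤ p) (h : Solves p θ Ω lam w u) {ψ : Space n →ᵇ ℝ} (hψ : ψ ∈ energySpace p θ Ω) :
    energy p θ u + p * (lam * massPair p w (ψ - u)) ≤ energy p θ ψ := by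
  rw [← h.eq _ (sub_mem hψ h.mem)]
  exact energy_tangent hp h.mem hψ

lemma Solves.energy_eq (hp : 2 ≤ p) (h : Solves p θ Ω lam w u) : energy p θ u = lam * massPair p w u := by
  rw [← h.eq _ h.mem, energyPair_self hp]

lemma Solves.neg (h : Solves p θ Ω lam w u) : Solves p θ Ω lam (-w) (-u) :=
  ⟨neg_mem h.mem, fun φ hφ => by rw [energyPair_neg_left, massPair_neg_left, h.eq φ hφ]; ring⟩

lemma Solves.smul (hp : 2 ≤ p) (h : Solves p θ Ω lam w u) {c : ℝ} (hc : 0 ≤ c) :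
    Solves p θ Ω lam (c • w) (c • u) :=
  ⟨Submodule.smul_mem _ c h.mem, fun φ hφ => by
    rw [energyPair_smul_left hp hc, massPair_smul_left hp hc, h.eq φ hφ]; ring⟩

/-- Weak solutions are stable under uniform convergence. -/
lemma Solves.of_tendsto (H : Admissible n p θ Ω) {u w : ℕ → Space n →ᵇ ℝ} {l : ℕ → ℝ}
    {u' w' : Space n →ᵇ ℝ} {l' : ℝ} (h : ∀ k, Solves p θ Ω (l k) (w k) (u k))
    (hw : ∀ k, w k ∈ energySpace p θ Ω) (hul : Tendsto u atTop (𝓝 u')) (hwl : Tendsto w atTop (𝓝 w'))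
    (hl : Tendsto l atTop (𝓝 l')) : Solves p θ Ω l' w' u' := by
  have hp := H.two_le
  -- The energy of u k equals l k times a mass pairing, which converges. Substituting this removes
  -- the energy of u k from the variational inequality, so Fatou is needed only for the limit u'.
  have h1 : Tendsto (fun k => l k * massPair p (w k) (u k)) atTop (𝓝 (l' * massPair p w' u')) :=
    hl.mul (tendsto_massPair H.isBounded hp hw hwl hul)
  have hF := energy_fatou hp (fun k => (h k).mem) hul (fun k => ((h k).energy_eq hp).le) h1
  refine solves_of_le hp hF.1 fun ψ hψ => ?_
  have h2 : Tendsto (fun k => l k * massPair p (w k) (u k) + p * (l k * massPair p (w k) (ψ - u k))) atTop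
      (𝓝 (l' * massPair p w' u' + p * (l' * massPair p w' (ψ - u')))) :=
    h1.add ((hl.mul (tendsto_massPair H.isBounded hp hw hwl (hul.const_sub ψ))).const_mul p)
  have h3 : l' * massPair p w' u' + p * (l' * massPair p w' (ψ - u')) ≤ energy p θ ψ := by
    refine le_of_tendsto' h2 fun k => ?_
    have := (h k).le hp hψ
    rwa [(h k).energy_eq hp] at this
  linarith [hF.2]

lemma Admissible.exists_smul_mass_eq_one (H : Admissible n p θ Ω) (hu : u ∈ energySpace p θ Ω)
    (h0 : u ≠ 0) : ∃ c : ℝ, 0 < c ∧ mass p (c • u) = 1 := by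
  have hp := H.two_le
  have hm := mass_pos H.isBounded hp hu h0
  refine ⟨mass p u ^ (-(1 / p)), by positivity, ?_⟩
  rw [mass_smul (by positivity), ← Real.rpow_mul hm.le, neg_mul, one_div_mul_cancel (by linarith),
    Real.rpow_neg_one, inv_mul_cancel₀ hm.ne']

lemma ne_zero_of_mass_eq_one (hp : 2 ≤ p) (h : mass p u = 1) : u ≠ 0 := by
  rintro rfl
  simp [mass, powInt, Real.zero_rpow (show p ≠ 0 by linarith)] at h

/-- `lam` is an eigenvalue in the energy space. -/
def IsEigen {n : ℕ} (p θ : ℝ) (Ω : Set (Space n)) (lam : ℝ) : Prop :=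
  ∃ u : Space n →ᵇ ℝ, u ≠ 0 ∧ Solves p θ Ω lam u u

lemma IsEigen.exists_normalized (H : Admissible n p θ Ω) (h : IsEigen p θ Ω lam) :
    ∃ u, mass p u = 1 ∧ Solves p θ Ω lam u u := by
  obtain ⟨u, h0, hu⟩ := h
  obtain ⟨c, hc, hcm⟩ := H.exists_smul_mass_eq_one hu.mem h0
  exact ⟨c • u, hcm, hu.smul H.two_le hc.le⟩

/-- Compactness of normalised eigenfunctions with converging eigenvalues. -/
lemma Admissible.exists_limit_eigen (H : Admissible n p θ Ω) {l : ℕ → ℝ} {l' : ℝ}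
    {u : ℕ → Space n →ᵇ ℝ} (hu : ∀ k, Solves p θ Ω (l k) (u k) (u k)) (h1 : ∀ k, mass p (u k) = 1)
    (hl : Tendsto l atTop (𝓝 l')) :
    ∃ v, mass p v = 1 ∧ Solves p θ Ω l' v v ∧ ∃ ψ : ℕ → ℕ, StrictMono ψ ∧ Tendsto (u ∘ ψ) atTop (𝓝 v) := by
  have hp := H.two_le
  obtain ⟨M, hM⟩ := hl.bddAbove_range
  obtain ⟨v, hv, ψ, hψ, hlim⟩ := H.exists_subseq (fun k => (hu k).mem) (M := M) fun k => by
    rw [(hu k).energy_eq hp, massPair_self hp, h1, mul_one]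
    exact hM ⟨k, rfl⟩
  refine ⟨v, ?_, Solves.of_tendsto H (fun k => hu (ψ k)) (fun k => (hu _).mem) hlim hlim
    (hl.comp hψ.tendsto_atTop), ψ, hψ, hlim⟩
  refine tendsto_nhds_unique (tendsto_mass H.isBounded hp (fun k => (hu (ψ k)).mem) hlim) ?_
  simp [h1]

lemma Admissible.isEigen_of_tendsto (H : Admissible n p θ Ω) {l : ℕ → ℝ} {l' : ℝ}
    (h : ∀ k, IsEigen p θ Ω (l k)) (hl : Tendsto l atTop (𝓝 l')) : IsEigen p θ Ω l' := by
  choose u h1 hu using fun k => (h k).exists_normalized H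
  obtain ⟨v, hv1, hv, -⟩ := H.exists_limit_eigen hu h1 hl
  exact ⟨v, ne_zero_of_mass_eq_one H.two_le hv1, hv⟩

/-- A minimiser of the Rayleigh quotient is an eigenfunction. -/
lemma Admissible.solves_of_minimizer (H : Admissible n p θ Ω) (hl0 : 0 ≤ lam)
    (hl : ∀ ψ ∈ energySpace p θ Ω, lam * mass p ψ ≤ energy p θ ψ) (hu : u ∈ energySpace p θ Ω)
    (h : energy p θ u ≤ lam * mass p u) : Solves p θ Ω lam u u := by
  refine solves_of_le H.two_le hu fun ψ hψ => ?_
  have h1 := mul_le_mul_of_nonneg_left (mass_tangent H.isBounded H.two_le hu hψ) hl0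
  have h2 := hl ψ hψ
  linarith

end Solutions

/-! ### Lattice operations -/

section Lattice

variable {n : ℕ} {p θ lam : ℝ} {Ω : Set (Space n)} {u v w : Space n →ᵇ ℝ}

lemma mem_energySpace_of_abs_sub_le (hu : u ∈ energySpace p θ Ω) (hv : v ∈ energySpace p θ Ω)
    (h0 : ∀ x ∉ Ω, w x = 0) {L : ℝ} (h : ∀ x y, |w x - w y| ≤ L * (|u x - u y| + |v x - v y|)) :
    w ∈ energySpace p θ Ω := by
  refine ⟨h0, ?_⟩
  refine ((hu.2.abs.add hv.2.abs).const_mul L).mono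
    (measurable_incr w.continuous.measurable).aestronglyMeasurable (ae_of_all _ fun z => ?_)
  refine (h z.2 z.1).trans ?_
  simp only [Pi.add_apply, Real.norm_eq_abs, abs_mul]
  have h1 : |(|u z.2 - u z.1| + |v z.2 - v z.1|)| = |u z.2 - u z.1| + |v z.2 - v z.1| :=
    abs_of_nonneg (by positivity)
  change _ ≤ |L| * |(|u z.2 - u z.1| + |v z.2 - v z.1|)|
  rw [h1]
  gcongr
  exact le_abs_self L

lemma mem_energySpace_of_contraction (hu : u ∈ energySpace p θ Ω) (h0 : ∀ x ∉ Ω, w x = 0)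
    (h : ∀ x y, |w x - w y| ≤ |u x - u y|) : w ∈ energySpace p θ Ω :=
  mem_energySpace_of_abs_sub_le hu (zero_mem _) h0 (L := 1) fun x y => by simpa using h x y

lemma posPart_mem (hu : u ∈ energySpace p θ Ω) : u ⊔ 0 ∈ energySpace p θ Ω :=
  mem_energySpace_of_contraction hu (fun x hx => by simp [zero_of_mem hu hx]) fun x y => by
    simpa using abs_max_sub_max_le_abs (u x) (u y) 0

lemma abs_mem (hu : u ∈ energySpace p θ Ω) : |u| ∈ energySpace p θ Ω :=
  mem_energySpace_of_contraction hu (fun x hx => by simp [zero_of_mem hu hx]) fun x y => by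
    simpa using abs_abs_sub_abs_le_abs_sub (u x) (u y)

lemma energy_posPart_le (hp : 2 ≤ p) (hu : u ∈ energySpace p θ Ω) :
    energy p θ (u ⊔ 0) ≤ energyPair p θ u (u ⊔ 0) := by
  refine integral_mono (integrable_abs_rpow hp (posPart_mem hu).2)
    (integrable_dualPow_mul hp hu.2 (posPart_mem hu).2) fun z => ?_
  simpa [incr] using dualPow_sub_mul_posPart hp (u z.2) (u z.1)

lemma massPair_posPart (hp : 2 ≤ p) : massPair p u (u ⊔ 0) = mass p (u ⊔ 0) := by
  rw [← massPair_self hp]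
  refine integral_congr_ae (ae_of_all _ fun x => ?_)
  simp only [BoundedContinuousFunction.coe_sup, Pi.sup_apply, BoundedContinuousFunction.coe_zero,
    Pi.zero_apply]
  rcases le_total (u x) 0 with h | h
  · simp [h]
  · simp [h]

lemma massPair_nonneg (hp : 2 ≤ p) (hu : 0 ≤ u) (hv : 0 ≤ v) : 0 ≤ massPair p u v := by
  refine integral_nonneg fun x => ?_
  have h1 : 0 ≤ u x := hu x
  simp only [Pi.zero_apply]
  rw [dualPow_of_nonneg hp h1]
  exact mul_nonneg (by positivity) (hv x)

lemma Solves.energy_posPart_le (hp : 2 ≤ p) (h : Solves p θ Ω lam u u) :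
    energy p θ (u ⊔ 0) ≤ lam * mass p (u ⊔ 0) := by
  rw [← massPair_posPart hp, ← h.eq _ (posPart_mem h.mem)]
  exact FracEigen.energy_posPart_le hp h.mem

end Lattice

/-! ### Picone test functions and the strong minimum principle -/

lemma abs_rpow_sub_rpow_le {q M x y : ℝ} (hq : 1 ≤ q) (hx : 0 ≤ x) (hxM : x ≤ M) (hy : 0 ≤ y)
    (hyM : y ≤ M) : |x ^ q - y ^ q| ≤ q * M ^ (q - 1) * |x - y| := by
  have := Convex.norm_image_sub_le_of_norm_hasDerivWithin_le (𝕜 := ℝ) (f := fun t : ℝ => t ^ q)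
    (f' := fun t => q * t ^ (q - 1)) (s := Set.Icc 0 M) (C := q * M ^ (q - 1)) (x := y) (y := x)
    (fun t _ => (Real.hasDerivAt_rpow_const (Or.inr hq)).hasDerivWithinAt)
    (fun t ht => by
      have := ht.1
      rw [Real.norm_of_nonneg (by positivity)]
      exact mul_le_mul_of_nonneg_left (Real.rpow_le_rpow ht.1 ht.2 (by linarith)) (by linarith)) (convex_Icc 0 M) ⟨hy, hyM⟩ ⟨hx, hxM⟩
  simpa using this

/-- The ratio `a^p / (c + ε)^(p-1)`. -/
noncomputable def piconeRatio (p ε a c : ℝ) : ℝ := a ^ p / (c + ε) ^ (p - 1)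

/-- The shift ε keeps the denominator away from 0, so the ratio is Lipschitz on bounded a. Hence
Picone test functions have finite energy. -/
lemma abs_piconeRatio_sub_le {p ε M : ℝ} (hp : 2 ≤ p) (hε : 0 < ε) (hM : 0 ≤ M) : ∃ L : ℝ,
    ∀ a b c d : ℝ, 0 ≤ a → a ≤ M → 0 ≤ b → b ≤ M → 0 ≤ c → 0 ≤ d →
    |piconeRatio p ε a c - piconeRatio p ε b d| ≤ L * (|a - b| + |c - d|) := by
  set L₁ := p * M ^ (p - 1) * ε⁻¹ ^ (p - 1)
  set L₂ := M ^ p * ((p - 1) * ε⁻¹ ^ (p - 1 - 1) * (ε⁻¹ * ε⁻¹))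
  have hp1 : 0 ≤ p - 1 := by linarith
  have hL₁ : 0 ≤ L₁ := by positivity
  have hL₂ : 0 ≤ L₂ := by positivity
  refine ⟨L₁ + L₂, fun a b c d ha haM hb hbM hc hd => ?_⟩
  have e : ∀ x t : ℝ, 0 ≤ t → piconeRatio p ε x t = x ^ p * (t + ε)⁻¹ ^ (p - 1) := fun x t ht => by
    rw [piconeRatio, Real.inv_rpow (by linarith), div_eq_mul_inv]
  rw [e a c hc, e b d hd]
  have hci : (c + ε)⁻¹ ≤ ε⁻¹ := by gcongr; linarith
  have hdi : (d + ε)⁻¹ ≤ ε⁻¹ := by gcongr; linarith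
  have hc0 : 0 < c + ε := by linarith
  have hd0 : 0 < d + ε := by linarith
  have h1 := abs_rpow_sub_rpow_le (q := p) (by linarith) ha haM hb hbM
  have h2 := abs_rpow_sub_rpow_le (q := p - 1) (by linarith) (inv_nonneg.2 hc0.le) hci
    (inv_nonneg.2 hd0.le) hdi
  have h3 : |(c + ε)⁻¹ - (d + ε)⁻¹| ≤ ε⁻¹ * ε⁻¹ * |c - d| := by
    have : (c + ε)⁻¹ - (d + ε)⁻¹ = (c + ε)⁻¹ * (d + ε)⁻¹ * (d - c) := by field_simp; ring
    rw [this, abs_mul, abs_of_nonneg (by positivity), abs_sub_comm]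
    gcongr
  have h4 : (c + ε)⁻¹ ^ (p - 1) ≤ ε⁻¹ ^ (p - 1) := by gcongr
  have h5 : b ^ p ≤ M ^ p := by gcongr
  have h6 : a ^ p * (c + ε)⁻¹ ^ (p - 1) - b ^ p * (d + ε)⁻¹ ^ (p - 1) =
      (a ^ p - b ^ p) * (c + ε)⁻¹ ^ (p - 1) + b ^ p * ((c + ε)⁻¹ ^ (p - 1) - (d + ε)⁻¹ ^ (p - 1)) := by ring
  rw [h6]
  have hpow : 0 ≤ (c + ε)⁻¹ ^ (p - 1) := by positivity
  have hbp : 0 ≤ b ^ p := by positivity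
  calc _ ≤ |a ^ p - b ^ p| * (c + ε)⁻¹ ^ (p - 1) + b ^ p * |(c + ε)⁻¹ ^ (p - 1) - (d + ε)⁻¹ ^ (p - 1)| := by
        refine (abs_add_le _ _).trans ?_
        rw [abs_mul, abs_mul, abs_of_nonneg hpow, abs_of_nonneg hbp]
    _ ≤ (p * M ^ (p - 1) * |a - b|) * ε⁻¹ ^ (p - 1) +
        M ^ p * ((p - 1) * ε⁻¹ ^ (p - 1 - 1) * (ε⁻¹ * ε⁻¹ * |c - d|)) := by
        have h7 : |(c + ε)⁻¹ ^ (p - 1) - (d + ε)⁻¹ ^ (p - 1)| ≤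
            (p - 1) * ε⁻¹ ^ (p - 1 - 1) * (ε⁻¹ * ε⁻¹ * |c - d|) := h2.trans (by gcongr)
        gcongr
    _ = L₁ * |a - b| + L₂ * |c - d| := by ring
    _ ≤ (L₁ + L₂) * (|a - b| + |c - d|) := by
        nlinarith [mul_nonneg hL₁ (abs_nonneg (c - d)), mul_nonneg hL₂ (abs_nonneg (a - b))]

section Picone

variable {n : ℕ} {p θ lam : ℝ} {Ω : Set (Space n)} {u v : Space n →ᵇ ℝ}

/-- The Picone test function `u^p / (v + ε)^(p-1)`. -/
lemma exists_piconeTest (hp : 2 ≤ p) (hu : u ∈ energySpace p θ Ω) (hu0 : 0 ≤ u)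
    (hv : v ∈ energySpace p θ Ω) (hv0 : 0 ≤ v) {ε : ℝ} (hε : 0 < ε) :
    ∃ φ ∈ energySpace p θ Ω, 0 ≤ φ ∧ ∀ x, φ x = piconeRatio p ε (u x) (v x) := by
  have hu0' : ∀ x, 0 ≤ u x := fun x => hu0 x
  have hv0' : ∀ x, 0 ≤ v x := fun x => hv0 x
  have hpos : ∀ x, 0 < v x + ε := fun x => by linarith [hv0' x]
  have hle : ∀ x, u x ≤ ‖u‖ := fun x => (le_abs_self _).trans (u.norm_coe_le_norm x)
  have hcont : Continuous fun x => piconeRatio p ε (u x) (v x) := by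
    unfold piconeRatio
    refine (u.continuous.rpow_const fun _ => Or.inr (by linarith)).div
      ((v.continuous.add continuous_const).rpow_const fun x => Or.inl (hpos x).ne') fun x => ?_
    have := hpos x
    positivity
  have hnn : ∀ x, 0 ≤ piconeRatio p ε (u x) (v x) := fun x => by
    have := hpos x
    have := hu0' x
    unfold piconeRatio
    positivity
  let φ : Space n →ᵇ ℝ := BoundedContinuousFunction.ofNormedAddCommGroup
    (fun x => piconeRatio p ε (u x) (v x)) hcont (‖u‖ ^ p / ε ^ (p - 1)) fun x => by
      rw [Real.norm_of_nonneg (hnn x), piconeRatio]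
      have h1 := hu0' x
      have h2 := hle x
      have h3 := hv0' x
      have h4 : 0 ≤ p - 1 := by linarith
      gcongr
      linarith
  obtain ⟨L, hL⟩ := abs_piconeRatio_sub_le hp hε (norm_nonneg u)
  refine ⟨φ, mem_energySpace_of_abs_sub_le hu hv (fun x hx => ?_) (L := L) fun x y =>
    hL _ _ _ _ (hu0' x) (hle x) (hu0' y) (hle y) (hv0' x) (hv0' y), fun x => hnn x, fun x => rfl⟩
  change piconeRatio p ε (u x) (v x) = 0
  rw [zero_of_mem hu hx, piconeRatio, Real.zero_rpow (by linarith), zero_div]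

lemma dualPow_mul_piconeRatio_le (hp : 2 ≤ p) (hu0 : 0 ≤ u) (hv0 : 0 ≤ v) {ε : ℝ} (hε : 0 < ε)
    {φ : Space n →ᵇ ℝ} (hφ : ∀ x, φ x = piconeRatio p ε (u x) (v x)) (z : Space n × Space n) :
    dualPow p (incr v z) * incr φ z ≤ |incr u z| ^ p := by
  have h1 : 0 ≤ v z.1 := hv0 z.1
  have h2 : 0 ≤ v z.2 := hv0 z.2
  have := picone hp (hu0 z.2) (hu0 z.1) (c := v z.2 + ε) (d := v z.1 + ε) (by linarith) (by linarith)
  rw [add_sub_add_right_eq_sub] at this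
  simpa [incr, hφ, piconeRatio] using this

lemma energyPair_piconeRatio_le (hp : 2 ≤ p) (hu : u ∈ energySpace p θ Ω) (hu0 : 0 ≤ u)
    (hv : v ∈ energySpace p θ Ω) (hv0 : 0 ≤ v) {ε : ℝ} (hε : 0 < ε) {φ : Space n →ᵇ ℝ}
    (hφm : φ ∈ energySpace p θ Ω) (hφ : ∀ x, φ x = piconeRatio p ε (u x) (v x)) :
    energyPair p θ v φ ≤ energy p θ u :=
  integral_mono (integrable_dualPow_mul hp hv.2 hφm.2) (integrable_abs_rpow hp hu.2)
    (dualPow_mul_piconeRatio_le hp hu0 hv0 hε hφ)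

/-- Minimum principle: a nonnegative weak supersolution which is not identically zero is positive
almost everywhere. -/
lemma ae_pos_of_supersolution (hp : 2 ≤ p) (hv : v ∈ energySpace p θ Ω) (hv0 : 0 ≤ v) (hvne : v ≠ 0)
    (hsup : ∀ φ ∈ energySpace p θ Ω, 0 ≤ φ → 0 ≤ energyPair p θ v φ) (hu : u ∈ energySpace p θ Ω)
    (hu0 : 0 ≤ u) : ∀ᵐ x, u x ≠ 0 → v x ≠ 0 := by
  set κ := kernelMeasure n θ with hκ
  set ε : ℕ → ℝ := fun k => 1 / ((k : ℝ) + 1) with hε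
  have hε0 : ∀ k, 0 < ε k := fun k => by positivity
  choose φ hφm hφ0 hφ using fun k => exists_piconeTest hp hu hu0 hv hv0 (hε0 k)
  -- The Picone deficit: pointwise nonnegative, with integral at most the energy of u because v is a
  -- supersolution. By Fatou its lower limit is finite almost everywhere.
  set g : ℕ → Space n × Space n → ℝ := fun k z => |incr u z| ^ p - dualPow p (incr v z) * incr (φ k) z
    with hg
  have hg0 : ∀ k z, 0 ≤ g k z := fun k z =>
    sub_nonneg.2 (dualPow_mul_piconeRatio_le hp hu0 hv0 (hε0 k) (hφ k) z)
  have hgi : ∀ k, Integrable (g k) κ := fun k =>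
    (integrable_abs_rpow hp hu.2).sub (integrable_dualPow_mul hp hv.2 (hφm k).2)
  have hgle : ∀ k, ∫ z, g k z ∂κ ≤ energy p θ u := by
    intro k
    rw [hg]
    simp only
    rw [integral_sub (integrable_abs_rpow hp hu.2) (integrable_dualPow_mul hp hv.2 (hφm k).2)]
    have := hsup _ (hφm k) (hφ0 k)
    change energy p θ u - energyPair p θ v (φ k) ≤ _
    linarith
  have hgm : ∀ k, Measurable fun z => ENNReal.ofReal (g k z) := fun k => by
    have h1 := measurable_incr u.continuous.measurable
    have h2 := measurable_incr (φ k).continuous.measurable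
    have h3 := (continuous_dualPow hp).measurable.comp (measurable_incr v.continuous.measurable)
    refine Measurable.ennreal_ofReal (Measurable.sub ?_ (Measurable.mul h3 h2))
    fun_prop
  have hliminf : ∫⁻ z, liminf (fun k => ENNReal.ofReal (g k z)) atTop ∂κ < ⊤ := by
    refine lt_of_le_of_lt (lintegral_liminf_le hgm) ?_
    refine lt_of_le_of_lt (b := ENNReal.ofReal (energy p θ u)) ?_ ENNReal.ofReal_lt_top
    refine liminf_le_of_le ⟨0, by simp⟩ fun b hb => ?_
    obtain ⟨k, hk⟩ := hb.exists
    refine hk.trans ?_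
    rw [← ofReal_integral_eq_lintegral_ofReal (hgi k) (ae_of_all _ (hg0 k))]
    exact ENNReal.ofReal_le_ofReal (hgle k)
  have hae := ae_lt_top (Measurable.liminf hgm) hliminf.ne
  set Z : Set (Space n) := {x | u x ≠ 0 ∧ v x = 0} with hZ
  set K : Set (Space n) := {x | v x ≠ 0} with hK
  -- If v x = 0 < u x and v y > 0, the nonlocal interaction contributes v(y)^(p-1) u(x)^p
  -- ε^(-(p-1)), which is unbounded as ε → 0. Hence Z × K is null, and so is Z, since K is open and
  -- nonempty.
  have hblow : ∀ z ∈ Z ×ˢ K, liminf (fun k => ENNReal.ofReal (g k z)) atTop = ⊤ := by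
    rintro ⟨x, y⟩ ⟨⟨hux, hvx⟩, hvy⟩
    have hux' : 0 < u x := lt_of_le_of_ne (hu0 x) (Ne.symm hux)
    have hvy' : 0 < v y := lt_of_le_of_ne (hv0 y) (Ne.symm hvy)
    refine Tendsto.liminf_eq (ENNReal.tendsto_ofReal_atTop.comp ?_)
    have hlow : ∀ k : ℕ, v y ^ (p - 1) * u x ^ p * ((k : ℝ) + 1) ^ (p - 1) - u y ^ p ≤ g k (x, y) := by
      intro k
      simp only [hg, incr, hφ, hvx, sub_zero, piconeRatio, zero_add]
      rw [dualPow_of_nonneg hp hvy'.le]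
      have h1 : v y ^ (p - 1) * (u y ^ p / (v y + ε k) ^ (p - 1)) ≤ u y ^ p := by
        have h2 : v y ^ (p - 1) ≤ (v y + ε k) ^ (p - 1) := by
          have := hε0 k
          have : 0 ≤ p - 1 := by linarith
          gcongr
          linarith
        have h3 : 0 < (v y + ε k) ^ (p - 1) := by have := hε0 k; positivity
        rw [mul_div_assoc', div_le_iff₀ h3, mul_comm]
        have : 0 ≤ u y ^ p := Real.rpow_nonneg (hu0 y) p
        gcongr
      have h4 : u x ^ p / ε k ^ (p - 1) = u x ^ p * ((k : ℝ) + 1) ^ (p - 1) := by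
        rw [hε]
        simp only
        rw [one_div, Real.inv_rpow (by positivity), div_inv_eq_mul]
      rw [h4, mul_sub]
      have h5 : 0 ≤ |u y - u x| ^ p := by positivity
      linarith
    refine tendsto_atTop_mono hlow (tendsto_atTop_add_const_right _ _ ?_)
    refine Tendsto.const_mul_atTop (by positivity) ?_
    exact (tendsto_rpow_atTop (by linarith)).comp
      (tendsto_atTop_add_const_right _ _ tendsto_natCast_atTop_atTop)
  have hnull : κ (Z ×ˢ K) = 0 := by
    refine measure_mono_null (fun z hz => ?_) hae
    simp only [Set.mem_compl_iff, Set.mem_ofPred_eq, hblow z hz, lt_irrefl, not_false_eq_true]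
  have hvol : (volume : Measure (Space n × Space n)) (Z ×ˢ K) = 0 := by
    rw [hκ, kernelMeasure, withDensity_apply_eq_zero (measurable_kernel n θ)] at hnull
    refine measure_mono_null (t := {z | ENNReal.ofReal ((‖z.2 - z.1‖ ^ θ)⁻¹) ≠ 0} ∩ Z ×ˢ K)
      (fun z hz => ⟨?_, hz⟩) hnull
    -- The density of the kernel measure is positive only off the diagonal; the product set avoids
    -- it, as v vanishes at the first point and not at the second.
    have hne : z.2 ≠ z.1 := by
      intro h
      apply hz.2
      rw [h]
      exact hz.1.2
    have hpos : 0 < ‖z.2 - z.1‖ := norm_pos_iff.2 (sub_ne_zero.2 hne)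
    simp only [Set.mem_ofPred_eq, ne_eq, ENNReal.ofReal_eq_zero, not_le]
    positivity
  rw [Measure.volume_eq_prod, Measure.prod_prod, mul_eq_zero] at hvol
  have hKpos : volume K ≠ 0 := by
    have hKo : IsOpen K := isOpen_ne_fun v.continuous continuous_const
    refine (hKo.measure_pos volume ?_).ne'
    by_contra hcon
    rw [Set.not_nonempty_iff_eq_empty, Set.eq_empty_iff_forall_notMem] at hcon
    exact hvne (by ext x; simpa [hK] using hcon x)
  have hZ0 := hvol.resolve_right hKpos
  rw [ae_iff]
  convert hZ0 using 2
  ext x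
  simp [hZ]

end Picone

/-! ### Signs of eigenfunctions and isolation of the first eigenvalue -/

section Sign

variable {n : ℕ} {p θ lam l₁ : ℝ} {Ω : Set (Space n)} {u v w : Space n →ᵇ ℝ}

lemma sup_zero_eq_zero_iff : u ⊔ 0 = 0 ↔ u ≤ 0 := sup_eq_right

lemma Solves.ae_ne_zero (hp : 2 ≤ p) (h : Solves p θ Ω lam v v) (hl : 0 ≤ lam) (hv0 : 0 ≤ v)
    (hv : v ≠ 0) (hu : u ∈ energySpace p θ Ω) : ∀ᵐ x, u x ≠ 0 → v x ≠ 0 := by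
  have := ae_pos_of_supersolution hp h.mem hv0 hv (fun φ hφ hφ0 => by
    rw [h.eq φ hφ]
    exact mul_nonneg hl (massPair_nonneg hp hv0 hφ0)) (abs_mem hu) (abs_nonneg u)
  simpa using this

/-- A minimiser of the Rayleigh quotient does not change sign. -/
lemma Admissible.sign_of_minimizer (H : Admissible n p θ Ω) (hl0 : 0 ≤ l₁)
    (hl : ∀ ψ ∈ energySpace p θ Ω, l₁ * mass p ψ ≤ energy p θ ψ) (h : Solves p θ Ω l₁ u u) :
    0 ≤ u ∨ u ≤ 0 := by
  have hp := H.two_le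
  by_contra hcon
  push Not at hcon
  have hpos : u ⊔ 0 ≠ 0 := fun h' => hcon.2 (sup_zero_eq_zero_iff.1 h')
  -- Testing with u⁺ shows that u⁺ also attains the minimum, hence is itself a solution. The minimum
  -- principle then forces u⁺ ≠ 0 almost everywhere on {u ≠ 0}, which rules out the nonempty open
  -- set {u < 0}.
  have hs := H.solves_of_minimizer hl0 hl (posPart_mem h.mem) (h.energy_posPart_le hp)
  have hae := hs.ae_ne_zero hp hl0 le_sup_right hpos h.mem
  obtain ⟨x, hx⟩ : ∃ x, u x < 0 := by
    by_contra hc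
    push Not at hc
    exact hcon.1 fun x => hc x
  have hopen : IsOpen {x | u x < 0} := isOpen_lt u.continuous continuous_const
  have hnull : volume {x | u x < 0} = 0 := by
    refine measure_mono_null (fun y hy => ?_) (ae_iff.1 hae)
    have hy' : u y < 0 := hy
    simp [hy'.le, hy'.ne]
  exact (hopen.measure_pos volume ⟨x, hx⟩).ne' hnull

/-- The eigenvalue of a nonnegative eigenfunction is a lower bound of the Rayleigh quotient. -/
lemma Solves.mul_mass_le (H : Admissible n p θ Ω) (h : Solves p θ Ω lam v v) (hl : 0 ≤ lam)
    (hv0 : 0 ≤ v) (hv : v ≠ 0) (hu : u ∈ energySpace p θ Ω) (hu0 : 0 ≤ u) :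
    lam * mass p u ≤ energy p θ u := by
  have hp := H.two_le
  set ε : ℕ → ℝ := fun k => 1 / ((k : ℝ) + 1) with hε
  have hε0 : ∀ k, 0 < ε k := fun k => by positivity
  choose φ hφm hφ0 hφ using fun k => exists_piconeTest hp hu hu0 h.mem hv0 (hε0 k)
  -- The integrand u^p (v/(v + ε))^(p-1) is dominated by u^p and tends to it wherever v > 0, that is
  -- almost everywhere on {u ≠ 0}.
  have hlim : Tendsto (fun k => massPair p v (φ k)) atTop (𝓝 (mass p u)) := by
    refine tendsto_integral_of_dominated_convergence (fun x => |u x| ^ p) ?_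
      (integrable_abs_rpow hp (memLp_of_mem H.isBounded hu)) ?_ ?_
    · intro k
      exact (((continuous_dualPow hp).comp v.continuous).mul (φ k).continuous).aestronglyMeasurable
    · intro k
      refine ae_of_all _ fun x => ?_
      have h1 : 0 ≤ v x := hv0 x
      have h2 : 0 ≤ u x := hu0 x
      have h3 := hε0 k
      have h4 : 0 ≤ p - 1 := by linarith
      rw [hφ, dualPow_of_nonneg hp h1, piconeRatio, Real.norm_of_nonneg (by positivity),
        abs_of_nonneg h2, mul_div_assoc', div_le_iff₀ (by positivity), mul_comm]
      gcongr
      linarith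
    · filter_upwards [h.ae_ne_zero hp hl hv0 hv hu] with x hx
      have h1 : 0 ≤ v x := hv0 x
      have h2 : 0 ≤ u x := hu0 x
      rw [abs_of_nonneg h2]
      by_cases hux : u x = 0
      · simp [hφ, piconeRatio, hux, Real.zero_rpow (show p ≠ 0 by linarith)]
      · have hvx : 0 < v x := lt_of_le_of_ne h1 (Ne.symm (hx hux))
        have hden : Tendsto (fun k => (v x + ε k) ^ (p - 1)) atTop (𝓝 (v x ^ (p - 1))) := by
          have : Tendsto (fun k => v x + ε k) atTop (𝓝 (v x + 0)) :=
            tendsto_one_div_add_atTop_nhds_zero_nat.const_add (v x)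
          rw [add_zero] at this
          exact this.rpow_const (Or.inl hvx.ne')
        have hpow : v x ^ (p - 1) ≠ 0 := by positivity
        have := ((tendsto_const_nhds (x := u x ^ p)).div hden hpow).const_mul (v x ^ (p - 1))
        rw [mul_div_cancel₀ _ hpow] at this
        refine this.congr fun k => ?_
        rw [hφ, dualPow_of_nonneg hp h1, piconeRatio]
        rfl
  refine le_of_tendsto' (hlim.const_mul lam) fun k => ?_
  rw [← h.eq _ (hφm k)]
  exact energyPair_piconeRatio_le hp hu hu0 h.mem hv0 (hε0 k) (hφm k) (hφ k)

lemma Solves.le_of_ne_zero (H : Admissible n p θ Ω)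
    (hl : ∀ ψ ∈ energySpace p θ Ω, l₁ * mass p ψ ≤ energy p θ ψ) (h : Solves p θ Ω lam v v)
    (hv : v ≠ 0) : l₁ ≤ lam := by
  have h1 := hl v h.mem
  rw [h.energy_eq H.two_le, massPair_self H.two_le] at h1
  exact le_of_mul_le_mul_right h1 (mass_pos H.isBounded H.two_le h.mem hv)

/-- Eigenfunctions to eigenvalues other than the first one change sign. -/
lemma Solves.eq_of_nonneg (H : Admissible n p θ Ω) (hl0 : 0 ≤ l₁)
    (hl : ∀ ψ ∈ energySpace p θ Ω, l₁ * mass p ψ ≤ energy p θ ψ) (he : IsEigen p θ Ω l₁)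
    (h : Solves p θ Ω lam v v) (hv : v ≠ 0) (hv0 : 0 ≤ v) : lam = l₁ := by
  have hp := H.two_le
  have hle := h.le_of_ne_zero H hl hv
  refine le_antisymm ?_ hle
  have key : ∃ u, u ≠ 0 ∧ 0 ≤ u ∧ Solves p θ Ω l₁ u u := by
    obtain ⟨u, hu0, hu⟩ := he
    rcases H.sign_of_minimizer hl0 hl hu with h1 | h1
    · exact ⟨u, hu0, h1, hu⟩
    · exact ⟨-u, neg_ne_zero.2 hu0, neg_nonneg.2 h1, hu.neg⟩
  obtain ⟨u, hu0, hun, hu⟩ := key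
  -- Picone with the first eigenfunction u as competitor: lam · mass(u) ≤ energy(u) = l₁ · mass(u).
  have h1 := h.mul_mass_le H (hl0.trans hle) hv0 hv hu.mem hun
  rw [hu.energy_eq hp, massPair_self hp] at h1
  exact le_of_mul_le_mul_right h1 (mass_pos H.isBounded hp hu.mem hu0)

lemma mass_le_norm_mul (hp : 2 ≤ p) {S : Set (Space n)} (hSf : volume S ≠ ⊤)
    (h : ∀ x ∉ S, u x = 0) : mass p u ≤ ‖u‖ ^ p * volume.real S := by
  have e : mass p u = ∫ x in S, |u x| ^ p := by
    refine (setIntegral_eq_integral_of_forall_compl_eq_zero fun x hx => ?_).symm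
    rw [h x hx, abs_zero, Real.zero_rpow (by linarith)]
  rw [e]
  refine (le_abs_self _).trans (norm_setIntegral_le_of_norm_le_const (μ := volume)
    (f := fun x => |u x| ^ p) (C := ‖u‖ ^ p) hSf.lt_top fun x _ => ?_)
  rw [Real.norm_of_nonneg (by positivity)]
  exact Real.rpow_le_rpow (abs_nonneg _) (u.norm_coe_le_norm x) (by linarith)

lemma Admissible.exists_mass_le (H : Admissible n p θ Ω) : ∃ C : ℝ, 0 < C ∧
    ∀ u ∈ energySpace p θ Ω, mass p u ≤ C * energy p θ u := by
  obtain ⟨C, hC, h⟩ := H.sup_bound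
  have hf : volume Ω ≠ ⊤ := H.isBounded.measure_lt_top.ne
  refine ⟨C * (volume.real Ω + 1), by positivity, fun u hu => ?_⟩
  have h1 := mass_le_norm_mul H.two_le hf fun x hx => zero_of_mem hu hx
  have h2 := h u hu
  have h3 := energy_nonneg (p := p) (θ := θ) (u := u)
  calc _ ≤ _ := h1
    _ ≤ (C * energy p θ u) * (volume.real Ω + 1) := by
      gcongr
      linarith
    _ = _ := by ring

/-- A lower bound for the measure of a nodal domain. -/
lemma Admissible.exists_nodal_bound (H : Admissible n p θ Ω) : ∃ C : ℝ, 0 < C ∧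
    ∀ (lam : ℝ) (u : Space n →ᵇ ℝ), 0 ≤ lam → Solves p θ Ω lam u u → ¬ u ≤ 0 →
      1 ≤ lam * C * volume.real {x | 0 < u x} := by
  have hp := H.two_le
  obtain ⟨C, hC, h⟩ := H.sup_bound
  refine ⟨C, hC, fun lam u hl hu hpos => ?_⟩
  have hm := posPart_mem hu.mem
  have hne : u ⊔ 0 ≠ 0 := fun h' => hpos (sup_zero_eq_zero_iff.1 h')
  have hnorm : 0 < ‖u ⊔ 0‖ ^ p := Real.rpow_pos_of_pos (norm_pos_iff.2 hne) p
  have hSf : volume {x | 0 < u x} ≠ ⊤ := by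
    refine ((measure_mono fun x (hx : 0 < u x) => ?_).trans_lt (H.isBounded.measure_lt_top (μ := volume))).ne
    by_contra hxn
    exact hx.ne' (zero_of_mem hu.mem hxn)
  have h1 := h _ hm
  have h2 := hu.energy_posPart_le hp
  have h3 := mass_le_norm_mul (u := u ⊔ 0) hp hSf fun x hx => by
    have : u x ≤ 0 := not_lt.1 hx
    simp [this]
  -- The sup bound, the equation tested with u⁺, and the estimate of the mass by sup norm times
  -- support are chained; the sup norm of u⁺ then cancels.
  have h4 : 1 * ‖u ⊔ 0‖ ^ p ≤ lam * C * volume.real {x | 0 < u x} * ‖u ⊔ 0‖ ^ p := by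
    calc _ = ‖u ⊔ 0‖ ^ p := one_mul _
      _ ≤ C * (lam * (‖u ⊔ 0‖ ^ p * volume.real {x | 0 < u x})) := by
        refine h1.trans ?_
        gcongr
        exact h2.trans (by gcongr)
      _ = _ := by ring
  exact le_of_mul_le_mul_right h4 hnorm

lemma tendsto_measure_superlevel (hΩ : Bornology.IsBounded Ω) (hv : v ∈ energySpace p θ Ω) :
    Tendsto (fun j : ℕ => volume {x | 0 < v x ∧ v x ≤ 1 / ((j : ℝ) + 1)}) atTop (𝓝 0) := by
  have hanti : Antitone fun j : ℕ => {x | 0 < v x ∧ v x ≤ 1 / ((j : ℝ) + 1)} := by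
    intro i j hij x hx
    refine ⟨hx.1, hx.2.trans ?_⟩
    gcongr
  have hinter : ⋂ j : ℕ, {x | 0 < v x ∧ v x ≤ 1 / ((j : ℝ) + 1)} = ∅ := by
    rw [Set.eq_empty_iff_forall_notMem]
    intro x hx
    rw [Set.mem_iInter] at hx
    have h1 : v x ≤ 0 := ge_of_tendsto' tendsto_one_div_add_atTop_nhds_zero_nat fun j => (hx j).2
    exact absurd (hx 0).1 (not_lt.2 h1)
  have := tendsto_measure_iInter_atTop (μ := volume)
    (s := fun j : ℕ => {x | 0 < v x ∧ v x ≤ 1 / ((j : ℝ) + 1)})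
    (fun j => by
      have hm := v.continuous.measurable
      exact ((measurableSet_lt measurable_const hm).inter (measurableSet_le hm measurable_const)).nullMeasurableSet)
    hanti ⟨0, ((measure_mono fun x hx => ?_).trans_lt (hΩ.measure_lt_top (μ := volume))).ne⟩
  · rwa [hinter, measure_empty] at this
  · by_contra hxn
    exact hx.1.ne' (zero_of_mem hv hxn)

/-- The contradiction when the limiting first eigenfunction is nonnegative: the negative sets of the
u k become arbitrarily small, against the nodal bound. The other sign follows by passing to -u k. -/
lemma Admissible.isolated_aux (H : Admissible n p θ Ω) (hl0 : 0 ≤ l₁)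
    (hl : ∀ ψ ∈ energySpace p θ Ω, l₁ * mass p ψ ≤ energy p θ ψ) (he : IsEigen p θ Ω l₁)
    {l : ℕ → ℝ} {u : ℕ → Space n →ᵇ ℝ} (hu : ∀ k, Solves p θ Ω (l k) (u k) (u k)) (hu0 : ∀ k, u k ≠ 0)
    (hne : ∀ k, l k ≠ l₁) (hlim : Tendsto l atTop (𝓝 l₁)) (hv : Solves p θ Ω l₁ v v) (hv0 : 0 ≤ v)
    (hvne : v ≠ 0) (huv : Tendsto u atTop (𝓝 v)) : False := by
  have hp := H.two_le
  obtain ⟨C, hC, hnod⟩ := H.exists_nodal_bound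
  obtain ⟨M, hM⟩ := hlim.bddAbove_range
  have hlk : ∀ k, 0 ≤ l k := fun k => hl0.trans ((hu k).le_of_ne_zero H hl (hu0 k))
  have hM0 : 0 ≤ M := (hlk 0).trans (hM ⟨0, rfl⟩)
  -- A measure so small that, with l k ≤ M, the nodal lower bound 1 ≤ l k · C · |{u k < 0}| must
  -- fail.
  have hsmall : 0 < 1 / (2 * (M * C + 1)) := by positivity
  obtain ⟨j, hj⟩ := ((tendsto_measure_superlevel H.isBounded hv.mem).eventually_lt_const
    (ENNReal.ofReal_pos.2 hsmall)).exists
  have hj0 : (0 : ℝ) < 1 / ((j : ℝ) + 1) := by positivity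
  obtain ⟨k, hk⟩ := ((Metric.tendsto_nhds.1 huv) _ hj0).exists
  have hchange : ¬ -u k ≤ 0 := fun h' =>
    hne k ((hu k).eq_of_nonneg H hl0 hl he (hu0 k) (neg_nonpos.1 h'))
  have h1 := hnod (l k) (-u k) (hlk k) (hu k).neg hchange
  have hae := hv.ae_ne_zero hp hl0 hv0 hvne (hu k).mem
  -- Where u k < 0, the minimum principle gives v > 0 almost everywhere, and the uniform distance to
  -- u k forces v below 1/(j+1).
  have h2 : volume {x | 0 < (-u k) x} ≤ volume {x | 0 < v x ∧ v x ≤ 1 / ((j : ℝ) + 1)} := by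
    refine measure_mono_ae ?_
    filter_upwards [hae] with x hx (hx0 : 0 < -(u k x))
    have hvx : 0 < v x := lt_of_le_of_ne (hv0 x) (Ne.symm (hx (by linarith)))
    refine ⟨hvx, ?_⟩
    have h3 : dist (u k x) (v x) ≤ dist (u k) v := BoundedContinuousFunction.dist_coe_le_dist x
    rw [Real.dist_eq] at h3
    have h4 := neg_abs_le (u k x - v x)
    linarith
  have h3 : volume.real {x | 0 < (-u k) x} ≤ 1 / (2 * (M * C + 1)) := by
    rw [Measure.real]
    exact ENNReal.toReal_le_of_le_ofReal hsmall.le (h2.trans hj.le)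
  have h4 : l k * C * volume.real {x | 0 < (-u k) x} ≤ M * C * (1 / (2 * (M * C + 1))) := by
    have := hM ⟨k, rfl⟩
    gcongr
  have h5 : M * C * (1 / (2 * (M * C + 1))) < 1 := by
    rw [mul_one_div, div_lt_one (by positivity)]
    nlinarith [mul_nonneg hM0 hC.le]
  linarith

/-- The first eigenvalue is isolated. -/
lemma Admissible.isolated (H : Admissible n p θ Ω) (hl0 : 0 ≤ l₁)
    (hl : ∀ ψ ∈ energySpace p θ Ω, l₁ * mass p ψ ≤ energy p θ ψ) (he : IsEigen p θ Ω l₁)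
    {l : ℕ → ℝ} (h : ∀ k, IsEigen p θ Ω (l k)) (hne : ∀ k, l k ≠ l₁) : ¬ Tendsto l atTop (𝓝 l₁) := by
  intro hlim
  have hp := H.two_le
  choose u h1 hu using fun k => (h k).exists_normalized H
  obtain ⟨v, hv1, hv, ψ, hψ, huv⟩ := H.exists_limit_eigen hu h1 hlim
  have hv0 := ne_zero_of_mass_eq_one hp hv1
  have hu0 := fun k => ne_zero_of_mass_eq_one hp (h1 k)
  have hlim' := hlim.comp hψ.tendsto_atTop
  rcases H.sign_of_minimizer hl0 hl hv with hs | hs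
  · exact H.isolated_aux hl0 hl he (fun k => hu (ψ k)) (fun k => hu0 (ψ k)) (fun k => hne (ψ k)) hlim'
      hv hs hv0 huv
  · exact H.isolated_aux hl0 hl he (fun k => (hu (ψ k)).neg) (fun k => neg_ne_zero.2 (hu0 (ψ k)))
      (fun k => hne (ψ k)) hlim' hv.neg (neg_nonneg.2 hs) (neg_ne_zero.2 hv0) huv.neg

end Sign

/-! ### The solution operator of `A w = c B v` -/

section SolutionOperator

variable {n : ℕ} {p θ c l₁ : ℝ} {Ω : Set (Space n)} {u v w : Space n →ᵇ ℝ}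

/-- Coercivity of ψ ↦ E(ψ) - pc⟨Bv, ψ⟩, uniform for v of bounded mass. It gives both existence of
solutions and their energy bound. -/
lemma Admissible.exists_pair_bound (H : Admissible n p θ Ω) (hc : 0 ≤ c) : ∃ K : ℝ, 0 ≤ K ∧
    ∀ v ∈ energySpace p θ Ω, ∀ ψ ∈ energySpace p θ Ω,
      p * (c * massPair p v ψ) ≤ energy p θ ψ / 2 + K * mass p v := by
  have hp := H.two_le
  obtain ⟨C, hC, h⟩ := H.exists_mass_le
  -- Chosen so that δ · pcC ≤ 1/2, with C the Poincaré constant; the minimum with 1 is required by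
  -- `abs_pair_le`.
  set δ : ℝ := min 1 (1 / (2 * (p * c * C + 1))) with hδ
  have hden : 0 < 2 * (p * c * C + 1) := by positivity
  have hδ0 : 0 < δ := lt_min one_pos (by positivity)
  refine ⟨p * c * δ⁻¹, by positivity, fun v hv ψ hψ => ?_⟩
  have h1 := (le_abs_self _).trans (abs_pair_le hp (memLp_of_mem H.isBounded hv)
    (memLp_of_mem H.isBounded hψ) hδ0 (min_le_left _ _))
  change massPair p v ψ ≤ δ * mass p ψ + δ⁻¹ * mass p v at h1
  have h2 := h ψ hψ
  have hE := energy_nonneg (p := p) (θ := θ) (u := ψ)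
  have h3 : p * c * (δ * mass p ψ) ≤ energy p θ ψ / 2 := by
    have h4 : δ * (p * c * C) ≤ 1 / 2 := by
      have h5 : δ ≤ 1 / (2 * (p * c * C + 1)) := min_le_right _ _
      calc δ * (p * c * C) ≤ 1 / (2 * (p * c * C + 1)) * (p * c * C + 1) := by
            gcongr; linarith
        _ = 1 / 2 := by field_simp
    calc p * c * (δ * mass p ψ) ≤ p * c * (δ * (C * energy p θ ψ)) := by gcongr
      _ = δ * (p * c * C) * energy p θ ψ := by ring
      _ ≤ 1 / 2 * energy p θ ψ := by gcongr
      _ = _ := by ring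
  have h6 : p * (c * massPair p v ψ) ≤ p * (c * (δ * mass p ψ + δ⁻¹ * mass p v)) := by gcongr
  linarith

lemma Solves.unique (H : Admissible n p θ Ω) (hu : Solves p θ Ω c v u) (hw : Solves p θ Ω c v w) :
    u = w := by
  have hp := H.two_le
  have h1 := powInt_sub_le hp hu.mem.2 hw.mem.2
  rw [← incr_coe_sub] at h1
  change energy p θ (u - w) ≤ p * 2 ^ (p - 1) / 2 * (energyPair p θ u (u - w) - energyPair p θ w (u - w)) at h1
  rw [hu.eq _ (sub_mem hu.mem hw.mem), hw.eq _ (sub_mem hu.mem hw.mem), sub_self, mul_zero] at h1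
  by_contra hne
  obtain ⟨C, hC, h⟩ := H.exists_mass_le
  have h2 := mass_pos H.isBounded hp (sub_mem hu.mem hw.mem) (sub_ne_zero.2 hne)
  have h3 := h _ (sub_mem hu.mem hw.mem)
  nlinarith

/-- Direct method: a minimising sequence of the coercive functional F has bounded energy, hence a
uniform limit, which is a minimiser by lower semicontinuity. -/
lemma Admissible.exists_solves (H : Admissible n p θ Ω) (hc : 0 ≤ c) (hv : v ∈ energySpace p θ Ω) :
    ∃ w, Solves p θ Ω c v w := by
  have hp := H.two_le
  obtain ⟨K, hK0, hK⟩ := H.exists_pair_bound hc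
  set F : (Space n →ᵇ ℝ) → ℝ := fun ψ => energy p θ ψ - p * (c * massPair p v ψ) with hF
  set S : Set ℝ := F '' (energySpace p θ Ω : Set (Space n →ᵇ ℝ)) with hS
  have hbelow : ∀ ψ ∈ energySpace p θ Ω, energy p θ ψ / 2 - K * mass p v ≤ F ψ := fun ψ hψ => by
    have := hK v hv ψ hψ
    rw [hF]
    linarith
  have hbdd : BddBelow S := ⟨-(K * mass p v), by
    rintro _ ⟨ψ, hψ, rfl⟩
    have := hbelow ψ hψ
    have := energy_nonneg (p := p) (θ := θ) (u := ψ)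
    linarith⟩
  obtain ⟨s, -, hs, hsS⟩ := exists_seq_tendsto_sInf (S := S) ⟨_, 0, zero_mem _, rfl⟩ hbdd
  choose ψ hψ hψs using hsS
  obtain ⟨M, hM⟩ := hs.bddAbove_range
  obtain ⟨w, hw, r, hr, hlim⟩ := H.exists_subseq hψ (M := 2 * (M + K * mass p v)) fun k => by
    have h1 := hbelow _ (hψ k)
    have h2 : s k ≤ M := hM ⟨k, rfl⟩
    rw [hψs] at h1
    linarith
  refine ⟨w, solves_of_le hp hw fun φ hφ => ?_⟩
  have h1 : Tendsto (fun k => s (r k) + p * (c * massPair p v (ψ (r k)))) atTop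
      (𝓝 (sInf S + p * (c * massPair p v w))) :=
    (hs.comp hr.tendsto_atTop).add (((tendsto_massPair H.isBounded hp (fun _ => hv) tendsto_const_nhds
      hlim).const_mul c).const_mul p)
  have h2 := (energy_fatou hp (fun k => hψ (r k)) hlim (fun k => by
    rw [← hψs (r k), hF]; simp) h1).2
  have h3 : sInf S ≤ F φ := csInf_le hbdd ⟨φ, hφ, rfl⟩
  rw [massPair_sub_right H.isBounded hp hv hφ hw]
  simp only [hF] at h3
  linarith

lemma Solves.energy_le (H : Admissible n p θ Ω) {K : ℝ} (hK : ∀ v ∈ energySpace p θ Ω,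
    ∀ ψ ∈ energySpace p θ Ω, p * (c * massPair p v ψ) ≤ energy p θ ψ / 2 + K * mass p v)
    (hv : v ∈ energySpace p θ Ω) (h : Solves p θ Ω c v w) : energy p θ w ≤ K * mass p v := by
  have hp := H.two_le
  have h1 := hK v hv w h.mem
  rw [← h.energy_eq hp] at h1
  have := energy_nonneg (p := p) (θ := θ) (u := w)
  nlinarith

lemma Solves.ne_zero (H : Admissible n p θ Ω) (hc : 0 < c) (hv : v ∈ energySpace p θ Ω) (hv0 : v ≠ 0)
    (h : Solves p θ Ω c v w) : w ≠ 0 := by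
  rintro rfl
  have h1 := h.eq v hv
  rw [massPair_self H.two_le] at h1
  have h2 : energyPair p θ (0 : Space n →ᵇ ℝ) v = 0 := by
    simp [energyPair, pair, incr]
  have := mass_pos H.isBounded H.two_le hv hv0
  rw [h2] at h1
  exact (mul_pos hc this).ne h1

/-- Testing with the negative part of w shows that its energy is at most 0, so it vanishes by the
Poincaré inequality. -/
lemma Solves.nonneg (H : Admissible n p θ Ω) (hc : 0 ≤ c) (hv0 : 0 ≤ v) (h : Solves p θ Ω c v w) :
    0 ≤ w := by
  have hp := H.two_le
  have hm := posPart_mem (neg_mem h.mem)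
  have h1 := FracEigen.energy_posPart_le hp (neg_mem h.mem)
  rw [energyPair_neg_left, h.eq _ hm] at h1
  have h2 := mul_nonneg hc (massPair_nonneg hp hv0 (le_sup_right : (0 : Space n →ᵇ ℝ) ≤ -w ⊔ 0))
  by_contra hcon
  obtain ⟨C, hC, hb⟩ := H.exists_mass_le
  have h3 := mass_pos H.isBounded hp hm fun h' => hcon (neg_nonpos.1 (sup_zero_eq_zero_iff.1 h'))
  have h4 := hb _ hm
  nlinarith

/-- The solution operator is continuous for uniform convergence. -/
lemma Admissible.exists_solutionOperator (H : Admissible n p θ Ω) (hc : 0 ≤ c) :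
    ∃ T : energySpace p θ Ω → energySpace p θ Ω, Continuous T ∧
      ∀ v : energySpace p θ Ω, Solves p θ Ω c v.1 (T v).1 := by
  have hp := H.two_le
  choose T hT using fun v : energySpace p θ Ω => H.exists_solves hc v.2
  refine ⟨fun v => ⟨T v, (hT v).mem⟩, ?_, hT⟩
  refine Continuous.subtype_mk ?_ _
  obtain ⟨K, hK0, hK⟩ := H.exists_pair_bound hc
  rw [continuous_iff_seqContinuous]
  intro x a hxa
  have hxa' : Tendsto (fun k => (x k : Space n →ᵇ ℝ)) atTop (𝓝 a) :=
    (continuous_subtype_val.tendsto a).comp hxa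
  obtain ⟨M, hM⟩ := (tendsto_mass H.isBounded hp (fun k => (x k).2) hxa').bddAbove_range
  have hE : ∀ k, energy p θ (T (x k)) ≤ K * M := fun k =>
    ((hT (x k)).energy_le H hK (x k).2).trans (mul_le_mul_of_nonneg_left (hM ⟨k, rfl⟩) hK0)
  -- Every subsequence of images has a uniformly convergent further subsequence whose limit solves
  -- the limit problem; uniqueness identifies it with the image of a.
  refine tendsto_of_subseq_tendsto fun ns hns => ?_
  obtain ⟨w, hw, r, hr, hlim⟩ := H.exists_subseq (fun k => (hT (x (ns k))).mem) (M := K * M) fun k => hE _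
  refine ⟨r, ?_⟩
  have h1 : Solves p θ Ω c a w := Solves.of_tendsto H (fun k => hT (x (ns (r k))))
    (fun k => (x _).2) hlim (hxa'.comp (hns.comp hr.tendsto_atTop)) tendsto_const_nhds
  rw [(hT a).unique H h1]
  exact hlim

end SolutionOperator

/-! ### A minimax level above the first eigenvalue -/

section Minimax

variable {n : ℕ} {p θ c l₁ : ℝ} {Ω : Set (Space n)} {u v w : Space n →ᵇ ℝ}

/-- The levels `r` below which some connected set of nonzero functions links a nonnegative function
to a nonpositive one. -/
def linkingLevels {n : ℕ} (p θ : ℝ) (Ω : Set (Space n)) : Set ℝ :=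
  {r | ∃ K : Set (energySpace p θ Ω), IsPreconnected K ∧
    (∀ u ∈ K, u ≠ 0 ∧ energy p θ u.1 ≤ r * mass p u.1) ∧
    (∃ u ∈ K, 0 ≤ u.1) ∧ ∃ u ∈ K, u.1 ≤ 0}

lemma integrable_of_mem (hΩ : Bornology.IsBounded Ω) (hu : u ∈ energySpace p θ Ω) :
    Integrable u volume :=
  u.continuous.integrable_of_hasCompactSupport (HasCompactSupport.intro' (K := closure Ω)
    hΩ.isCompact_closure isClosed_closure fun _ hx => zero_of_mem hu fun h => hx (subset_closure h))

lemma abs_integral_le (hΩ : Bornology.IsBounded Ω) (hu : u ∈ energySpace p θ Ω) :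
    |∫ x, u x| ≤ ‖u‖ * volume.real Ω := by
  have e : ∫ x, u x = ∫ x in Ω, u x :=
    (setIntegral_eq_integral_of_forall_compl_eq_zero fun x hx => zero_of_mem hu hx).symm
  rw [e]
  exact norm_setIntegral_le_of_norm_le_const (f := fun x => u x) (hΩ.measure_lt_top)
    fun x _ => u.norm_coe_le_norm x

lemma continuous_integral (hΩ : Bornology.IsBounded Ω) :
    Continuous fun u : energySpace p θ Ω => ∫ x, (u : Space n →ᵇ ℝ) x := by
  refine LipschitzWith.continuous (K := (volume.real Ω).toNNReal) (LipschitzWith.of_dist_le_mul fun u v => ?_)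
  rw [Real.coe_toNNReal _ measureReal_nonneg, Real.dist_eq,
    ← integral_sub (integrable_of_mem hΩ u.2) (integrable_of_mem hΩ v.2), mul_comm,
    Subtype.dist_eq, dist_eq_norm]
  exact abs_integral_le (u := u - v) hΩ (sub_mem u.2 v.2)

lemma eq_zero_of_integral_eq_zero (hΩ : Bornology.IsBounded Ω) (hu : u ∈ energySpace p θ Ω)
    (hu0 : 0 ≤ u) (h : ∫ x, u x = 0) : u = 0 := by
  by_contra hne
  obtain ⟨x, hx⟩ : ∃ x, u x ≠ 0 := by
    by_contra hcon
    push Not at hcon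
    exact hne (by ext x; simp [hcon x])
  have := u.continuous.integral_pos_of_hasCompactSupport_nonneg_nonzero (μ := volume)
    (HasCompactSupport.intro' (K := closure Ω) hΩ.isCompact_closure isClosed_closure
      fun _ hx => zero_of_mem hu fun h => hx (subset_closure h)) (fun x => hu0 x) hx
  exact this.ne' h

/-- The mean is continuous on the connected set, nonnegative at one end and nonpositive at the
other. Mean zero is a closed condition, unlike changing sign, so it survives the limit in
`Admissible.lt_sInf_linking`. -/
lemma exists_mean_zero_of_linking (hΩ : Bornology.IsBounded Ω) {r : ℝ} (hr : r ∈ linkingLevels p θ Ω) :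
    ∃ u ∈ energySpace p θ Ω, u ≠ 0 ∧ ∫ x, u x = 0 ∧ energy p θ u ≤ r * mass p u := by
  obtain ⟨K, hK, hE, ⟨a, haK, ha⟩, b, hbK, hb⟩ := hr
  have h1 : (0 : ℝ) ≤ ∫ x, (a : Space n →ᵇ ℝ) x := integral_nonneg fun x => ha x
  have h2 : ∫ x, (b : Space n →ᵇ ℝ) x ≤ 0 := integral_nonpos fun x => hb x
  obtain ⟨u, huK, hu⟩ := hK.intermediate_value hbK haK (continuous_integral hΩ).continuousOn ⟨h2, h1⟩
  exact ⟨u, u.2, by simpa using (hE u huK).1, hu, (hE u huK).2⟩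

lemma Admissible.le_of_linking (H : Admissible n p θ Ω)
    (hl : ∀ ψ ∈ energySpace p θ Ω, l₁ * mass p ψ ≤ energy p θ ψ) {r : ℝ} (hr : r ∈ linkingLevels p θ Ω) :
    l₁ ≤ r := by
  obtain ⟨u, hu, hu0, -, hE⟩ := exists_mean_zero_of_linking H.isBounded hr
  exact le_of_mul_le_mul_right ((hl u hu).trans hE) (mass_pos H.isBounded H.two_le hu hu0)

/-- A bounded sequence of Rayleigh quotients of normalised functions has a limit point. -/
lemma Admissible.exists_limit_of_energy_le (H : Admissible n p θ Ω) {u : ℕ → Space n →ᵇ ℝ}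
    (hu : ∀ k, u k ∈ energySpace p θ Ω) (h1 : ∀ k, mass p (u k) = 1) {r : ℕ → ℝ} {r' : ℝ}
    (hE : ∀ k, energy p θ (u k) ≤ r k) (hr : Tendsto r atTop (𝓝 r')) :
    ∃ v ∈ energySpace p θ Ω, mass p v = 1 ∧ energy p θ v ≤ r' ∧
      ∃ ψ : ℕ → ℕ, StrictMono ψ ∧ Tendsto (u ∘ ψ) atTop (𝓝 v) := by
  obtain ⟨M, hM⟩ := hr.bddAbove_range
  obtain ⟨v, hv, ψ, hψ, hlim⟩ := H.exists_subseq hu fun k => (hE k).trans (hM ⟨k, rfl⟩)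
  refine ⟨v, hv, ?_, (energy_fatou H.two_le (fun k => hu (ψ k)) hlim (fun k => hE (ψ k))
    (hr.comp hψ.tendsto_atTop)).2, ψ, hψ, hlim⟩
  refine tendsto_nhds_unique (tendsto_mass H.isBounded H.two_le (fun k => hu (ψ k)) hlim) ?_
  simp [h1]

/-- Were the infimum l₁, normalised mean-zero functions would converge uniformly to a first
eigenfunction of mean zero, which cannot have constant sign. -/
lemma Admissible.lt_sInf_linking (H : Admissible n p θ Ω) (hl0 : 0 ≤ l₁)
    (hl : ∀ ψ ∈ energySpace p θ Ω, l₁ * mass p ψ ≤ energy p θ ψ) (hne : (linkingLevels p θ Ω).Nonempty) :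
    l₁ < sInf (linkingLevels p θ Ω) := by
  have hp := H.two_le
  have hbdd : BddBelow (linkingLevels p θ Ω) := ⟨l₁, fun r hr => H.le_of_linking hl hr⟩
  refine lt_of_le_of_ne (le_csInf hne fun r hr => H.le_of_linking hl hr) fun heq => ?_
  obtain ⟨r, -, hr, hrS⟩ := exists_seq_tendsto_sInf hne hbdd
  choose u hu hu0 hint hE using fun k => exists_mean_zero_of_linking H.isBounded (hrS k)
  choose t ht0 ht using fun k => H.exists_smul_mass_eq_one (hu k) (hu0 k)
  have hmem : ∀ k, t k • u k ∈ energySpace p θ Ω := fun k => Submodule.smul_mem _ _ (hu k)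
  obtain ⟨v, hv, hv1, hEv, ψ, hψ, hlim⟩ := H.exists_limit_of_energy_le hmem ht (r := r) (fun k => by
    rw [energy_smul (ht0 k).le]
    have h1 := ht k
    rw [mass_smul (ht0 k).le] at h1
    have h2 : 0 ≤ t k ^ p := Real.rpow_nonneg (ht0 k).le p
    have h3 := mul_le_mul_of_nonneg_left (hE k) h2
    calc _ ≤ _ := h3
      _ = r k * (t k ^ p * mass p (u k)) := by ring
      _ = r k := by rw [h1, mul_one]) hr
  have hv0 := ne_zero_of_mass_eq_one hp hv1
  have hs : Solves p θ Ω l₁ v v := H.solves_of_minimizer hl0 hl hv (by rw [hv1, mul_one, heq]; exact hEv)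
  have hintv : ∫ x, v x = 0 := by
    have h1 : Tendsto (fun k => (⟨t (ψ k) • u (ψ k), hmem (ψ k)⟩ : energySpace p θ Ω)) atTop
        (𝓝 ⟨v, hv⟩) := tendsto_subtype_rng.2 hlim
    refine tendsto_nhds_unique (((continuous_integral H.isBounded).tendsto _).comp h1) ?_
    have h2 : ∀ k, ∫ x, (t k • u k) x = 0 := fun k => by
      simp only [BoundedContinuousFunction.coe_smul, smul_eq_mul]
      rw [integral_const_mul, hint, mul_zero]
    exact tendsto_const_nhds.congr fun k => (h2 (ψ k)).symm
  rcases H.sign_of_minimizer hl0 hl hs with h | h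
  · exact hv0 (eq_zero_of_integral_eq_zero H.isBounded hv h hintv)
  · refine hv0 (neg_eq_zero.1 (eq_zero_of_integral_eq_zero H.isBounded (neg_mem hv) (neg_nonneg.2 h) ?_))
    simp only [BoundedContinuousFunction.coe_neg, Pi.neg_apply]
    rw [integral_neg, hintv, neg_zero]

/-- If `w` solves `A w = c B v` and its Rayleigh quotient is at least `c`, while that of `v` is at
most `c`, then `v` is an eigenfunction with eigenvalue `c`. -/
lemma Solves.isEigen_of_energy_le (H : Admissible n p θ Ω) (hc : 0 < c) (hv : v ∈ energySpace p θ Ω)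
    (hv1 : mass p v = 1) (hEv : energy p θ v ≤ c) (h : Solves p θ Ω c v w)
    (hEw : c * mass p w ≤ energy p θ w) : IsEigen p θ Ω c := by
  have hp := H.two_le
  refine ⟨v, ne_zero_of_mass_eq_one hp hv1, solves_of_le hp hv fun ψ hψ => ?_⟩
  have h1 : p * massPair p v w ≤ (p - 1) * mass p v + mass p w :=
    mul_pair_le hp (memLp_of_mem H.isBounded hv) (memLp_of_mem H.isBounded h.mem)
  have h2 := h.energy_eq hp
  rw [hv1, mul_one] at h1
  have h3 := mul_le_mul_of_nonneg_left h1 hc.le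
  -- From pc · mass(w) ≤ p · energy(w) = pc⟨Bv, w⟩ ≤ c((p-1) + mass(w)); reinserting mass(w) ≤ 1
  -- gives energy(w) ≤ c.
  have hmw : mass p w ≤ 1 := by
    have h4 : (p - 1) * (c * mass p w) ≤ (p - 1) * (c * 1) := by
      have := mul_le_mul_of_nonneg_left hEw (show 0 ≤ p by linarith)
      rw [h2] at this
      linarith
    exact le_of_mul_le_mul_left (le_of_mul_le_mul_left h4 (by linarith)) hc
  have hEw' : energy p θ w ≤ c := by
    have h4 : p * energy p θ w ≤ p * c := by
      have := mul_le_mul_of_nonneg_left hmw hc.le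
      rw [h2]
      linarith
    exact le_of_mul_le_mul_left h4 (by linarith)
  -- The solution w minimises F(ψ) = energy(ψ) - pc⟨Bv, ψ⟩, with F(w) = -(p-1) energy(w) ≥ -(p-1)c ≥
  -- F(v). So v is a minimiser as well, which is the equation A v = c B v.
  have h5 := h.le hp hψ
  rw [massPair_sub_right H.isBounded hp hv hψ h.mem, mul_sub c, ← h2] at h5
  rw [massPair_sub_right H.isBounded hp hv hψ hv, massPair_self hp, hv1]
  have h6 : (p - 1) * energy p θ w ≤ (p - 1) * c := mul_le_mul_of_nonneg_left hEw' (by linarith)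
  linarith

/-- The solution operator T is continuous, keeps functions nonzero and preserves both signs, so it
maps linking sets to linking sets. This replaces the deformation lemma. -/
lemma Admissible.isEigen_sInf_linking (H : Admissible n p θ Ω) (hl0 : 0 ≤ l₁)
    (hl : ∀ ψ ∈ energySpace p θ Ω, l₁ * mass p ψ ≤ energy p θ ψ) (hne : (linkingLevels p θ Ω).Nonempty) :
    IsEigen p θ Ω (sInf (linkingLevels p θ Ω)) := by
  have hp := H.two_le
  have hbdd : BddBelow (linkingLevels p θ Ω) := ⟨l₁, fun r hr => H.le_of_linking hl hr⟩
  have hc0 := hl0.trans_lt (H.lt_sInf_linking hl0 hl hne)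
  set c := sInf (linkingLevels p θ Ω) with hc
  obtain ⟨T, hTc, hT⟩ := H.exists_solutionOperator hc0.le
  have key : ∀ k : ℕ, ∃ v w : Space n →ᵇ ℝ, v ∈ energySpace p θ Ω ∧ Solves p θ Ω c v w ∧ mass p v = 1 ∧
      energy p θ v ≤ c + 1 / ((k : ℝ) + 1) ∧ (c - 1 / ((k : ℝ) + 1)) * mass p w ≤ energy p θ w := by
    intro k
    have hk : (0 : ℝ) < 1 / ((k : ℝ) + 1) := by positivity
    obtain ⟨r, hr, hrc⟩ := exists_lt_of_csInf_lt hne (lt_add_of_pos_right c hk)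
    obtain ⟨K, hK, hE, ⟨a, haK, ha⟩, b, hbK, hb⟩ := hr
    -- Otherwise T '' K would be a linking set at a level below the infimum c.
    have hex : ∃ v ∈ K, (c - 1 / ((k : ℝ) + 1)) * mass p (T v).1 < energy p θ (T v).1 := by
      by_contra hcon
      push Not at hcon
      have hmem : c - 1 / ((k : ℝ) + 1) ∈ linkingLevels p θ Ω := by
        refine ⟨T '' K, hK.image T hTc.continuousOn, ?_, ⟨T a, ⟨a, haK, rfl⟩, (hT a).nonneg H hc0.le ha⟩,
          T b, ⟨b, hbK, rfl⟩, ?_⟩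
        · rintro _ ⟨v, hvK, rfl⟩
          refine ⟨?_, hcon v hvK⟩
          have := (hT v).ne_zero H hc0 v.2 (by simpa using (hE v hvK).1)
          simpa using this
        · exact neg_nonneg.1 ((hT b).neg.nonneg H hc0.le (neg_nonneg.2 hb))
      have := csInf_le hbdd hmem
      linarith
    obtain ⟨v, hvK, hv⟩ := hex
    obtain ⟨t, ht0, ht⟩ := H.exists_smul_mass_eq_one v.2 (by simpa using (hE v hvK).1)
    have htp : 0 < t ^ p := by positivity
    refine ⟨t • v.1, t • (T v).1, Submodule.smul_mem _ _ v.2, (hT v).smul hp ht0.le, ht, ?_, ?_⟩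
    · rw [energy_smul ht0.le]
      rw [mass_smul ht0.le] at ht
      calc _ ≤ t ^ p * (r * mass p v.1) := mul_le_mul_of_nonneg_left (hE v hvK).2 htp.le
        _ = r * (t ^ p * mass p v.1) := by ring
        _ = r := by rw [ht, mul_one]
        _ ≤ _ := hrc.le
    · rw [energy_smul ht0.le, mass_smul ht0.le]
      calc _ = t ^ p * ((c - 1 / ((k : ℝ) + 1)) * mass p (T v).1) := by ring
        _ ≤ _ := mul_le_mul_of_nonneg_left hv.le htp.le
  choose v w hv hw hv1 hEv hEw using key
  have hlim1 : Tendsto (fun k : ℕ => c + 1 / ((k : ℝ) + 1)) atTop (𝓝 c) := by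
    simpa using tendsto_one_div_add_atTop_nhds_zero_nat.const_add c
  have hlim2 : Tendsto (fun k : ℕ => c - 1 / ((k : ℝ) + 1)) atTop (𝓝 c) := by
    simpa using tendsto_one_div_add_atTop_nhds_zero_nat.const_sub c
  obtain ⟨v', hv', hv1', hEv', ψ, hψ, hvlim⟩ := H.exists_limit_of_energy_le hv hv1 hEv hlim1
  obtain ⟨Q, hQ0, hQ⟩ := H.exists_pair_bound hc0.le
  obtain ⟨w', hw', χ, hχ, hwlim⟩ := H.exists_subseq (fun k => (hw (ψ k)).mem) (M := Q) fun k => by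
    have := (hw (ψ k)).energy_le H hQ (hv _)
    rwa [hv1, mul_one] at this
  have hvlim' := hvlim.comp hχ.tendsto_atTop
  have hs : Solves p θ Ω c v' w' := Solves.of_tendsto H (fun k => hw (ψ (χ k))) (fun k => hv _) hwlim
    hvlim' tendsto_const_nhds
  refine hs.isEigen_of_energy_le H hc0 hv' hv1' hEv' ?_
  have h1 := (hlim2.comp (hψ.comp hχ).tendsto_atTop).mul
    (tendsto_mass H.isBounded hp (fun k => (hw (ψ (χ k))).mem) hwlim)
  have h2 := (tendsto_massPair H.isBounded hp (fun k => hv (ψ (χ k))) hvlim' hwlim).const_mul c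
  rw [hs.energy_eq hp]
  refine le_of_tendsto_of_tendsto' h1 h2 fun k => ?_
  have := hEw (ψ (χ k))
  rw [(hw _).energy_eq hp] at this
  exact this

lemma energy_segment_le (hp : 2 ≤ p) (hu : u ∈ energySpace p θ Ω) (hv : v ∈ energySpace p θ Ω)
    {t : ℝ} (ht0 : 0 ≤ t) (ht1 : t ≤ 1) :
    energy p θ ((1 - t) • u + t • v) ≤ (1 - t) * energy p θ u + t * energy p θ v := by
  set z := (1 - t) • u + t • v with hz
  have hm : z ∈ energySpace p θ Ω := add_mem (Submodule.smul_mem _ _ hu) (Submodule.smul_mem _ _ hv)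
  have h1 := energy_tangent hp hm hu
  have h2 := energy_tangent hp hm hv
  have e1 : u - z = t • (u - v) := by rw [hz]; module
  have e2 : v - z = (-(1 - t)) • (u - v) := by rw [hz]; module
  have e : ∀ s : ℝ, energyPair p θ z (s • (u - v)) = s * energyPair p θ z (u - v) := fun s => by
    rw [energyPair, incr_coe_smul, pair_smul_right]; rfl
  rw [e1, e] at h1
  rw [e2, e] at h2
  have h3 := mul_le_mul_of_nonneg_left h1 (sub_nonneg.2 ht1)
  have h4 := mul_le_mul_of_nonneg_left h2 ht0
  linarith

/-- The segment from u to -v is a linking set: u and v are never nonzero at the same point, so no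
cancellation occurs and the mass along it stays away from 0. -/
lemma Admissible.linkingLevels_nonempty (H : Admissible n p θ Ω) (hu : u ∈ energySpace p θ Ω)
    (hv : v ∈ energySpace p θ Ω) (hu0 : 0 ≤ u) (hv0 : 0 ≤ v) (hune : u ≠ 0) (hvne : v ≠ 0)
    (huv : ∀ x, u x = 0 ∨ v x = 0) : (linkingLevels p θ Ω).Nonempty := by
  have hp := H.two_le
  have hmu := mass_pos H.isBounded hp hu hune
  have hmv := mass_pos H.isBounded hp hv hvne
  -- One of the weights 1 - t and t is always at least 1/2.
  set m := (1 / 2 : ℝ) ^ p * min (mass p u) (mass p v) with hm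
  have hm0 : 0 < m := mul_pos (by positivity) (lt_min hmu hmv)
  set γ : ℝ → energySpace p θ Ω := fun t => ⟨(1 - t) • u + t • (-v),
    add_mem (Submodule.smul_mem _ _ hu) (Submodule.smul_mem _ _ (neg_mem hv))⟩ with hγ
  have hγc : Continuous γ := Continuous.subtype_mk
    (((continuous_const.sub continuous_id).smul continuous_const).add (continuous_id.smul continuous_const)) _
  have hγv : ∀ t x, (γ t).1 x = (1 - t) * u x - t * v x := fun t x => by
    simp [hγ]; ring
  have hmass : ∀ t ∈ Set.Icc (0 : ℝ) 1, m ≤ mass p (γ t).1 := by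
    intro t ht
    have hL := memLp_of_mem H.isBounded (γ t).2
    have b1 : (1 - t) ^ p * mass p u ≤ mass p (γ t).1 := by
      rw [← mass_smul (sub_nonneg.2 ht.2)]
      refine powInt_mono hp hL fun x => ?_
      rw [hγv]
      rcases huv x with h | h
      · simp [h]; positivity
      · simp [h]
    have b2 : t ^ p * mass p v ≤ mass p (γ t).1 := by
      rw [← mass_smul ht.1]
      refine powInt_mono hp hL fun x => ?_
      rw [hγv]
      rcases huv x with h | h
      · simp [h]
      · simp [h]; positivity
    rcases le_total t (1 / 2) with h | h
    · refine le_trans ?_ b1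
      exact mul_le_mul (Real.rpow_le_rpow (by norm_num) (by linarith) (by linarith)) (min_le_left _ _)
        (le_min hmu.le hmv.le) (Real.rpow_nonneg (by linarith) _)
    · refine le_trans ?_ b2
      exact mul_le_mul (Real.rpow_le_rpow (by norm_num) h (by linarith)) (min_le_right _ _)
        (le_min hmu.le hmv.le) (Real.rpow_nonneg (by linarith) _)
  have hEn : ∀ t ∈ Set.Icc (0 : ℝ) 1, energy p θ (γ t).1 ≤ energy p θ u + energy p θ v := by
    intro t ht
    have := energy_segment_le hp hu (neg_mem hv) ht.1 ht.2
    rw [energy_neg] at this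
    have h1 := energy_nonneg (p := p) (θ := θ) (u := u)
    have h2 := energy_nonneg (p := p) (θ := θ) (u := v)
    refine this.trans ?_
    nlinarith [ht.1, ht.2]
  refine ⟨(energy p θ u + energy p θ v) / m, γ '' Set.Icc 0 1,
    isPreconnected_Icc.image γ hγc.continuousOn, ?_, ⟨γ 0, ⟨0, by simp, rfl⟩, ?_⟩, γ 1, ⟨1, by simp, rfl⟩, ?_⟩
  · rintro _ ⟨t, ht, rfl⟩
    have h1 := hmass t ht
    refine ⟨fun h => ?_, (hEn t ht).trans ?_⟩
    · rw [h] at h1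
      have : mass p (0 : Space n →ᵇ ℝ) = 0 := by
        simp [mass, powInt, Real.zero_rpow (show p ≠ 0 by linarith)]
      rw [ZeroMemClass.coe_zero, this] at h1
      linarith
    · rw [div_mul_eq_mul_div, le_div_iff₀ hm0]
      have h2 := energy_nonneg (p := p) (θ := θ) (u := u)
      have h3 := energy_nonneg (p := p) (θ := θ) (u := v)
      gcongr
  · intro x
    change 0 ≤ (γ 0).1 x
    rw [hγv]
    simpa using hu0 x
  · intro x
    change (γ 1).1 x ≤ 0
    rw [hγv]
    simpa using hv0 x

end Minimax

/-! ### Density of test functions in the energy space -/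

section Density

variable {n : ℕ} {p θ : ℝ} {Ω : Set (Space n)} {u v w : Space n →ᵇ ℝ}

lemma energy_add_le (hp : 2 ≤ p) (hu : u ∈ energySpace p θ Ω) (hv : v ∈ energySpace p θ Ω) :
    energy p θ (u + v) ≤ 2 ^ p * (energy p θ u + energy p θ v) := by
  have h1 := powInt_clarkson hp hu.2 hv.2
  have h2 := energy_nonneg (p := p) (θ := θ) (u := u)
  have h3 := energy_nonneg (p := p) (θ := θ) (u := v)
  rw [powInt_smul (by norm_num), ← incr_coe_add] at h1
  change (1 / 2 : ℝ) ^ p * energy p θ (u + v) + _ ≤ (energy p θ u + energy p θ v) / 2 at h1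
  have h4 : 0 ≤ powInt p (kernelMeasure n θ) ((1 / 2 : ℝ) • (incr u - incr v)) := powInt_nonneg
  have h5 : (1 / 2 : ℝ) ^ p * energy p θ (u + v) ≤ energy p θ u + energy p θ v := by linarith
  have h6 : (2 : ℝ) ^ p * (1 / 2 : ℝ) ^ p = 1 := by
    rw [← Real.mul_rpow (by norm_num) (by norm_num)]; norm_num
  calc energy p θ (u + v) = 2 ^ p * ((1 / 2 : ℝ) ^ p * energy p θ (u + v)) := by
        rw [← mul_assoc, h6, one_mul]
    _ ≤ _ := by gcongr

/-- Young's inequality with g rescaled by t stands in for Hölder: for fixed t the bound tends to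
M/t, and t is arbitrary. -/
lemma tendsto_energyPair_zero (hp : 2 ≤ p) {u g : ℕ → Space n →ᵇ ℝ} (hu : ∀ k, u k ∈ energySpace p θ Ω)
    (hg : ∀ k, g k ∈ energySpace p θ Ω) {M : ℝ} (hM : ∀ k, energy p θ (u k) ≤ M)
    (hlim : Tendsto (fun k => energy p θ (g k)) atTop (𝓝 0)) :
    Tendsto (fun k => energyPair p θ (u k) (g k)) atTop (𝓝 0) := by
  have hM0 : 0 ≤ M := energy_nonneg.trans (hM 0)
  have key : ∀ t : ℝ, 0 < t → ∀ k, |energyPair p θ (u k) (g k)| ≤ t⁻¹ * (t ^ p * energy p θ (g k) + M) := by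
    intro t ht k
    have h1 := abs_pair_le hp (hu k).2 ((hg k).2.const_smul t) one_pos le_rfl
    rw [pair_smul_right, powInt_smul ht.le, abs_mul, abs_of_pos ht, inv_one, one_mul, one_mul] at h1
    change t * |energyPair p θ (u k) (g k)| ≤ t ^ p * energy p θ (g k) + energy p θ (u k) at h1
    rw [inv_mul_eq_div, le_div_iff₀ ht]
    linarith [hM k]
  rw [Metric.tendsto_atTop]
  intro ε hε
  set t := 2 * (M + 1) / ε with ht
  have ht0 : 0 < t := by positivity
  have h1 : Tendsto (fun k => t⁻¹ * (t ^ p * energy p θ (g k) + M)) atTop (𝓝 (t⁻¹ * (t ^ p * 0 + M))) :=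
    ((hlim.const_mul _).add_const M).const_mul _
  have h2 : t⁻¹ * (t ^ p * 0 + M) < ε := by
    rw [mul_zero, zero_add, inv_mul_eq_div, div_lt_iff₀ ht0, ht]
    field_simp
    linarith
  obtain ⟨N, hN⟩ := eventually_atTop.1 (h1.eventually_lt_const h2)
  exact ⟨N, fun k hk => by
    rw [Real.dist_eq, sub_zero]
    exact (key t ht0 k).trans_lt (hN k hk)⟩

/-- Functions with compact support in `Ω` are dense in the energy space. -/
lemma exists_compactSupport_energy_sub_le (hp : 2 ≤ p) (hΩ : Bornology.IsBounded Ω)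
    (hu : u ∈ energySpace p θ Ω) {ε : ℝ} (hε : 0 < ε) :
    ∃ w ∈ energySpace p θ Ω, HasCompactSupport w ∧ tsupport w ⊆ Ω ∧ energy p θ (w - u) ≤ ε := by
  set d : ℕ → ℝ := fun k => 1 / ((k : ℝ) + 1) with hd
  have hd0 : ∀ k, 0 < d k := fun k => by positivity
  -- Clipping u at height d k. The clipped part loses its energy as d k → 0, by dominated
  -- convergence, while u minus it is supported in {|u| ≥ d k}, a closed subset of Ω.
  set cl : ℕ → Space n →ᵇ ℝ := fun k =>
    (u ⊓ BoundedContinuousFunction.const _ (d k)) ⊔ BoundedContinuousFunction.const _ (-d k) with hcl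
  have hclv : ∀ k x, cl k x = max (min (u x) (d k)) (-d k) := fun k x => rfl
  have hcon : ∀ k x y, |cl k x - cl k y| ≤ |u x - u y| := fun k x y => by
    rw [hclv, hclv]
    exact (abs_max_sub_max_le_abs _ _ _).trans (by
      simpa using abs_min_sub_min_le_max (u x) (d k) (u y) (d k))
  have hclm : ∀ k, cl k ∈ energySpace p θ Ω := fun k =>
    mem_energySpace_of_contraction hu (fun x hx => by
      rw [hclv, zero_of_mem hu hx, min_eq_left (hd0 k).le]
      exact max_eq_left (by linarith [hd0 k])) (hcon k)
  have hsmall : ∀ k x, |cl k x| ≤ d k := fun k x => by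
    rw [hclv, abs_le]
    exact ⟨le_max_right _ _, max_le (min_le_right _ _) (by linarith [hd0 k])⟩
  have hlim : Tendsto (fun k => energy p θ (cl k)) atTop (𝓝 0) := by
    have h0 : (0 : ℝ) = ∫ _z, 0 ∂(kernelMeasure n θ) := by simp
    rw [h0]
    refine tendsto_integral_of_dominated_convergence (fun z => |incr u z| ^ p) ?_
      (integrable_abs_rpow hp hu.2) ?_ ?_
    · exact fun k => (integrable_abs_rpow hp (hclm k).2).1
    · intro k
      refine ae_of_all _ fun z => ?_
      rw [Real.norm_of_nonneg (by positivity)]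
      exact Real.rpow_le_rpow (abs_nonneg _) (hcon k _ _) (by linarith)
    · refine ae_of_all _ fun z => ?_
      have h1 : Tendsto (fun k => 2 * d k) atTop (𝓝 0) := by
        have := (tendsto_one_div_add_atTop_nhds_zero_nat (𝕜 := ℝ)).const_mul 2
        rwa [mul_zero] at this
      have h2 : Tendsto (fun k => |incr (cl k) z|) atTop (𝓝 0) := by
        refine squeeze_zero (fun _ => abs_nonneg _) (fun k => ?_) h1
        refine (abs_sub _ _).trans ?_
        linarith [hsmall k z.2, hsmall k z.1]
      have := h2.rpow_const (p := p) (Or.inr (by linarith))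
      rwa [Real.zero_rpow (by linarith)] at this
  obtain ⟨k, hk⟩ := (hlim.eventually_lt_const hε).exists
  have hsub : tsupport ⇑(u - cl k) ⊆ {x | d k ≤ |u x|} := by
    refine closure_minimal (fun x hx => ?_) (isClosed_le continuous_const u.continuous.abs)
    by_contra hlt
    have hlt' : |u x| < d k := not_le.1 hlt
    rw [abs_lt] at hlt'
    refine hx ?_
    change u x - cl k x = 0
    rw [hclv, min_eq_left hlt'.2.le, max_eq_left hlt'.1.le, sub_self]
  have hsubΩ : {x | d k ≤ |u x|} ⊆ Ω := fun x hx => by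
    by_contra hxn
    have : d k ≤ |u x| := hx
    rw [zero_of_mem hu hxn, abs_zero] at this
    linarith [hd0 k]
  refine ⟨u - cl k, sub_mem hu (hclm k), ?_, hsub.trans hsubΩ, ?_⟩
  · exact hΩ.isCompact_closure.of_isClosed_subset (isClosed_tsupport _)
      ((hsub.trans hsubΩ).trans subset_closure)
  · rw [sub_sub_cancel_left, energy_neg]; exact hk.le

/-- Averaging over translations does not increase the Gagliardo seminorm. -/
lemma seminormPow_average_le {p θ : ℝ} (hp : 1 ≤ p) (P : Measure (Space n)) [IsProbabilityMeasure P]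
    (w : Space n →ᵇ ℝ) :
    seminormPow p θ Set.univ (fun x => ∫ t, w (x - t) ∂P) ≤ seminormPow p θ Set.univ w := by
  set F : Space n × Space n → ℝ≥0∞ := fun z => ENNReal.ofReal (|w z.2 - w z.1| ^ p / ‖z.2 - z.1‖ ^ θ)
    with hF
  have hFm : Measurable F := measurable_diff_quotient p θ w.continuous.measurable
  have hint : ∀ x, Integrable (fun t => w (x - t)) P := fun x =>
    Integrable.of_bound ((w.continuous.comp (continuous_const.sub continuous_id)).aestronglyMeasurable)
      ‖w‖ (ae_of_all _ fun t => w.norm_coe_le_norm _)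
  have hpt : ∀ x y, ENNReal.ofReal (|(∫ t, w (y - t) ∂P) - ∫ t, w (x - t) ∂P| ^ p / ‖y - x‖ ^ θ) ≤
      ∫⁻ t, F ((x, y) - (t, t)) ∂P := by
    intro x y
    rw [← integral_sub (hint y) (hint x), div_eq_mul_inv, ENNReal.ofReal_mul (by positivity)]
    refine (mul_le_mul_left (ofReal_abs_integral_rpow_le hp ((hint y).sub (hint x)).1) _).trans ?_
    rw [← lintegral_mul_const' _ _ ENNReal.ofReal_ne_top]
    refine lintegral_mono fun t => ?_
    rw [← ENNReal.ofReal_mul (by positivity), ← div_eq_mul_inv]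
    simp only [hF, Prod.mk_sub_mk, sub_sub_sub_cancel_right, Pi.sub_apply]
    exact le_rfl
  have hm : Measurable fun q : (Space n × Space n) × Space n => F (q.1 - (q.2, q.2)) := by
    refine hFm.comp ?_
    fun_prop
  calc seminormPow p θ Set.univ (fun x => ∫ t, w (x - t) ∂P)
      ≤ ∫⁻ x, ∫⁻ y, ∫⁻ t, F ((x, y) - (t, t)) ∂P := by
        rw [seminormPow]
        simp only [Measure.restrict_univ]
        exact lintegral_mono fun x => lintegral_mono fun y => hpt x y
    _ = ∫⁻ z, ∫⁻ t, F (z - (t, t)) ∂P := by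
        rw [Measure.volume_eq_prod, lintegral_prod _ (Measurable.lintegral_prod_right hm).aemeasurable]
    _ = ∫⁻ t, (∫⁻ z, F (z - (t, t))) ∂P := lintegral_lintegral_swap hm.aemeasurable
    _ = ∫⁻ z, F z := by
        have e : ∀ t : Space n, ∫⁻ z, F (z - (t, t)) = ∫⁻ z, F z := fun t => by
          simp only [sub_eq_add_neg]
          rw [Measure.volume_eq_prod]
          exact lintegral_add_right_eq_self F (-(t, t))
        simp_rw [e]
        simp
    _ = _ := by
        rw [Measure.volume_eq_prod, lintegral_prod _ hFm.aemeasurable, seminormPow]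
        simp [hF]

open scoped Convolution in
/-- Smooth functions are dense among the compactly supported functions of the energy space. -/
lemma exists_test_energy_sub_le (hp : 2 ≤ p) (hΩ : IsOpen Ω) (hw : w ∈ energySpace p θ Ω)
    (hwc : HasCompactSupport w) (hwΩ : tsupport w ⊆ Ω) {ε : ℝ} (hε : 0 < ε) :
    ∃ φ ∈ energySpace p θ Ω, IsTest Ω φ ∧ energy p θ (φ - w) ≤ ε := by
  obtain ⟨δ, hδ, hδΩ⟩ := hwc.isCompact.exists_cthickening_subset_open hΩ hwΩ
  have huc : UniformContinuous w := hwc.uniformContinuous_of_continuous w.continuous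
  have step : ∀ k : ℕ, ∃ φ ∈ energySpace p θ Ω, IsTest Ω φ ∧ energy p θ φ ≤ energy p θ w ∧
      ‖φ - w‖ ≤ 1 / ((k : ℝ) + 1) := by
    intro k
    have hk : (0 : ℝ) < 1 / ((k : ℝ) + 1) := by positivity
    obtain ⟨η, hη, hηu⟩ := Metric.uniformContinuous_iff.1 huc _ hk
    set r := min δ η with hr
    have hr0 : 0 < r := lt_min hδ hη
    let b : ContDiffBump (0 : Space n) := ⟨r / 2, r, by positivity, by linarith⟩
    set ρ : Space n → ℝ := b.normed volume with hρ
    have hρ0 : ∀ t, 0 ≤ ρ t := b.nonneg_normed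
    have hρm : Measurable ρ := b.continuous_normed.measurable
    -- Mollification is an average of translates, so it does not increase the energy.
    set P : Measure (Space n) := volume.withDensity fun t => ENNReal.ofReal (ρ t) with hP
    have hPp : IsProbabilityMeasure P := ⟨by
      rw [hP, withDensity_apply _ MeasurableSet.univ, Measure.restrict_univ,
        ← ofReal_integral_eq_lintegral_ofReal b.integrable_normed (ae_of_all _ hρ0),
        b.integral_normed, ENNReal.ofReal_one]⟩
    set f : Space n → ℝ := ρ ⋆[ContinuousLinearMap.lsmul ℝ ℝ, volume] w with hf
    have hfP : ∀ x, f x = ∫ t, w (x - t) ∂P := by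
      intro x
      rw [hP, integral_withDensity_eq_integral_toReal_smul hρm.ennreal_ofReal
        (ae_of_all _ fun _ => ENNReal.ofReal_lt_top)]
      refine integral_congr_ae (ae_of_all _ fun t => ?_)
      simp [ENNReal.toReal_ofReal (hρ0 t)]
    have hsmooth : ContDiff ℝ (⊤ : ℕ∞) f :=
      b.hasCompactSupport_normed.contDiff_convolution_left _ b.contDiff_normed
        w.continuous.locallyIntegrable
    have hsupp : tsupport f ⊆ Metric.cthickening δ (tsupport w) := by
      refine closure_minimal (fun x hx => ?_) Metric.isClosed_cthickening
      obtain ⟨a, ha, c, hc, rfl⟩ := support_convolution_subset _ hx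
      rw [hρ, b.support_normed_eq] at ha
      refine Metric.mem_cthickening_of_dist_le (a + c) c δ _ (subset_tsupport _ hc) ?_
      rw [dist_eq_norm, add_sub_cancel_right]
      rw [mem_ball_zero_iff] at ha
      exact ha.le.trans (min_le_left _ _)
    have hfc : HasCompactSupport f :=
      (hwc.isCompact.cthickening).of_isClosed_subset (isClosed_tsupport _) hsupp
    have hdist : ∀ x, dist (f x) (w x) ≤ 1 / ((k : ℝ) + 1) := fun x =>
      b.dist_normed_convolution_le w.continuous.aestronglyMeasurable fun y hy =>
        (hηu (lt_of_lt_of_le hy (min_le_right _ _))).le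
    let φ : Space n →ᵇ ℝ := BoundedContinuousFunction.ofNormedAddCommGroup f hsmooth.continuous
      (‖w‖ + 1 / ((k : ℝ) + 1)) fun x => by
        have h1 := hdist x
        have h2 := w.norm_coe_le_norm x
        have h3 := norm_sub_norm_le (f x) (w x)
        rw [dist_eq_norm] at h1
        linarith
    have hφf : ⇑φ = f := rfl
    have htest : IsTest Ω φ := ⟨hsmooth, hfc, hsupp.trans hδΩ⟩
    have hle : seminormPow p θ Set.univ φ ≤ seminormPow p θ Set.univ w := by
      have := seminormPow_average_le (θ := θ) (show 1 ≤ p by linarith) P w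
      simp_rw [← hfP] at this
      exact this
    rw [seminormPow_univ_eq hp hw] at hle
    have hmem : φ ∈ energySpace p θ Ω := mem_energySpace_of_lt_top hp
      (fun x hx => image_eq_zero_of_notMem_tsupport fun h => hx (htest.support_subset h))
      (hle.trans_lt ENNReal.ofReal_lt_top)
    rw [seminormPow_univ_eq hp hmem, ENNReal.ofReal_le_ofReal_iff energy_nonneg] at hle
    refine ⟨φ, hmem, htest, hle, ?_⟩
    rw [BoundedContinuousFunction.norm_le hk.le]
    exact hdist
  choose φ hφm hφt hφE hφd using step
  by_contra hcon
  push Not at hcon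
  have hlim : Tendsto φ atTop (𝓝 w) := by
    rw [tendsto_iff_norm_sub_tendsto_zero]
    exact squeeze_zero (fun _ => norm_nonneg _) hφd tendsto_one_div_add_atTop_nhds_zero_nat
  -- If no φ k were ε-close to w, Clarkson would put the energy of the midpoints below that of w by
  -- a fixed amount. The midpoints converge uniformly to w, so this contradicts lower
  -- semicontinuity.
  have hmid : ∀ k, energy p θ ((1 / 2 : ℝ) • (φ k + w)) ≤ energy p θ w - (1 / 2 : ℝ) ^ p * ε := by
    intro k
    have h1 := powInt_clarkson hp (hφm k).2 hw.2
    rw [← incr_coe_add, ← incr_coe_smul, ← incr_coe_sub, ← incr_coe_smul] at h1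
    change energy p θ _ + energy p θ _ ≤ (energy p θ _ + energy p θ _) / 2 at h1
    rw [energy_smul (u := φ k - w) (by norm_num)] at h1
    have h2 := hcon (φ k) (hφm k) (hφt k)
    have h3 : (1 / 2 : ℝ) ^ p * ε ≤ (1 / 2 : ℝ) ^ p * energy p θ (φ k - w) := by gcongr
    linarith [hφE k]
  have hlim' : Tendsto (fun k => (1 / 2 : ℝ) • (φ k + w)) atTop (𝓝 w) := by
    have h1 := (hlim.add_const w).const_smul (1 / 2 : ℝ)
    have h2 : (1 / 2 : ℝ) • (w + w) = w := by module
    rwa [h2] at h1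
  have := (energy_fatou hp (fun k => Submodule.smul_mem _ _ (add_mem (hφm k) hw)) hlim' hmid
    tendsto_const_nhds).2
  have : 0 < (1 / 2 : ℝ) ^ p * ε := by positivity
  linarith

/-- Test functions are dense in the energy space. -/
lemma Admissible.exists_test_energy_sub_le (H : Admissible n p θ Ω) (hu : u ∈ energySpace p θ Ω) {ε : ℝ}
    (hε : 0 < ε) : ∃ φ ∈ energySpace p θ Ω, IsTest Ω φ ∧ energy p θ (φ - u) ≤ ε := by
  have hp := H.two_le
  set η := ε / (2 * 2 ^ p) with hη
  have hη0 : 0 < η := by positivity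
  obtain ⟨w, hw, hwc, hwΩ, hwE⟩ := exists_compactSupport_energy_sub_le hp H.isBounded hu hη0
  obtain ⟨φ, hφ, hφt, hφE⟩ := FracEigen.exists_test_energy_sub_le hp H.isOpen hw hwc hwΩ hη0
  refine ⟨φ, hφ, hφt, ?_⟩
  have h1 := energy_add_le hp (sub_mem hφ hw) (sub_mem hw hu)
  rw [sub_add_sub_cancel] at h1
  calc _ ≤ _ := h1
    _ ≤ 2 ^ p * (η + η) := by gcongr
    _ = ε := by rw [hη]; field_simp; ring

lemma Admissible.exists_test_seq (H : Admissible n p θ Ω) (hu : u ∈ energySpace p θ Ω) :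
    ∃ φ : ℕ → Space n →ᵇ ℝ, (∀ k, φ k ∈ energySpace p θ Ω) ∧ (∀ k, IsTest Ω (φ k)) ∧
      Tendsto (fun k => energy p θ (φ k - u)) atTop (𝓝 0) ∧ Tendsto φ atTop (𝓝 u) := by
  have hp := H.two_le
  choose φ hφ hφt hφE using fun k : ℕ => H.exists_test_energy_sub_le hu
    (ε := 1 / ((k : ℝ) + 1)) (by positivity)
  have hE : Tendsto (fun k => energy p θ (φ k - u)) atTop (𝓝 0) :=
    squeeze_zero (fun _ => energy_nonneg) hφE tendsto_one_div_add_atTop_nhds_zero_nat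
  refine ⟨φ, hφ, hφt, hE, ?_⟩
  obtain ⟨C, hC, h⟩ := H.sup_bound
  rw [tendsto_iff_norm_sub_tendsto_zero]
  have h1 : Tendsto (fun k => (C * energy p θ (φ k - u)) ^ (1 / p)) atTop (𝓝 ((C * 0) ^ (1 / p))) :=
    (hE.const_mul C).rpow_const (Or.inr (by positivity))
  rw [mul_zero, Real.zero_rpow (by positivity)] at h1
  refine squeeze_zero (fun _ => norm_nonneg _) (fun k => ?_) h1
  have := Real.rpow_le_rpow (by positivity) (h _ (sub_mem (hφ k) hu)) (by positivity : 0 ≤ 1 / p)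
  rwa [← Real.rpow_mul (norm_nonneg _), mul_one_div_cancel (by linarith), Real.rpow_one] at this

end Density

/-! ### Identification of `W₀^{s,p}(Ω)` with the energy space -/

section Sobolev

variable {n : ℕ} {p θ : ℝ} {Ω : Set (Space n)} {v w : Space n →ᵇ ℝ}

lemma IsTest.eq_zero_of_notMem {φ : Space n → ℝ} (hφ : IsTest Ω φ) {x : Space n} (hx : x ∉ Ω) : φ x = 0 :=
  image_eq_zero_of_notMem_tsupport fun h => hx (hφ.support_subset h)

lemma Admissible.exists_energySpace_eq_test (H : Admissible n p θ Ω) {φ : Space n → ℝ} (hφ : IsTest Ω φ) :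
    ∃ f ∈ energySpace p θ Ω, ⇑f = φ := by
  have hp := H.two_le
  obtain ⟨M, hM⟩ := hφ.compact_support.exists_bound_of_continuous hφ.smooth.continuous
  refine ⟨BoundedContinuousFunction.ofNormedAddCommGroup φ hφ.smooth.continuous M hM,
    mem_energySpace_of_lt_top hp (fun x hx => hφ.eq_zero_of_notMem hx) ?_, rfl⟩
  exact hφ.seminormPow_lt_top H.one_le (by linarith [H.lt, (Nat.cast_nonneg n : (0 : ℝ) ≤ n)]) H.lt'
    (by linarith)

/-- Measurability of `g` suffices, since the lower integral is additive as soon as one summand is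
measurable. -/
lemma seminormPow_le_add (hp : 0 ≤ p) {D : Set (Space n)} {f g : Space n → ℝ}
    (hg : AEStronglyMeasurable g volume) :
    seminormPow p θ D f ≤
      ENNReal.ofReal (2 ^ p) * (seminormPow p θ D g + seminormPow p θ D fun x => g x - f x) := by
  set G : Space n → Space n → ℝ≥0∞ := fun x y => ENNReal.ofReal (|g y - g x| ^ p / ‖y - x‖ ^ θ) with hG
  set K : Space n → Space n → ℝ≥0∞ := fun x y =>
    ENNReal.ofReal (|(g y - f y) - (g x - f x)| ^ p / ‖y - x‖ ^ θ) with hK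
  have hgm : AEMeasurable g (volume.restrict D) := hg.aemeasurable.restrict
  have hG1 : ∀ x, AEMeasurable (G x) (volume.restrict D) := fun x => by
    simp only [hG]; fun_prop
  have hG2 : AEMeasurable (fun x => ∫⁻ y in D, G x y) (volume.restrict D) := by
    have h1 : AEMeasurable (fun z : Space n × Space n => g z.1)
        ((volume.restrict D).prod (volume.restrict D)) := hgm.comp_fst
    have h2 : AEMeasurable (fun z : Space n × Space n => g z.2)
        ((volume.restrict D).prod (volume.restrict D)) := hgm.comp_snd
    have h3 : AEMeasurable (fun z : Space n × Space n => G z.1 z.2)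
        ((volume.restrict D).prod (volume.restrict D)) := by
      simp only [hG]; fun_prop
    exact h3.lintegral_prod_right'
  have hpt : ∀ x y, ENNReal.ofReal (|f y - f x| ^ p / ‖y - x‖ ^ θ) ≤
      ENNReal.ofReal (2 ^ p) * (G x y + K x y) := by
    intro x y
    rw [hG, hK, ← ENNReal.ofReal_add (by positivity) (by positivity),
      ← ENNReal.ofReal_mul (by positivity), ← add_div, ← mul_div_assoc]
    refine ENNReal.ofReal_le_ofReal (div_le_div_of_nonneg_right ?_ (by positivity))
    set a := |g y - g x|
    set b := |(g y - f y) - (g x - f x)|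
    have h1 : |f y - f x| ≤ 2 * max a b := by
      have : |f y - f x| ≤ a + b := by
        rw [show f y - f x = (g y - g x) - ((g y - f y) - (g x - f x)) by ring]
        exact abs_sub _ _
      linarith [le_max_left a b, le_max_right a b]
    have h2 : (max a b) ^ p ≤ a ^ p + b ^ p := by
      have ha : 0 ≤ a ^ p := by positivity
      have hb : 0 ≤ b ^ p := by positivity
      rcases max_choice a b with h | h <;> rw [h] <;> linarith
    calc |f y - f x| ^ p ≤ (2 * max a b) ^ p := Real.rpow_le_rpow (abs_nonneg _) h1 hp
      _ = 2 ^ p * (max a b) ^ p := Real.mul_rpow (by norm_num) (by positivity)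
      _ ≤ _ := by gcongr
  calc seminormPow p θ D f ≤ ∫⁻ x in D, ∫⁻ y in D, ENNReal.ofReal (2 ^ p) * (G x y + K x y) :=
        lintegral_mono fun x => lintegral_mono fun y => hpt x y
    _ = ∫⁻ x in D, ENNReal.ofReal (2 ^ p) * ((∫⁻ y in D, G x y) + ∫⁻ y in D, K x y) := by
        refine lintegral_congr fun x => ?_
        rw [lintegral_const_mul' _ _ ENNReal.ofReal_ne_top, lintegral_add_left' (hG1 x)]
    _ = _ := by
        rw [lintegral_const_mul' _ _ ENNReal.ofReal_ne_top, lintegral_add_left' hG2]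
        rfl

/-- Every element of `W₀^{s,p}(Ω)` has a representative in the energy space. -/
lemma Admissible.exists_energySpace_ae_eq (H : Admissible n p θ Ω) {u : Space n → ℝ}
    (hum : AEStronglyMeasurable u volume) (h0 : ∀ x ∉ Ω, u x = 0) (hfin : seminormPow p θ Ω u < ⊤)
    (hcl : ∀ ε : ℝ≥0∞, 0 < ε → ∃ φ : Space n → ℝ, IsTest Ω φ ∧
      seminormPow p θ Ω (fun x => u x - φ x) + lpPow p Ω (fun x => u x - φ x) < ε) :
    ∃ v ∈ energySpace p θ Ω, u =ᵐ[volume] v := by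
  have hp := H.two_le
  choose φ hφt hφ using fun k : ℕ => hcl (((k : ℝ≥0∞) + 1)⁻¹) (by simp)
  choose f hf hfφ using fun k => H.exists_energySpace_eq_test (hφt k)
  obtain ⟨C, hC, hCb⟩ := seminormPow_univ_le (n := n) (p := p) (θ := θ) (by linarith) H.lt H.one_le
  -- The approximants are bounded only in the norm on Ω; the Hardy constant C turns this into an
  -- energy bound on ℝⁿ. Compactness yields a uniform limit v, and L^p convergence on Ω identifies
  -- it with u.
  set B : ℝ≥0∞ := C * (ENNReal.ofReal (2 ^ p) * (seminormPow p θ Ω u + 1)) with hB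
  have hBfin : B < ⊤ := ENNReal.mul_lt_top hC
    (ENNReal.mul_lt_top ENNReal.ofReal_lt_top (ENNReal.add_lt_top.2 ⟨hfin, ENNReal.one_lt_top⟩))
  have hle1 : ∀ k, seminormPow p θ Ω (fun x => u x - φ k x) ≤ 1 := fun k =>
    le_self_add.trans ((hφ k).le.trans (ENNReal.inv_le_one.2 le_add_self))
  have hbound : ∀ k, energy p θ (f k) ≤ B.toReal := by
    intro k
    refine (ENNReal.ofReal_le_iff_le_toReal hBfin.ne).1 ?_
    rw [← seminormPow_univ_eq hp (hf k), hfφ]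
    refine (hCb Ω H.isOpen (compl_nonempty_of_isBounded H.one_le H.isBounded) _
      (hφt k).smooth.continuous fun x hx => (hφt k).eq_zero_of_notMem hx).trans ?_
    rw [hB]
    gcongr
    refine (seminormPow_le_add (by linarith) hum).trans ?_
    gcongr
    exact hle1 k
  obtain ⟨v, hv, ψ, hψ, hlim⟩ := H.exists_subseq hf hbound
  refine ⟨v, hv, ?_⟩
  have hmeas : ∀ g : Space n → ℝ, Continuous g →
      AEMeasurable (fun x => ENNReal.ofReal (|u x - g x| ^ p)) (volume.restrict Ω) := fun g hg => by
    have h1 : AEMeasurable u (volume.restrict Ω) := hum.aemeasurable.restrict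
    have h2 : AEMeasurable g (volume.restrict Ω) := hg.aemeasurable
    fun_prop
  have hzero : ∫⁻ x in Ω, ENNReal.ofReal (|u x - v x| ^ p) = 0 := by
    have e : ∀ x, ENNReal.ofReal (|u x - v x| ^ p) =
        liminf (fun k => ENNReal.ofReal (|u x - φ (ψ k) x| ^ p)) atTop := by
      intro x
      have h1 : Tendsto (fun k => φ (ψ k) x) atTop (𝓝 (v x)) := by
        have := tendsto_apply hlim x
        simpa only [Function.comp_apply, hfφ] using this
      exact ((ENNReal.tendsto_ofReal (((h1.const_sub (u x)).abs).rpow_const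
        (Or.inr (by linarith)))).liminf_eq).symm
    have hl : Tendsto (fun k => lpPow p Ω (fun x => u x - φ (ψ k) x)) atTop (𝓝 0) := by
      have h1 : Tendsto (fun k : ℕ => ((k : ℝ≥0∞) + 1)⁻¹) atTop (𝓝 0) := by
        have := (tendsto_add_atTop_iff_nat 1).2 ENNReal.tendsto_inv_nat_nhds_zero
        simpa using this
      exact tendsto_of_tendsto_of_tendsto_of_le_of_le tendsto_const_nhds (h1.comp hψ.tendsto_atTop)
        (fun _ => zero_le) fun k => le_add_self.trans (hφ (ψ k)).le
    simp_rw [e]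
    refine le_antisymm ?_ zero_le
    refine (lintegral_liminf_le' fun k => hmeas _ (hφt (ψ k)).smooth.continuous).trans ?_
    exact hl.liminf_eq.le
  rw [lintegral_eq_zero_iff' (hmeas v v.continuous), EventuallyEq,
    ae_restrict_iff' H.isOpen.measurableSet] at hzero
  filter_upwards [hzero] with x hx
  by_cases hxΩ : x ∈ Ω
  · have h1 := hx hxΩ
    simp only [Pi.zero_apply, ENNReal.ofReal_eq_zero] at h1
    have h2 : |u x - v x| ^ p = 0 := le_antisymm h1 (by positivity)
    rw [Real.rpow_eq_zero (abs_nonneg _) (by linarith), abs_eq_zero, sub_eq_zero] at h2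
    exact h2
  · rw [h0 x hxΩ, zero_of_mem hv hxΩ]

lemma sobolevNorm_eq {α : ℝ} (hp : 2 ≤ p) (u : Space n → ℝ) :
    sobolevNorm (α - n / p) p Ω u = (seminormPow p (α * p) Ω u + lpPow p Ω u) ^ (1 / p) := by
  have : (α - n / p) * p + n = α * p := by
    have : p ≠ 0 := by linarith
    field_simp
    ring
  rw [sobolevNorm, this]

lemma Admissible.memSobolevZero_ae_eq {α : ℝ} (H : Admissible n p (α * p) Ω) {u : Space n → ℝ}
    (hu : MemSobolevZero (α - n / p) p Ω u) : ∃ v ∈ energySpace p (α * p) Ω, u =ᵐ[volume] v := by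
  have hp := H.two_le
  have hp' : 0 < 1 / p := by positivity
  refine H.exists_energySpace_ae_eq hu.aestronglyMeasurable hu.zero_outside ?_ fun ε hε => ?_
  · have := hu.finite_norm
    rw [sobolevNorm_eq hp, ENNReal.rpow_lt_top_iff_of_pos hp'] at this
    exact le_self_add.trans_lt this
  · obtain ⟨φ, hφ, h⟩ := hu.mem_closure (ε ^ (1 / p)) (ENNReal.rpow_pos_of_nonneg hε hp'.le)
    rw [sobolevNorm_eq hp, ENNReal.rpow_lt_rpow_iff hp'] at h
    exact ⟨φ, hφ, h⟩

lemma Admissible.memSobolevZero {α : ℝ} (H : Admissible n p (α * p) Ω)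
    (hv : v ∈ energySpace p (α * p) Ω) : MemSobolevZero (α - n / p) p Ω v := by
  have hp := H.two_le
  have hp' : 0 < 1 / p := by positivity
  obtain ⟨C, hC, hCm⟩ := H.exists_mass_le
  have key : ∀ w ∈ energySpace p (α * p) Ω, sobolevNorm (α - n / p) p Ω w ≤
      ENNReal.ofReal ((1 + C) * energy p (α * p) w) ^ (1 / p) := by
    intro w hw
    rw [sobolevNorm_eq hp]
    refine ENNReal.rpow_le_rpow ?_ hp'.le
    rw [add_mul, one_mul, ENNReal.ofReal_add energy_nonneg (mul_nonneg hC.le energy_nonneg)]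
    refine add_le_add ?_ ?_
    · rw [← seminormPow_univ_eq hp hw]
      exact seminormPow_mono (Set.subset_univ _) _
    · refine (lintegral_mono_set (Set.subset_univ _)).trans ?_
      exact (lpPow_univ_eq H.isBounded hp hw).le.trans (ENNReal.ofReal_le_ofReal (hCm w hw))
  refine ⟨v.continuous.aestronglyMeasurable, fun x hx => zero_of_mem hv hx, ?_, fun ε hε => ?_⟩
  · exact (key v hv).trans_lt (ENNReal.rpow_lt_top_of_nonneg hp'.le ENNReal.ofReal_ne_top)
  · obtain ⟨φ, hφ, hφt, hE, -⟩ := H.exists_test_seq hv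
    have h1 : Tendsto (fun k => ENNReal.ofReal ((1 + C) * energy p (α * p) (φ k - v)) ^ (1 / p)) atTop
        (𝓝 (ENNReal.ofReal ((1 + C) * 0) ^ (1 / p))) :=
      (ENNReal.continuous_rpow_const.tendsto _).comp (ENNReal.tendsto_ofReal (hE.const_mul _))
    rw [mul_zero, ENNReal.ofReal_zero, ENNReal.zero_rpow_of_pos hp'] at h1
    obtain ⟨k, hk⟩ := (h1.eventually_lt_const hε).exists
    refine ⟨φ k, hφt k, lt_of_le_of_lt ?_ hk⟩
    have := key (v - φ k) (sub_mem hv (hφ k))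
    rwa [← energy_neg, neg_sub] at this

end Sobolev

/-! ### The weak equation -/

section Eigenvalues

variable {n : ℕ} {p α lam : ℝ} {Ω : Set (Space n)} {v w : Space n →ᵇ ℝ}

lemma integral_eq_energyPair {u : Space n → ℝ} (huv : u =ᵐ[volume] v) (w : Space n →ᵇ ℝ) :
    ∫ z : Space n × Space n, |u z.2 - u z.1| ^ (p - 2) * (u z.2 - u z.1) * (w z.2 - w z.1)
      / ‖z.2 - z.1‖ ^ (α * p) = energyPair p (α * p) v w := by
  rw [energyPair, pair, integral_kernelMeasure]
  refine integral_congr_ae ?_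
  have h1 : ∀ᵐ z : Space n × Space n, u z.1 = v z.1 := Measure.quasiMeasurePreserving_fst.ae huv
  have h2 : ∀ᵐ z : Space n × Space n, u z.2 = v z.2 := Measure.quasiMeasurePreserving_snd.ae huv
  filter_upwards [h1, h2] with z hz1 hz2
  rw [hz1, hz2]
  rfl

lemma integral_eq_massPair {u : Space n → ℝ} (huv : u =ᵐ[volume] v) (w : Space n →ᵇ ℝ) :
    ∫ x : Space n, |u x| ^ (p - 2) * u x * w x = massPair p v w := by
  refine integral_congr_ae ?_
  filter_upwards [huv] with x hx
  rw [hx]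
  rfl

/-- Both sides of the equation are continuous in the test function for energy convergence, which
also implies uniform convergence; density then extends the equation to the energy space. -/
lemma Admissible.weakEquation_iff (H : Admissible n p (α * p) Ω) {u : Space n → ℝ}
    (hv : v ∈ energySpace p (α * p) Ω) (huv : u =ᵐ[volume] v) :
    WeakEquation α p lam Ω u ↔ Solves p (α * p) Ω lam v v := by
  have hp := H.two_le
  constructor
  · refine fun h => ⟨hv, fun w hw => ?_⟩
    obtain ⟨φ, hφ, hφt, hE, hlim⟩ := H.exists_test_seq hw
    have h1 : Tendsto (fun k => energyPair p (α * p) v (φ k - w)) atTop (𝓝 0) :=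
      tendsto_energyPair_zero hp (fun _ => hv) (fun k => sub_mem (hφ k) hw) (fun _ => le_rfl) hE
    have h2 : Tendsto (fun k => lam * massPair p v (φ k)) atTop (𝓝 (lam * massPair p v w)) :=
      (tendsto_massPair H.isBounded hp (fun _ => hv) tendsto_const_nhds hlim).const_mul lam
    have h3 : ∀ k, energyPair p (α * p) v (φ k - w) = lam * massPair p v (φ k) - energyPair p (α * p) v w := by
      intro k
      rw [energyPair_sub_right hp hv (hφ k) hw, ← integral_eq_energyPair huv, ← integral_eq_massPair huv,
        h _ (hφt k)]
    simp_rw [h3] at h1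
    have := tendsto_nhds_unique h1 (h2.sub_const _)
    linarith
  · intro h φ hφ
    obtain ⟨f, hf, rfl⟩ := H.exists_energySpace_eq_test hφ
    rw [integral_eq_energyPair huv, integral_eq_massPair huv, h.eq f hf]

lemma ae_eq_zero_iff : v =ᵐ[volume] (0 : Space n → ℝ) ↔ v = 0 := by
  rw [v.continuous.ae_eq_iff_eq volume continuous_zero]
  exact ⟨fun h => DFunLike.coe_injective h, fun h => by rw [h]; rfl⟩

lemma Admissible.isEigenvalue_iff (H : Admissible n p (α * p) Ω) :
    IsEigenvalue α p Ω lam ↔ IsEigen p (α * p) Ω lam := by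
  constructor
  · rintro ⟨u, hu, hne, hw⟩
    obtain ⟨v, hv, huv⟩ := H.memSobolevZero_ae_eq hu
    refine ⟨v, fun h => hne (huv.trans (ae_eq_zero_iff.2 h)), (H.weakEquation_iff hv huv).1 hw⟩
  · rintro ⟨v, hne, hv⟩
    exact ⟨v, H.memSobolevZero hv.mem, fun h => hne (ae_eq_zero_iff.1 h),
      (H.weakEquation_iff hv.mem EventuallyEq.rfl).2 hv⟩

end Eigenvalues

/-! ### The first eigenvalue -/

section First

variable {n : ℕ} {p α θ : ℝ} {Ω : Set (Space n)}

/-- There are two nonnegative test functions with disjoint supports. -/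
lemma exists_disjoint_tests (hn : 1 ≤ n) (hΩ : IsOpen Ω) (hne : Ω.Nonempty) :
    ∃ φ ψ : Space n → ℝ, IsTest Ω φ ∧ IsTest Ω ψ ∧ φ ≠ 0 ∧ ψ ≠ 0 ∧ (∀ x, 0 ≤ φ x) ∧ (∀ x, 0 ≤ ψ x) ∧
      ∀ x, φ x = 0 ∨ ψ x = 0 := by
  obtain ⟨a, ha⟩ := hne
  obtain ⟨r, hr, hball⟩ := Metric.isOpen_iff.1 hΩ a ha
  set b : Space n := a + EuclideanSpace.single (⟨0, hn⟩ : Fin n) (r / 2) with hb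
  have hab : dist b a = r / 2 := by
    rw [hb, dist_eq_norm, add_sub_cancel_left, PiLp.norm_single, Real.norm_of_nonneg (by positivity)]
  have key : ∀ c : Space n, dist c a ≤ r / 2 → ∀ f : ContDiffBump c, f.rOut = r / 8 →
      IsTest Ω f ∧ (f : Space n → ℝ) ≠ 0 := by
    intro c hc f hf
    refine ⟨⟨f.contDiff, f.hasCompactSupport, ?_⟩, fun h => ?_⟩
    · rw [f.tsupport_eq, hf]
      refine fun x hx => hball ?_
      rw [Metric.mem_closedBall] at hx
      rw [Metric.mem_ball]
      linarith [dist_triangle x c a]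
    · have h1 := f.one_of_mem_closedBall (Metric.mem_closedBall_self f.rIn_pos.le)
      rw [h] at h1
      simp at h1
  let f : ContDiffBump a := ⟨r / 16, r / 8, by positivity, by linarith⟩
  let g : ContDiffBump b := ⟨r / 16, r / 8, by positivity, by linarith⟩
  obtain ⟨hf, hf0⟩ := key a (by rw [dist_self]; positivity) f rfl
  obtain ⟨hg, hg0⟩ := key b hab.le g rfl
  refine ⟨f, g, hf, hg, hf0, hg0, fun _ => f.nonneg, fun _ => g.nonneg, fun x => ?_⟩
  rcases le_or_gt (r / 8) (dist x a) with h | h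
  · exact Or.inl (f.zero_of_le_dist h)
  · refine Or.inr (g.zero_of_le_dist (show r / 8 ≤ dist x b from ?_))
    linarith [dist_triangle_left b a x]

lemma Admissible.rayleigh_eq (H : Admissible n p (α * p) Ω) {u : Space n →ᵇ ℝ}
    (hu : u ∈ energySpace p (α * p) Ω) (h0 : u ≠ 0) :
    rayleigh α p u = ENNReal.ofReal (energy p (α * p) u / mass p u) := by
  rw [rayleigh, seminormPow_univ_eq H.two_le hu, lpPow_univ_eq H.isBounded H.two_le hu,
    ENNReal.ofReal_div_of_pos (mass_pos H.isBounded H.two_le hu h0)]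

/-- An inequality between mass and energy extends from test functions to the energy space. -/
lemma Admissible.mul_mass_le_of_test (H : Admissible n p θ Ω) {l : ℝ}
    (h : ∀ φ ∈ energySpace p θ Ω, IsTest Ω φ → l * mass p φ ≤ energy p θ φ) :
    ∀ u ∈ energySpace p θ Ω, l * mass p u ≤ energy p θ u := by
  intro u hu
  have hp := H.two_le
  obtain ⟨φ, hφ, hφt, hE, hlim⟩ := H.exists_test_seq hu
  obtain ⟨M, hM⟩ := hE.bddAbove_range
  have hbound : ∀ k, energy p θ (φ k) ≤ 2 ^ p * (M + energy p θ u) := fun k => by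
    have h1 := energy_add_le hp (sub_mem (hφ k) hu) hu
    rw [sub_add_cancel] at h1
    refine h1.trans ?_
    have := hM ⟨k, rfl⟩
    gcongr
  have h1 : Tendsto (fun k => energyPair p θ (φ k) (u - φ k)) atTop (𝓝 0) := by
    refine tendsto_energyPair_zero hp hφ (fun k => sub_mem hu (hφ k)) hbound ?_
    refine hE.congr fun k => ?_
    rw [← energy_neg, neg_sub]
  have h2 : Tendsto (fun k => l * mass p (φ k) + p * energyPair p θ (φ k) (u - φ k)) atTop
      (𝓝 (l * mass p u + p * 0)) :=
    ((tendsto_mass H.isBounded hp hφ hlim).const_mul l).add (h1.const_mul p)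
  rw [mul_zero, add_zero] at h2
  refine le_of_tendsto' h2 fun k => ?_
  linarith [energy_tangent hp (hφ k) hu, h _ (hφ k) (hφt k)]

lemma firstEigenvalue_nonneg : 0 ≤ firstEigenvalue α p Ω := ENNReal.toReal_nonneg

lemma Admissible.firstEigenvalue_mul_mass_le (H : Admissible n p (α * p) Ω) :
    ∀ u ∈ energySpace p (α * p) Ω, firstEigenvalue α p Ω * mass p u ≤ energy p (α * p) u := by
  refine H.mul_mass_le_of_test fun φ hφ hφt => ?_
  have hp := H.two_le
  rcases eq_or_ne φ 0 with rfl | h0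
  · have : mass p (0 : Space n →ᵇ ℝ) = 0 := by
      simp [mass, powInt, Real.zero_rpow (show p ≠ 0 by linarith)]
    rw [this, mul_zero]
    exact energy_nonneg
  · have hm := mass_pos H.isBounded hp hφ h0
    rw [← le_div_iff₀ hm, firstEigenvalue]
    refine ENNReal.toReal_le_of_le_ofReal (div_nonneg energy_nonneg hm.le) ?_
    rw [← H.rayleigh_eq hφ h0]
    exact sInf_le ⟨φ, hφt, fun h => h0 (DFunLike.coe_injective h), rfl⟩

lemma Admissible.isEigen_firstEigenvalue (H : Admissible n p (α * p) Ω) :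
    IsEigen p (α * p) Ω (firstEigenvalue α p Ω) := by
  have hp := H.two_le
  set S := {r : ℝ≥0∞ | ∃ φ : Space n → ℝ, IsTest Ω φ ∧ φ ≠ 0 ∧ r = rayleigh α p φ} with hS
  have hSm : ∀ r ∈ S, ∃ u ∈ energySpace p (α * p) Ω, mass p u = 1 ∧
      r = ENNReal.ofReal (energy p (α * p) u) := by
    rintro r ⟨φ, hφ, h0, rfl⟩
    obtain ⟨f, hf, rfl⟩ := H.exists_energySpace_eq_test hφ
    have hf0 : f ≠ 0 := fun h => h0 (by rw [h]; rfl)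
    obtain ⟨c, hc, hcm⟩ := H.exists_smul_mass_eq_one hf hf0
    refine ⟨c • f, Submodule.smul_mem _ c hf, hcm, ?_⟩
    rw [H.rayleigh_eq hf hf0, energy_smul hc.le]
    rw [mass_smul hc.le] at hcm
    congr 1
    rw [div_eq_iff (mass_pos H.isBounded hp hf hf0).ne', mul_right_comm, hcm, one_mul]
  obtain ⟨φ, -, hφ, -, hφ0, -⟩ := exists_disjoint_tests H.one_le H.isOpen H.nonempty
  have hne : S.Nonempty := ⟨_, φ, hφ, hφ0, rfl⟩
  -- Finiteness of the infimum ensures that `toReal` in the definition of λ₁ does not return the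
  -- default value 0.
  have hfin : sInf S ≠ ⊤ := by
    obtain ⟨r, hr⟩ := hne
    obtain ⟨u, -, -, hu⟩ := hSm r hr
    exact ne_top_of_le_ne_top (hu ▸ ENNReal.ofReal_ne_top) (sInf_le hr)
  obtain ⟨r, -, hr, hrS⟩ := exists_seq_tendsto_sInf hne (OrderBot.bddBelow S)
  choose u hu hu1 hur using fun k => hSm (r k) (hrS k)
  have hlim : Tendsto (fun k => (r k).toReal) atTop (𝓝 (firstEigenvalue α p Ω)) :=
    (ENNReal.tendsto_toReal hfin).comp hr
  obtain ⟨v, hv, hv1, hvE, -⟩ := H.exists_limit_of_energy_le hu hu1 (fun k => by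
    rw [hur k, ENNReal.toReal_ofReal energy_nonneg]) hlim
  refine ⟨v, ne_zero_of_mass_eq_one hp hv1, H.solves_of_minimizer firstEigenvalue_nonneg
    H.firstEigenvalue_mul_mass_le hv ?_⟩
  rwa [hv1, mul_one]

lemma Admissible.nonempty_linkingLevels (H : Admissible n p θ Ω) : (linkingLevels p θ Ω).Nonempty := by
  obtain ⟨φ, ψ, hφ, hψ, hφ0, hψ0, hφp, hψp, hd⟩ := exists_disjoint_tests H.one_le H.isOpen H.nonempty
  obtain ⟨f, hf, rfl⟩ := H.exists_energySpace_eq_test hφ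
  obtain ⟨g, hg, rfl⟩ := H.exists_energySpace_eq_test hψ
  exact H.linkingLevels_nonempty hf hg hφp hψp (fun h => hφ0 (by rw [h]; rfl))
    (fun h => hψ0 (by rw [h]; rfl)) hd

end First

end FracEigen

theorem mainTheorem9 (n : ℕ) (hn : 1 ≤ n) (p α : ℝ) (hp : 2 ≤ p)
    (hα : 2 * (n : ℝ) < α * p) (hα' : α * p < n + p)
    (Ω : Set (FracEigen.Space n)) (hΩ : FracEigen.IsBoundedDomain Ω) :
    FracEigen.IsEigenvalue α p Ω (FracEigen.firstEigenvalue α p Ω) ∧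
    (∀ μ : ℕ → ℝ,
      (∀ k, FracEigen.IsEigenvalue α p Ω (μ k) ∧ μ k ≠ FracEigen.firstEigenvalue α p Ω) →
        ¬ Tendsto μ atTop (𝓝 (FracEigen.firstEigenvalue α p Ω))) ∧
    (FracEigen.higherEigenvalues α p Ω).Nonempty ∧
    FracEigen.firstEigenvalue α p Ω < FracEigen.secondEigenvalue α p Ω ∧
    FracEigen.IsEigenvalue α p Ω (FracEigen.secondEigenvalue α p Ω) := by
  have H : FracEigen.Admissible n p (α * p) Ω :=
    ⟨hn, hp, hα, hα', hΩ.isOpen, hΩ.isConnected.nonempty, hΩ.isBounded⟩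
  have h0 := FracEigen.firstEigenvalue_nonneg (α := α) (p := p) (Ω := Ω)
  have hl := H.firstEigenvalue_mul_mass_le
  have he := H.isEigen_firstEigenvalue
  have hisol : ∀ μ : ℕ → ℝ,
      (∀ k, FracEigen.IsEigenvalue α p Ω (μ k) ∧ μ k ≠ FracEigen.firstEigenvalue α p Ω) →
        ¬ Tendsto μ atTop (𝓝 (FracEigen.firstEigenvalue α p Ω)) := fun μ hμ =>
    H.isolated h0 hl he (fun k => H.isEigenvalue_iff.1 (hμ k).1) fun k => (hμ k).2
  have hne : (FracEigen.higherEigenvalues α p Ω).Nonempty :=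
    ⟨_, H.isEigenvalue_iff.2 (H.isEigen_sInf_linking h0 hl H.nonempty_linkingLevels),
      H.lt_sInf_linking h0 hl H.nonempty_linkingLevels⟩
  obtain ⟨l, -, hlim, hlS⟩ := exists_seq_tendsto_sInf hne ⟨_, fun _ hr => hr.2.le⟩
  refine ⟨H.isEigenvalue_iff.2 he, hisol, hne, ?_, ?_⟩
  -- Equality would make the minimising sequence of higher eigenvalues converge to λ₁, against
  -- isolation.
  · refine lt_of_le_of_ne (le_csInf hne fun _ hr => hr.2.le) fun heq => ?_
    refine hisol l (fun k => ⟨(hlS k).1, (hlS k).2.ne'⟩) ?_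
    rw [heq]
    exact hlim
  · exact H.isEigenvalue_iff.2 (H.isEigen_of_tendsto (fun k => H.isEigenvalue_iff.1 (hlS k).1) hlim)
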